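/- Let $n\ge 0$ and let $\dot{\mathfrak g}$ be a finite-dimensional complex Lie algebra. Let $\mathcal F=\mathcal F(\mathbb T^n)$ be the algebra of trigonometric polynomials on $\mathbb T^n=\mathbb R^n/\mathbb Z^n$, with basis $e^{2\pi i m\cdot x}$ ($m\in\mathbb Z^n$). Let $W_n$ be the Lie algebra of its derivations; it is a free $\mathcal F$-module with basis $d_j=\frac1{2\pi i}\frac{\partial}{\partial x^j}$ ($1\le j\le n$), and we put $d_j(s)=e^{2\pi i s\cdot x}d_j$ for $s\in\mathbb Z^n$. Let $\mathfrak g=W_n\ltimes(\mathcal F\otimes\dot{\mathfrak g})$, where $W_n$ acts on $\mathcal F\otimes\dot{\mathfrak g}$ through the first factor. On the polynomial side let $W_n^+=\mathrm{Span}\langle z^\alpha\frac{\partial}{\partial z_j} : \alpha\in\mathbb Z_{\ge0}^n\setminus\{0\},\ 1\le j\le n\rangle\subset \mathrm{Der}\,\mathbb C[z_1,\dots,z_n]$ and $\mathfrak g^+=W_n^+\ltimes(\mathbb C[z_1,\dots,z_n]\otimes\dot{\mathfrak g})$. Category $\mathcal J$ consists of the complex vector spaces $J$ that are modules both over $\mathfrak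 g$ and over the algebra $\mathcal F$ and satisfy: (J1) each $d_j$ acts diagonalizably on $J$; (J2) $J$ is a free $\mathcal F$-module of finite rank; (J3) $u(fw)=(uf)w+f(uw)$ for $u\in W_n$, $f\in\mathcal F$, $w\in J$; (J4) $y(fw)=f(yw)$ for $y\in\mathcal F\otimes\dot{\mathfrak g}$, $f\in\mathcal F$, $w\in J$. Submodules and isomorphisms in $\mathcal J$ are those respecting both $\mathfrak g$ and $\mathcal F$; indecomposable and irreducible modules are by definition non-zero. A module $J\in\mathcal J$ is called polynomial if it has an $\mathcal F$-basis $v_1,\dots,v_k$ such that for all $s,m\in\mathbb Z^n$, all $j$, $r$ and all $g\in\dot{\mathfrak g}$ $$d_j(s)\left(e^{2\pi i m\cdot x}v_r\right)=\sum_{\ell=1}^k f_{jr\ell}(s,m)\,e^{2\pi i(m+s)\cdot x}v_\ell,\qquad \left(e^{2\pi i s\cdot x}g\right)\left(e^{2\pi i m\cdot x}v_r\right)=\sum_{\ell=1}^k h_{gr\ell}(s,m)\,e^{2\pi i(m+s)\cdot x}v_\ell,$$ where all $f_{jr\ell}$ and $h_{gr\ell}$ are polynomials in $(s,m)$. Then: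 (a) Every $\mathfrak g$-module in category $\mathcal J$ is polynomial. (b) There is a bijection between the isomorphism classes of indecomposable modules $J$ in $\mathcal J$ and the pairs $(\lambda,[U])$ with $\lambda\in\mathbb C^n/\mathbb Z^n$ and $[U]$ the isomorphism class of a finite-dimensional indecomposable $\mathfrak g^+$-module $(U,\rho)$. It is characterized as follows: $J$ corresponds to $(\lambda,[U])$, for any representative $\lambda\in\mathbb C^n$, if and only if for every $j$ and every $g\in\dot{\mathfrak g}$ all but finitely many of the operators $\rho(z^\beta\frac{\partial}{\partial z_j})$ and of the operators $\rho(z^\beta g)$ are zero and there is an $\mathcal F$-linear isomorphism $J\cong\mathcal F\otimes U$ under which $$d_j(s)\left(e^{2\pi i m\cdot x}v\right)=(m_j+\lambda_j)\,e^{2\pi i(m+s)\cdot x}v+\sum_{\beta>0}\frac{s^\beta}{\beta!}\,e^{2\pi i(m+s)\cdot x}\rho\!\left(z^\beta\frac{\partial}{\partial z_j}\right)v,$$ $$\left(e^{2\pi i s\cdot x}g\right)\left(e^{2\pi i m\cdot x}v\right)=\sum_{\beta\ge0}\frac{s^\beta}{\beta!}\,e^{2\pi i(m+s)\cdot x}\rho\!\left(z^\beta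 g\right)v$$ for all $s,m\in\mathbb Z^n$, $1\le j\le n$, $g\in\dot{\mathfrak g}$, $v\in U$. (c) There is a bijection between the isomorphism classes of irreducible modules $J$ in $\mathcal J$ and the pairs $(\lambda,[V])$ with $\lambda\in\mathbb C^n/\mathbb Z^n$ and $[V]$ the isomorphism class of a finite-dimensional irreducible module $(V,\rho)$ over $gl_n(\mathbb C)\oplus\dot{\mathfrak g}$. It is characterized as follows: $J$ corresponds to $(\lambda,[V])$, for any representative $\lambda\in\mathbb C^n$, if and only if there is an $\mathcal F$-linear isomorphism $J\cong\mathcal F\otimes V$ under which $$d_j(s)\left(e^{2\pi i m\cdot x}v\right)=(m_j+\lambda_j)\,e^{2\pi i(m+s)\cdot x}v+\sum_{p=1}^n s_p\,e^{2\pi i(m+s)\cdot x}\rho(E_{pj})v,\qquad \left(e^{2\pi i s\cdot x}g\right)\left(e^{2\pi i m\cdot x}v\right)=e^{2\pi i(m+s)\cdot x}\rho(g)v,$$ where $E_{pj}$ is the matrix with entry $1$ in position $(p,j)$ and zeros elsewhere. -/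

import Mathlib

open scoped TensorProduct

universe u v

namespace JetModules

noncomputable section

/-! ## Functions and vector fields on the torus -/

/-- The algebra `F(𝕋ⁿ)` of trigonometric polynomials on the torus `ℝⁿ / ℤⁿ`: it has the basis
`e^{2πi m·x}`, `m ∈ ℤⁿ`, with `e^{2πi m·x} e^{2πi s·x} = e^{2πi (m+s)·x}`. -/
abbrev TorusFun (n : ℕ) : Type := AddMonoidAlgebra ℂ (Fin n → ℤ)

/-- The function `e^{2πi m·x}`. -/
def torusExp {n : ℕ} (m : Fin n → ℤ) : TorusFun n := AddMonoidAlgebra.single m 1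

/-- The Lie algebra `W_n` of vector fields on the torus: all derivations of `F(𝕋ⁿ)`. -/
abbrev VectTorus (n : ℕ) : Type := Derivation ℂ (TorusFun n) (TorusFun n)

/-- The linear operator `(1/2πi) ∂/∂xʲ`, `e^{2πi m·x} ↦ mⱼ e^{2πi m·x}`. -/
def partialLin {n : ℕ} (j : Fin n) : TorusFun n →ₗ[ℂ] TorusFun n :=
  (Finsupp.linearCombination ℂ fun m : Fin n → ℤ => (m j : ℂ) • torusExp m) ∘ₗ
    (AddMonoidAlgebra.coeffLinearEquiv ℂ).toLinearMap

theorem partialLin_single {n : ℕ} (j : Fin n) (m : Fin n → ℤ) (a : ℂ) :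
    partialLin j (AddMonoidAlgebra.single m a) = AddMonoidAlgebra.single m (a * (m j : ℂ)) := by
  simp [partialLin, torusExp]

theorem partialLin_mul {n : ℕ} (j : Fin n) (f h : TorusFun n) :
    partialLin j (f * h) = f • partialLin j h + h • partialLin j f := by
  induction f using AddMonoidAlgebra.induction_linear with
  | zero => simp
  | add f₁ f₂ h₁ h₂ => rw [add_mul, map_add, h₁, h₂, map_add, add_smul, smul_add]; abel
  | single m a =>
    induction h using AddMonoidAlgebra.induction_linear with
    | zero => simp
    | add f₁ f₂ h₁ h₂ => rw [mul_add, map_add, h₁, h₂, map_add, add_smul, smul_add]; abel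
    | single s b =>
      simp only [AddMonoidAlgebra.single_mul_single, partialLin_single, smul_eq_mul, Pi.add_apply,
        Int.cast_add, add_comm s m, ← AddMonoidAlgebra.single_add]
      congr 1
      ring

/-- The vector field `d_j = (1/2πi) ∂/∂xʲ`. -/
def d {n : ℕ} (j : Fin n) : VectTorus n := Derivation.mk' (partialLin j) (partialLin_mul j)

/-! ## The semidirect product with a multi-loop algebra -/

section Action

variable (A : Type) [CommRing A] [Algebra ℂ A] (g : Type u) [LieRing g] [LieAlgebra ℂ g]

/-- Derivations `D` of a commutative algebra `A` act on the Lie algebra `A ⊗ g` by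
`f ⊗ x ↦ D f ⊗ x`. -/
def derAct : Derivation ℂ A A →ₗ⁅ℂ⁆ LieDerivation ℂ (A ⊗[ℂ] g) (A ⊗[ℂ] g) where
  toFun D :=
    { toLinearMap := (D : A →ₗ[ℂ] A).rTensor g
      leibniz' := by
        intro a b
        induction a using TensorProduct.induction_on with
        | zero => simp
        | add a₁ a₂ h₁ h₂ => simp only [add_lie, map_add, lie_add, h₁, h₂]; abel
        | tmul f x =>
          induction b using TensorProduct.induction_on with
          | zero => simp
          | add a₁ a₂ h₁ h₂ => simp only [add_lie, map_add, lie_add, h₁, h₂]; abel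
          | tmul h y =>
            simp only [LieAlgebra.ExtendScalars.bracket_tmul, LinearMap.rTensor_tmul,
              Derivation.coeFn_coe, Derivation.leibniz, smul_eq_mul, TensorProduct.add_tmul]
            rw [← lie_skew y x, TensorProduct.tmul_neg, sub_neg_eq_add] }
  map_add' D D' := by
    ext t
    induction t using TensorProduct.induction_on with
    | zero => simp
    | add a₁ a₂ h₁ h₂ => simp only [map_add, h₁, h₂]
    | tmul f x => exact TensorProduct.add_tmul _ _ _
  map_smul' c D := by
    ext t
    induction t using TensorProduct.induction_on with
    | zero => simp
    | add a₁ a₂ h₁ h₂ => simp only [map_add, h₁, h₂]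
    | tmul f x => simp [TensorProduct.smul_tmul']
  map_lie' := by
    intro D D'
    ext t
    induction t using TensorProduct.induction_on with
    | zero => simp
    | add a₁ a₂ h₁ h₂ => simp only [map_add, h₁, h₂]
    | tmul f x =>
      change (D (D' f) - D' (D f)) ⊗ₜ[ℂ] x = D (D' f) ⊗ₜ[ℂ] x - D' (D f) ⊗ₜ[ℂ] x
      rw [TensorProduct.sub_tmul]

@[simp]
theorem derAct_tmul (D : Derivation ℂ A A) (f : A) (x : g) :
    derAct A g D (f ⊗ₜ[ℂ] x) = D f ⊗ₜ[ℂ] x := rfl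

end Action

/-- The Lie algebra `𝔤 = W_n ⋉ (F(𝕋ⁿ) ⊗ g)`. -/
abbrev TorusLie (n : ℕ) (g : Type u) [LieRing g] [LieAlgebra ℂ g] : Type u :=
  LieAlgebra.SemiDirectSum (TorusFun n ⊗[ℂ] g) (VectTorus n) (derAct (TorusFun n) g)

/-- A vector field, as an element of `𝔤`. -/
def vf {n : ℕ} {g : Type u} [LieRing g] [LieAlgebra ℂ g] (X : VectTorus n) : TorusLie n g :=
  LieAlgebra.SemiDirectSum.inr _ X

/-- An element of the multi-loop algebra `F(𝕋ⁿ) ⊗ g`, as an element of `𝔤`. -/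
def loop {n : ℕ} {g : Type u} [LieRing g] [LieAlgebra ℂ g] (y : TorusFun n ⊗[ℂ] g) :
    TorusLie n g :=
  LieAlgebra.SemiDirectSum.inl _ y

/-! ## The Lie algebra `𝔤⁺` -/

/-- The derivation `z^α ∂/∂z_j` of `ℂ[z₁, …, z_n]`. -/
def zd {n : ℕ} (α : Fin n →₀ ℕ) (j : Fin n) :
    Derivation ℂ (MvPolynomial (Fin n) ℂ) (MvPolynomial (Fin n) ℂ) :=
  MvPolynomial.monomial α (1 : ℂ) • MvPolynomial.pderiv j

theorem lie_zd_zd {n : ℕ} (α β : Fin n →₀ ℕ) (j k : Fin n) :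
    ⁅zd α j, zd β k⁆ = (β j : ℂ) • zd (α + (β - Finsupp.single j 1)) k -
      (α k : ℂ) • zd (β + (α - Finsupp.single k 1)) j := by
  classical
  refine MvPolynomial.derivation_ext fun i => ?_
  simp only [Derivation.commutator_apply, zd, Derivation.smul_apply, Derivation.sub_apply,
    MvPolynomial.pderiv_X, smul_eq_mul]
  by_cases hk : k = i <;> by_cases hj : j = i <;>
    simp [hk, hj, MvPolynomial.pderiv_monomial, MvPolynomial.monomial_mul,
      MvPolynomial.smul_monomial, eq_comm]

theorem lie_mem_span {L : Type u} [LieRing L] [LieAlgebra ℂ L] (S : Set L)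
    (h : ∀ x ∈ S, ∀ y ∈ S, ⁅x, y⁆ ∈ Submodule.span ℂ S) {x y : L}
    (hx : x ∈ Submodule.span ℂ S) (hy : y ∈ Submodule.span ℂ S) : ⁅x, y⁆ ∈ Submodule.span ℂ S := by
  induction hx using Submodule.span_induction with
  | zero => simp
  | add x₁ x₂ _ _ h₁ h₂ => rw [add_lie]; exact Submodule.add_mem _ h₁ h₂
  | smul c x₁ _ h₁ => rw [smul_lie]; exact Submodule.smul_mem _ c h₁
  | mem x hx =>
    induction hy using Submodule.span_induction with
    | zero => simp
    | add x₁ x₂ _ _ h₁ h₂ => rw [lie_add]; exact Submodule.add_mem _ h₁ h₂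
    | smul c x₁ _ h₁ => rw [lie_smul]; exact Submodule.smul_mem _ c h₁
    | mem y hy => exact h x hx y hy

/-- The Lie algebra `W_n⁺ = Span ⟨z^α ∂/∂z_j : α ≠ 0⟩`. -/
def WPlus (n : ℕ) :
    LieSubalgebra ℂ (Derivation ℂ (MvPolynomial (Fin n) ℂ) (MvPolynomial (Fin n) ℂ)) where
  __ := Submodule.span ℂ {D | ∃ (α : Fin n →₀ ℕ) (j : Fin n), α ≠ 0 ∧ D = zd α j}
  lie_mem' := by
    intro x y hx hy
    refine lie_mem_span _ ?_ hx hy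
    rintro _ ⟨α, j, hα, rfl⟩ _ ⟨β, k, hβ, rfl⟩
    rw [lie_zd_zd]
    refine Submodule.sub_mem _ (Submodule.smul_mem _ _ (Submodule.subset_span ?_))
      (Submodule.smul_mem _ _ (Submodule.subset_span ?_))
    · exact ⟨_, _, fun h => hα (add_eq_zero.mp h).1, rfl⟩
    · exact ⟨_, _, fun h => hβ (add_eq_zero.mp h).1, rfl⟩

/-- The Lie algebra `𝔤⁺ = W_n⁺ ⋉ (ℂ[z₁, …, z_n] ⊗ g)`. -/
abbrev PolyLie (n : ℕ) (g : Type u) [LieRing g] [LieAlgebra ℂ g] : Type u :=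
  LieAlgebra.SemiDirectSum (MvPolynomial (Fin n) ℂ ⊗[ℂ] g) (WPlus n)
    ((derAct (MvPolynomial (Fin n) ℂ) g).comp (WPlus n).incl)

/-- The element `z^β ∂/∂z_j`, `β ≠ 0`, of `𝔤⁺`. -/
def zdPlus {n : ℕ} {g : Type u} [LieRing g] [LieAlgebra ℂ g] (β : {β : Fin n →₀ ℕ // β ≠ 0})
    (j : Fin n) : PolyLie n g :=
  LieAlgebra.SemiDirectSum.inr _ ⟨zd β.1 j, Submodule.subset_span ⟨β.1, j, β.2, rfl⟩⟩

/-- The element `z^β x` of `𝔤⁺`. -/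
def zPlus {n : ℕ} {g : Type u} [LieRing g] [LieAlgebra ℂ g] (β : Fin n →₀ ℕ) (x : g) :
    PolyLie n g :=
  LieAlgebra.SemiDirectSum.inl _ (MvPolynomial.monomial β (1 : ℂ) ⊗ₜ[ℂ] x)

/-! ## The category `𝒥` -/

section Category

variable (n : ℕ) (g : Type u) [LieRing g] [LieAlgebra ℂ g]

/-- The conditions defining the category `𝒥`, for a vector space `J` that is both a module over `F(𝕋ⁿ)` and over
`𝔤`. -/
structure InCategoryJ (J : Type v) [AddCommGroup J] [Module ℂ J] [Module (TorusFun n) J]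
    [LieRingModule (TorusLie n g) J] [LieModule ℂ (TorusLie n g) J] : Prop where
  /-- Each `d_j` acts diagonalizably. -/
  diagonalizable : ∀ j : Fin n, ⨆ μ : ℂ,
    Module.End.eigenspace (LieModule.toEnd ℂ (TorusLie n g) J (vf (d j))) μ = ⊤
  /-- `J` is a free module over the algebra of functions ... -/
  free : Module.Free (TorusFun n) J
  /-- ... of finite rank. -/
  finite : Module.Finite (TorusFun n) J
  /-- Vector fields satisfy the Leibniz rule. -/
  vf_smul : ∀ (X : VectTorus n) (f : TorusFun n) (w : J),
    ⁅(vf X : TorusLie n g), f • w⁆ = X f • w + f • ⁅(vf X : TorusLie n g), w⁆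
  /-- The multi-loop algebra acts linearly over functions. -/
  loop_smul : ∀ (y : TorusFun n ⊗[ℂ] g) (f : TorusFun n) (w : J),
    ⁅(loop y : TorusLie n g), f • w⁆ = f • ⁅(loop y : TorusLie n g), w⁆

/-- The objects of the category `𝒥`. -/
structure JMod where
  carrier : Type v
  [addCommGroup : AddCommGroup carrier]
  [module : Module ℂ carrier]
  [funModule : Module (TorusFun n) carrier]
  [isScalarTower : IsScalarTower ℂ (TorusFun n) carrier]
  [lieRingModule : LieRingModule (TorusLie n g) carrier]
  [lieModule : LieModule ℂ (TorusLie n g) carrier]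
  inCategory : InCategoryJ n g carrier

attribute [instance] JMod.addCommGroup JMod.module JMod.funModule JMod.isScalarTower
  JMod.lieRingModule JMod.lieModule

end Category

namespace JMod

variable {n : ℕ} {g : Type u} [LieRing g] [LieAlgebra ℂ g]

/-- Isomorphism in `𝒥`: a bijection commuting with functions and with `𝔤`. -/
def Iso (J J' : JMod.{u, v} n g) : Prop :=
  ∃ e : J.carrier ≃ₗ[TorusFun n] J'.carrier,
    ∀ (x : TorusLie n g) (w : J.carrier), e ⁅x, w⁆ = ⁅x, e w⁆

instance isoSetoid : Setoid (JMod.{u, v} n g) where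
  r := Iso
  iseqv :=
    { refl := fun _ => ⟨LinearEquiv.refl _ _, fun _ _ => rfl⟩
      symm := by
        rintro _ _ ⟨e, he⟩
        refine ⟨e.symm, fun x w => ?_⟩
        rw [LinearEquiv.symm_apply_eq, he, LinearEquiv.apply_symm_apply]
      trans := by
        rintro _ _ _ ⟨e, he⟩ ⟨e', he'⟩
        exact ⟨e.trans e', fun x w => by simp [he, he']⟩ }

/-- A `𝔤`-stable subspace is a submodule in `𝒥` if it is also stable under functions. -/
def FunStable (J : JMod.{u, v} n g) (N : LieSubmodule ℂ (TorusLie n g) J.carrier) : Prop :=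
  ∀ (f : TorusFun n) (w : J.carrier), w ∈ N → f • w ∈ N

/-- `J` is non-zero and not a direct sum of two non-zero submodules. -/
def IsIndecomposable (J : JMod.{u, v} n g) : Prop :=
  Nontrivial J.carrier ∧ ∀ N N' : LieSubmodule ℂ (TorusLie n g) J.carrier,
    J.FunStable N → J.FunStable N' → IsCompl N N' → N = ⊥ ∨ N' = ⊥

/-- `J` is non-zero and has no submodules other than `0` and `J`. -/
def IsIrreducible (J : JMod.{u, v} n g) : Prop :=
  Nontrivial J.carrier ∧ ∀ N : LieSubmodule ℂ (TorusLie n g) J.carrier,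
    J.FunStable N → N = ⊥ ∨ N = ⊤

/-- `J` is a polynomial module: in some basis `v_r` of `J` over functions, the coefficients of
`d_j(s) (e^{2πi m·x} v_r)` and, for each `x ∈ g`, of `(e^{2πi s·x} x) (e^{2πi m·x} v_r)` along
`e^{2πi (m+s)·x} v_l` are polynomials in `s` and `m`, and there are no other terms. -/
def IsPolynomial (J : JMod.{u, v} n g) : Prop :=
  ∃ (k : ℕ) (b : Module.Basis (Fin k) (TorusFun n) J.carrier)
    (P : Fin n → Fin k → Fin k → MvPolynomial (Fin n ⊕ Fin n) ℂ)
    (Q : g → Fin k → Fin k → MvPolynomial (Fin n ⊕ Fin n) ℂ),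
    (∀ (j : Fin n) (s m : Fin n → ℤ) (r : Fin k),
      ⁅(vf (torusExp s • d j) : TorusLie n g), torusExp m • b r⁆ =
        ∑ l, MvPolynomial.eval (Sum.elim (fun i => (s i : ℂ)) (fun i => (m i : ℂ))) (P j r l) •
          (torusExp (m + s) • b l)) ∧
    (∀ (x : g) (s m : Fin n → ℤ) (r : Fin k),
      ⁅(loop (torusExp s ⊗ₜ[ℂ] x) : TorusLie n g), torusExp m • b r⁆ =
        ∑ l, MvPolynomial.eval (Sum.elim (fun i => (s i : ℂ)) (fun i => (m i : ℂ))) (Q x r l) •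
          (torusExp (m + s) • b l))

end JMod

/-! ## Finite-dimensional modules -/

/-- Finite-dimensional modules over a complex Lie algebra. -/
structure FDMod (L : Type u) [LieRing L] [LieAlgebra ℂ L] where
  carrier : Type v
  [addCommGroup : AddCommGroup carrier]
  [module : Module ℂ carrier]
  [lieRingModule : LieRingModule L carrier]
  [lieModule : LieModule ℂ L carrier]
  [finiteDimensional : FiniteDimensional ℂ carrier]

attribute [instance] FDMod.addCommGroup FDMod.module FDMod.lieRingModule FDMod.lieModule
  FDMod.finiteDimensional

namespace FDMod

variable {L : Type u} [LieRing L] [LieAlgebra ℂ L]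

instance isoSetoid : Setoid (FDMod.{u, v} L) where
  r U U' := Nonempty (U.carrier ≃ₗ⁅ℂ, L⁆ U'.carrier)
  iseqv :=
    { refl := fun _ => ⟨LieModuleEquiv.refl⟩
      symm := fun ⟨e⟩ => ⟨e.symm⟩
      trans := fun ⟨e⟩ ⟨e'⟩ => ⟨e.trans e'⟩ }

/-- `U` is non-zero and not a direct sum of two non-zero submodules. -/
def IsIndecomposable (U : FDMod.{u, v} L) : Prop :=
  Nontrivial U.carrier ∧ ∀ N N' : LieSubmodule ℂ L U.carrier, IsCompl N N' → N = ⊥ ∨ N' = ⊥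

/-- `U` is an irreducible module. -/
def IsIrreducible (U : FDMod.{u, v} L) : Prop := LieModule.IsIrreducible ℂ L U.carrier

end FDMod

/-- The Lie algebra `gl_n(ℂ)`: matrices with the commutator bracket. -/
instance glLieRing (n : ℕ) : LieRing (Matrix (Fin n) (Fin n) ℂ) := LieRing.ofAssociativeRing

instance glLieAlgebra (n : ℕ) : LieAlgebra ℂ (Matrix (Fin n) (Fin n) ℂ) :=
  LieAlgebra.ofAssociativeAlgebra

/-! ## Isomorphism classes -/

/-- Isomorphism classes of the elements of `X` that satisfy `p`. -/
abbrev Classes {X : Type v} [s : Setoid X] (p : X → Prop) : Type v :=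
  Quotient (s.comap (Subtype.val : {x // p x} → X))

/-- The isomorphism class of an element of `X` that satisfies `p`. -/
def cls {X : Type v} [s : Setoid X] {p : X → Prop} (x : {x // p x}) : Classes p :=
  Quotient.mk (s.comap (Subtype.val : {x // p x} → X)) x

/-- The subgroup `ℤⁿ` of `ℂⁿ`. -/
def intLattice (n : ℕ) : AddSubgroup (Fin n → ℂ) :=
  ((Int.castAddHom ℂ).compLeft (Fin n)).range

/-! ## The tensor product decompositions -/

/-- The number `s^β / β!`. -/
def coef {n : ℕ} (s : Fin n → ℤ) (β : Fin n →₀ ℕ) : ℂ :=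
  (∏ i, (s i : ℂ) ^ β i) / ∏ i, ((β i).factorial : ℂ)

variable {n : ℕ} {g : Type u} [LieRing g] [LieAlgebra ℂ g]

/-- `J` is isomorphic, over functions, to `F(𝕋ⁿ) ⊗ U`, where `𝔤` acts through
`d_j(s) (e^{2πi m·x} v) = (m_j + λ_j) e^{2πi (m+s)·x} v + ∑_{β > 0} (s^β / β!) e^{2πi (m+s)·x} ρ(z^β ∂/∂z_j) v`
and `(e^{2πi s·x} x) (e^{2πi m·x} v) = ∑_{β ≥ 0} (s^β / β!) e^{2πi (m+s)·x} ρ(z^β x) v`;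
both sums are finite because all but finitely many of the operators `ρ(z^β ∂/∂z_j)`, `ρ(z^β x)`
are zero. -/
def JetRealizes (J : JMod.{u, v} n g) (lam : Fin n → ℂ) (U : FDMod.{u, v} (PolyLie n g)) : Prop :=
  (∀ j : Fin n, {β | LieModule.toEnd ℂ (PolyLie n g) U.carrier (zdPlus β j) ≠ 0}.Finite) ∧
  (∀ x : g, {β | LieModule.toEnd ℂ (PolyLie n g) U.carrier (zPlus β x) ≠ 0}.Finite) ∧
  ∃ e : (TorusFun n ⊗[ℂ] U.carrier) ≃ₗ[TorusFun n] J.carrier,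
    (∀ (j : Fin n) (s m : Fin n → ℤ) (w : U.carrier),
      ⁅(vf (torusExp s • d j) : TorusLie n g), e (torusExp m ⊗ₜ[ℂ] w)⁆ =
        e (((m j : ℂ) + lam j) • (torusExp (m + s) ⊗ₜ[ℂ] w) +
          ∑ᶠ β : {β : Fin n →₀ ℕ // β ≠ 0},
            coef s β.1 • (torusExp (m + s) ⊗ₜ[ℂ] ⁅(zdPlus β j : PolyLie n g), w⁆))) ∧
    (∀ (x : g) (s m : Fin n → ℤ) (w : U.carrier),
      ⁅(loop (torusExp s ⊗ₜ[ℂ] x) : TorusLie n g), e (torusExp m ⊗ₜ[ℂ] w)⁆ =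
        e (∑ᶠ β : Fin n →₀ ℕ,
          coef s β • (torusExp (m + s) ⊗ₜ[ℂ] ⁅(zPlus β x : PolyLie n g), w⁆)))

/-- `J` is isomorphic, over functions, to `F(𝕋ⁿ) ⊗ V`, where `𝔤` acts through
`d_j(s) (e^{2πi m·x} v) = (m_j + λ_j) e^{2πi (m+s)·x} v + ∑_p s_p e^{2πi (m+s)·x} E_{pj} v`
and `(e^{2πi s·x} x) (e^{2πi m·x} v) = e^{2πi (m+s)·x} (x v)`. -/
def TensorRealizes (J : JMod.{u, v} n g) (lam : Fin n → ℂ)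
    (V : FDMod.{u, v} (Matrix (Fin n) (Fin n) ℂ × g)) : Prop :=
  ∃ e : (TorusFun n ⊗[ℂ] V.carrier) ≃ₗ[TorusFun n] J.carrier,
    (∀ (j : Fin n) (s m : Fin n → ℤ) (w : V.carrier),
      ⁅(vf (torusExp s • d j) : TorusLie n g), e (torusExp m ⊗ₜ[ℂ] w)⁆ =
        e (((m j : ℂ) + lam j) • (torusExp (m + s) ⊗ₜ[ℂ] w) +
          ∑ p : Fin n, (s p : ℂ) • (torusExp (m + s) ⊗ₜ[ℂ]
            ⁅((Matrix.single p j (1 : ℂ), 0) : Matrix (Fin n) (Fin n) ℂ × g), w⁆))) ∧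
    (∀ (x : g) (s m : Fin n → ℤ) (w : V.carrier),
      ⁅(loop (torusExp s ⊗ₜ[ℂ] x) : TorusLie n g), e (torusExp m ⊗ₜ[ℂ] w)⁆ =
        e (torusExp (m + s) ⊗ₜ[ℂ] ⁅((0, x) : Matrix (Fin n) (Fin n) ℂ × g), w⁆))

end

end JetModules

open scoped TensorProduct

namespace JetModules

noncomputable section

/-! ### Trigonometric polynomials and vector fields on the torus -/

section Torus

variable {n : ℕ} {M : Type*} [AddCommGroup M] [Module ℂ M]

/-! The commuting diagonalizable operators `d j` split `J` into weight spaces, and multiplication by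
`e^{2πi m·x}` shifts weights by `m`. If `U` is the sum of the weight spaces over one representative
of each coset of `ℤⁿ`, then `J ≅ F ⊗ U` and `U` is finite-dimensional (`IsTransversal.equiv`,
`finiteDimensional_of_equiv`). By the Leibniz rule and `F`-linearity the action is determined by the
operators `D j s = e^{-2πi s·x} d_j(s)` and `G s x = e^{-2πi s·x} (e^{2πi s·x} x)` on `U`, and being
a `𝔤`-module amounts to the relations `JetRel`.

The heart is that `D` and `G` are polynomial in `s`. Extend `s ↦ D j s - D j 0` linearly to `F`: the
operator attached to `f` then behaves like the vector field `(f - f(0)) d_j`, which vanishes at the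
origin (`JetRel.vfSymbol_comm`). So the vector fields vanishing at a point act on a
finite-dimensional space. With `t_i = e^{2πi xⁱ} - 1`, the fields `t_i^k ∂/∂t_i` have pairwise
different eigenvalues `k - 1` under `ad (t_i ∂/∂t_i)`, so almost all of them act by zero, and a few
more brackets show that the whole ideal generated by some powers `t_i^N` acts by zero
(`exists_pow_mul_eq_zero`, `JetRel.exists_killsPow`). Modulo this ideal `z_i = log (1 + t_i)` is a
polynomial in `t_i`, the derivation `d_j` becomes `∂/∂z_j`, and `e^{2πi s·x} = exp (∑ s_i z_i) = ∑
(s^β / β!) z^β` (`KillsPow.torusExp_eq_sum`). Substituting logarithms makes `U` a `𝔤⁺`-module, and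
the expansion of the exponential is the asserted formula (`JetRel.exists_polyHom`); this gives (a).

Conversely, in a finite-dimensional `𝔤⁺`-module the Euler field forces monomials of high degree to
act by zero, so truncated exponentials define operators satisfying `JetRel`, hence a module in `𝒥`
(`exists_isJet`, `jetMod`).

For (b), the weights in a coset of `ℤⁿ` and those outside it give complementary submodules, so an
indecomposable `J` has its weights in one coset and `U` is a single weight space, on which `D j 0`
is the scalar `λ_j`. A polynomial in `s` with values in a subspace for all `s ∈ ℤⁿ` has its
coefficients there (`mem_of_sum_coef_mem`). Hence submodules of `J` correspond to `𝔤⁺`-submodules of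
`U`, and isomorphisms of `J` induce isomorphisms of `U` (`Realizes.isIndecomposable_iff`,
`Realizes.unique`).

For (c), taking linear parts maps `𝔤⁺` onto `gl_n ⊕ g`, with kernel spanned by elements that raise
Euler eigenvalues. An Euler eigenvector whose eigenvalue has maximal real part is killed by the
kernel, and the vectors killed by an ideal form a submodule. So an irreducible `U` comes from `gl_n
⊕ g` (`FDMod.IsIrreducible.exists_pull`), and only the terms of lowest degree survive in the
formulas. -/

theorem torusExp_mul (m s : Fin n → ℤ) : torusExp m * torusExp s = torusExp (m + s) := by
  simp [torusExp, AddMonoidAlgebra.single_mul_single]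

theorem torusExp_zero : torusExp (0 : Fin n → ℤ) = 1 := rfl

theorem torusExp_neg_mul (m : Fin n → ℤ) : torusExp (-m) * torusExp m = 1 := by
  rw [torusExp_mul, neg_add_cancel, torusExp_zero]

theorem single_eq_smul_torusExp (m : Fin n → ℤ) (a : ℂ) :
    (AddMonoidAlgebra.single m a : TorusFun n) = a • torusExp m := by
  simp [torusExp]

/-- The linear map on trigonometric polynomials with prescribed values on exponentials. -/
def torusLin (φ : (Fin n → ℤ) → M) : TorusFun n →ₗ[ℂ] M :=
  Finsupp.linearCombination ℂ φ ∘ₗ (AddMonoidAlgebra.coeffLinearEquiv ℂ).toLinearMap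

@[simp]
theorem torusLin_torusExp (φ : (Fin n → ℤ) → M) (m : Fin n → ℤ) :
    torusLin φ (torusExp m) = φ m := by
  simp [torusLin, torusExp]

theorem torusFun_induction {p : TorusFun n → Prop} (h0 : p 0)
    (hadd : ∀ f h, p f → p h → p (f + h)) (hexp : ∀ (c : ℂ) m, p (c • torusExp m))
    (f : TorusFun n) : p f := by
  induction f using AddMonoidAlgebra.induction_linear with
  | zero => exact h0
  | add f h hf hh => exact hadd _ _ hf hh
  | single m a => rw [single_eq_smul_torusExp]; exact hexp a m

theorem torusFun_hom_ext {f h : TorusFun n →ₗ[ℂ] M}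
    (hfh : ∀ m, f (torusExp m) = h (torusExp m)) : f = h := by
  refine LinearMap.ext fun x => ?_
  induction x using torusFun_induction with
  | h0 => simp
  | hadd x y hx hy => simp [hx, hy]
  | hexp c m => simp [hfh]

@[simp]
theorem d_torusExp (j : Fin n) (m : Fin n → ℤ) :
    d j (torusExp m) = (m j : ℂ) • torusExp m := by
  change partialLin j _ = _
  rw [torusExp, partialLin_single, one_mul, single_eq_smul_torusExp, torusExp]

/-- The coefficient of a vector field along `d_j`. -/
def vfCoeff (j : Fin n) : VectTorus n →ₗ[ℂ] TorusFun n where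
  toFun X := torusExp (-Pi.single j 1) * X (torusExp (Pi.single j 1))
  map_add' X Y := by simp [mul_add]
  map_smul' c X := by simp

theorem vfCoeff_apply (j : Fin n) (X : VectTorus n) :
    vfCoeff j X = torusExp (-Pi.single j 1) * X (torusExp (Pi.single j 1)) := rfl

theorem sum_smul_d_apply (a : Fin n → TorusFun n) (f : TorusFun n) :
    (∑ j, a j • d j : VectTorus n) f = ∑ j, a j * d j f := by
  rw [← Derivation.coeFnAddMonoidHom_apply, map_sum, Finset.sum_apply]
  rfl

theorem vfCoeff_smul_d (j k : Fin n) (f : TorusFun n) :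
    vfCoeff j (f • d k) = if k = j then f else 0 := by
  rw [vfCoeff_apply, Derivation.smul_apply, d_torusExp]
  split_ifs with h
  · subst h
    simp only [Pi.single_eq_same, Int.cast_one, one_smul, smul_eq_mul]
    rw [mul_left_comm, torusExp_neg_mul, mul_one]
  · simp [Pi.single_eq_of_ne h]

/-- A derivation of `F` is determined by its values on the functions `e^{2πi xʲ}`, and the sum
agrees with `X` on those. -/
theorem sum_vfCoeff_smul_d (X : VectTorus n) : ∑ j, vfCoeff j X • d j = X := by
  have key : ∀ Y : VectTorus n, (∀ j, Y (torusExp (Pi.single j 1)) = 0) → Y = 0 := by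
    intro Y hY
    -- The logarithmic derivative `m ↦ e^{-2πi m·x} Y(e^{2πi m·x})`: the Leibniz rule makes it
    -- additive in `m`, so it vanishes once it vanishes on the standard basis of `ℤⁿ`.
    let δ : (Fin n → ℤ) →+ TorusFun n :=
      { toFun := fun m => torusExp (-m) * Y (torusExp m)
        map_zero' := by rw [torusExp_zero, Y.map_one_eq_zero, mul_zero]
        map_add' := fun a b => by
          rw [← torusExp_mul a b, Y.leibniz, neg_add, ← torusExp_mul, smul_eq_mul, smul_eq_mul]
          linear_combination (torusExp (-b) * Y (torusExp b)) * torusExp_neg_mul a +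
            (torusExp (-a) * Y (torusExp a)) * torusExp_neg_mul b }
    have hδ : δ = 0 := by
      refine AddMonoidHom.functions_ext _ _ _ fun j z => ?_
      have h1 : δ (Pi.single j 1) = 0 := by
        change torusExp _ * Y _ = 0
        rw [hY, mul_zero]
      have h2 : (Pi.single j z : Fin n → ℤ) = z • Pi.single j 1 := by
        rw [← Pi.single_smul]; simp
      rw [h2, map_zsmul, h1]
      simp
    refine Derivation.ext fun f => ?_
    have : (Y : TorusFun n →ₗ[ℂ] TorusFun n) = 0 := torusFun_hom_ext fun m => by
      have h1 : torusExp (-m) * Y (torusExp m) = 0 := DFunLike.congr_fun hδ m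
      have h2 := congrArg (torusExp m * ·) h1
      simp only [mul_zero, ← mul_assoc, torusExp_mul, add_neg_cancel, torusExp_zero, one_mul] at h2
      exact h2
    exact LinearMap.congr_fun this f
  refine sub_eq_zero.mp (key _ fun k => ?_)
  rw [Derivation.sub_apply, sum_smul_d_apply, sub_eq_zero, Finset.sum_eq_single k]
  · rw [d_torusExp, Pi.single_eq_same, Int.cast_one, one_smul, vfCoeff_apply]
    rw [mul_right_comm, torusExp_neg_mul, one_mul]
  · intro j _ hj
    rw [d_torusExp, Pi.single_eq_of_ne hj]
    simp
  · simp

theorem vectTorus_hom_ext {f h : VectTorus n →ₗ[ℂ] M}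
    (hfh : ∀ (j : Fin n) (s : Fin n → ℤ), f (torusExp s • d j) = h (torusExp s • d j)) : f = h := by
  ext X
  rw [← sum_vfCoeff_smul_d X, map_sum, map_sum]
  refine Finset.sum_congr rfl fun j _ => ?_
  have : f ∘ₗ (LinearMap.toSpanSingleton (TorusFun n) _ (d j)).restrictScalars ℂ =
      h ∘ₗ (LinearMap.toSpanSingleton (TorusFun n) _ (d j)).restrictScalars ℂ :=
    torusFun_hom_ext fun m => by simpa using hfh j m
  simpa using LinearMap.congr_fun this (vfCoeff j X)

theorem lie_torusExp_smul_d (j k : Fin n) (s r : Fin n → ℤ) :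
    ⁅(torusExp s • d j : VectTorus n), torusExp r • d k⁆ =
      (r j : ℂ) • (torusExp (s + r) • d k) - (s k : ℂ) • (torusExp (s + r) • d j) := by
  refine Derivation.ext fun f => ?_
  have hcomm : d j (d k f) = d k (d j f) := by
    induction f using torusFun_induction with
    | h0 => simp
    | hadd x y hx hy => simp only [map_add, hx, hy]
    | hexp c m =>
      simp only [Derivation.map_smul, d_torusExp]
      rw [smul_comm (m k : ℂ)]
  simp only [Derivation.commutator_apply, Derivation.smul_apply, Derivation.sub_apply, smul_eq_mul,
    Derivation.leibniz, d_torusExp, hcomm, ← torusExp_mul, mul_smul_comm]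
  simp only [Algebra.smul_def]
  ring

theorem smul_d_apply_torusExp (j : Fin n) (s r : Fin n → ℤ) :
    (torusExp s • d j : VectTorus n) (torusExp r) = (r j : ℂ) • torusExp (r + s) := by
  rw [Derivation.smul_apply, d_torusExp, smul_comm, smul_eq_mul, torusExp_mul, add_comm]

end Torus

/-! ### Homomorphisms out of a semidirect sum -/

section SemiDirectSum

open LieAlgebra.SemiDirectSum

variable {R K L : Type*} [CommRing R] [LieRing K] [LieAlgebra R K] [LieRing L] [LieAlgebra R L]
variable (ψ : L →ₗ⁅R⁆ LieDerivation R K K)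

theorem lie_inr_inl (l : L) (k : K) : ⁅inr ψ l, inl ψ k⁆ = inl ψ (ψ l k) := by
  simp

theorem semiDirectSum_eq (x : LieAlgebra.SemiDirectSum K L ψ) :
    x = inl ψ x.left + inr ψ x.right := by
  ext <;> simp

/-- A homomorphism from a semidirect sum, from homomorphisms on the two summands. -/
def semiDirectLift {M : Type*} [LieRing M] [LieAlgebra R M] (a : K →ₗ⁅R⁆ M) (b : L →ₗ⁅R⁆ M)
    (hab : ∀ l k, ⁅b l, a k⁆ = a (ψ l k)) : LieAlgebra.SemiDirectSum K L ψ →ₗ⁅R⁆ M where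
  toFun x := a x.left + b x.right
  map_add' x y := by simp only [add_eq_mk, map_add]; abel
  map_smul' c x := by simp only [smul_eq_mk, map_smul, smul_add, RingHom.id_apply]
  map_lie' := by
    intro x y
    simp only [lie_eq_mk, map_add, map_sub, LieHom.map_lie, ← hab, lie_add, add_lie]
    rw [← lie_skew (a x.left) (b y.right)]
    abel

theorem semiDirectLift_inl {M : Type*} [LieRing M] [LieAlgebra R M] (a : K →ₗ⁅R⁆ M)
    (b : L →ₗ⁅R⁆ M) (hab : ∀ l k, ⁅b l, a k⁆ = a (ψ l k)) (k : K) :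
    semiDirectLift ψ a b hab (inl ψ k) = a k := by
  change a k + b 0 = _
  rw [map_zero, add_zero]

theorem semiDirectLift_inr {M : Type*} [LieRing M] [LieAlgebra R M] (a : K →ₗ⁅R⁆ M)
    (b : L →ₗ⁅R⁆ M) (hab : ∀ l k, ⁅b l, a k⁆ = a (ψ l k)) (l : L) :
    semiDirectLift ψ a b hab (inr ψ l) = b l := by
  change a 0 + b l = _
  rw [map_zero, zero_add]

end SemiDirectSum

/-! ### Brackets and linear maps on `𝔤` -/

section TorusLie

variable {n : ℕ} {g : Type u} [LieRing g] [LieAlgebra ℂ g]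
variable {M : Type*} [AddCommGroup M] [Module ℂ M]

theorem torusLie_eq (x : TorusLie n g) : x = loop x.left + vf x.right :=
  semiDirectSum_eq _ x

/-- `vf` as a linear map. -/
def vfLin : VectTorus n →ₗ[ℂ] TorusLie n g := 
  (LieAlgebra.SemiDirectSum.inr (derAct (TorusFun n) g)).toLinearMap

/-- `loop` as a linear map. -/
def loopLin : TorusFun n ⊗[ℂ] g →ₗ[ℂ] TorusLie n g := 
  (LieAlgebra.SemiDirectSum.inl (derAct (TorusFun n) g)).toLinearMap

theorem vfLin_apply (X : VectTorus n) : vfLin X = (vf X : TorusLie n g) := rfl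

theorem loopLin_apply (y : TorusFun n ⊗[ℂ] g) : loopLin y = (loop y : TorusLie n g) := rfl

theorem tensor_hom_ext {V : Type*} [AddCommGroup V] [Module ℂ V]
    {f h : TorusFun n ⊗[ℂ] V →ₗ[ℂ] M}
    (hfh : ∀ m w, f (torusExp m ⊗ₜ w) = h (torusExp m ⊗ₜ w)) : f = h := by
  refine TensorProduct.ext (torusFun_hom_ext fun m => ?_)
  ext w
  exact hfh m w

theorem torusLie_hom_ext {f h : TorusLie n g →ₗ[ℂ] M}
    (hv : ∀ (j : Fin n) (s : Fin n → ℤ), f (vf (torusExp s • d j)) = h (vf (torusExp s • d j)))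
    (hl : ∀ (s : Fin n → ℤ) (x : g), f (loop (torusExp s ⊗ₜ x)) = h (loop (torusExp s ⊗ₜ x))) : f = h := by
  have h1 : f ∘ₗ vfLin = h ∘ₗ vfLin := vectTorus_hom_ext hv
  have h2 : f ∘ₗ loopLin = h ∘ₗ loopLin := tensor_hom_ext hl
  ext x
  rw [torusLie_eq x, map_add, map_add]
  exact congrArg₂ _ (LinearMap.congr_fun h2 _) (LinearMap.congr_fun h1 _)

theorem lie_vf_vf (X Y : VectTorus n) : ⁅(vf X : TorusLie n g), (vf Y : TorusLie n g)⁆ = vf ⁅X, Y⁆ :=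
  (LieHom.map_lie (LieAlgebra.SemiDirectSum.inr _) X Y).symm

theorem lie_loop_loop (x y : TorusFun n ⊗[ℂ] g) :
    ⁅(loop x : TorusLie n g), (loop y : TorusLie n g)⁆ = loop ⁅x, y⁆ :=
  (LieHom.map_lie (LieAlgebra.SemiDirectSum.inl _) x y).symm

theorem lie_vf_loop (X : VectTorus n) (y : TorusFun n ⊗[ℂ] g) :
    ⁅(vf X : TorusLie n g), (loop y : TorusLie n g)⁆ = loop (derAct _ g X y) :=
  lie_inr_inl _ X y

end TorusLie

set_option maxSynthPendingDepth 3

attribute [local instance] LieRing.ofAssociativeRing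

/-! ### Modules in `𝒥` from operators on a vector space -/

section Span

variable {R L M : Type*} [CommRing R] [LieRing L] [LieAlgebra R L] [LieRing M] [LieAlgebra R M]

/-- Apply the hypothesis to the quotient map. This turns each extensionality lemma for linear maps
into a spanning statement. -/
theorem span_eq_top_of_hom_ext {V : Type*} [AddCommGroup V] [Module R V] {S : Set V}
    (h : ∀ f : V →ₗ[R] V ⧸ Submodule.span R S, (∀ x ∈ S, f x = 0) → f = 0) :
    Submodule.span R S = ⊤ := by
  rw [← Submodule.ker_mkQ (Submodule.span R S), LinearMap.ker_eq_top]
  refine h _ fun x hx => ?_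
  rw [← LinearMap.mem_ker, Submodule.ker_mkQ]
  exact Submodule.subset_span hx

theorem map_lie_of_span (φ : L →ₗ[R] M) {S : Set L} (hS : Submodule.span R S = ⊤)
    (h : ∀ x ∈ S, ∀ y ∈ S, φ ⁅x, y⁆ = ⁅φ x, φ y⁆) (x y : L) : φ ⁅x, y⁆ = ⁅φ x, φ y⁆ := by
  have hx : x ∈ Submodule.span R S := hS ▸ Submodule.mem_top
  have hy : y ∈ Submodule.span R S := hS ▸ Submodule.mem_top
  induction hx using Submodule.span_induction with
  | zero => simp
  | add x₁ x₂ _ _ h₁ h₂ => simp only [add_lie, map_add, h₁, h₂]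
  | smul c x₁ _ h₁ => simp only [smul_lie, map_smul, h₁]
  | mem x hx =>
    induction hy using Submodule.span_induction with
    | zero => simp
    | add x₁ x₂ _ _ h₁ h₂ => simp only [lie_add, map_add, h₁, h₂]
    | smul c x₁ _ h₁ => simp only [lie_smul, map_smul, h₁]
    | mem y hy => exact h x hx y hy

end Span

/-! ### Spanning sets and components along exponentials -/

section TorusSpan

variable {n : ℕ} {g : Type u} [LieRing g] [LieAlgebra ℂ g]

theorem span_torusExp_smul_d :
    Submodule.span ℂ {X : VectTorus n | ∃ (j : Fin n) (s : Fin n → ℤ), X = torusExp s • d j} = ⊤ :=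
  span_eq_top_of_hom_ext fun f hf => vectTorus_hom_ext fun j s => by
    rw [hf _ ⟨j, s, rfl⟩]; rfl

theorem span_torusExp_tmul {V : Type*} [AddCommGroup V] [Module ℂ V] :
    Submodule.span ℂ {t : TorusFun n ⊗[ℂ] V | ∃ m w, t = torusExp m ⊗ₜ w} = ⊤ :=
  span_eq_top_of_hom_ext fun f hf => tensor_hom_ext fun j s => by
    rw [hf _ ⟨j, s, rfl⟩]; rfl

theorem torusLie_induction {p : TorusLie n g → Prop}
    (hadd : ∀ x y, p x → p y → p (x + y)) (hsmul : ∀ (c : ℂ) x, p x → p (c • x))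
    (hvf : ∀ (j : Fin n) (s : Fin n → ℤ), p (vf (torusExp s • d j)))
    (hloop : ∀ (s : Fin n → ℤ) (x : g), p (loop (torusExp s ⊗ₜ x))) (x : TorusLie n g) : p x := by
  have hS : Submodule.span ℂ {y : TorusLie n g | (∃ j s, y = vf (torusExp s • d j)) ∨
      ∃ s x, y = loop (torusExp s ⊗ₜ x)} = ⊤ :=
    span_eq_top_of_hom_ext fun f hf => torusLie_hom_ext
      (fun j s => by rw [hf _ (Or.inl ⟨j, s, rfl⟩)]; rfl)
      (fun s x => by rw [hf _ (Or.inr ⟨s, x, rfl⟩)]; rfl)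
  have h0 : p 0 := by
    have := hsmul 0 _ (hloop 0 0)
    rwa [zero_smul] at this
  have hx : x ∈ Submodule.span ℂ _ := hS ▸ Submodule.mem_top
  induction hx using Submodule.span_induction with
  | zero => exact h0
  | add x₁ x₂ _ _ h₁ h₂ => exact hadd _ _ h₁ h₂
  | smul c x₁ _ h₁ => exact hsmul _ _ h₁
  | mem x hx =>
    obtain ⟨j, s, rfl⟩ | ⟨s, x, rfl⟩ := hx
    · exact hvf j s
    · exact hloop s x

/-- The component of an element of `F(𝕋ⁿ) ⊗ V` along `e^{2πi m·x}`. -/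
def comp {V : Type*} [AddCommGroup V] [Module ℂ V] (m : Fin n → ℤ) : TorusFun n ⊗[ℂ] V →ₗ[ℂ] V :=
  TensorProduct.lift (torusLin (Pi.single m LinearMap.id : (Fin n → ℤ) → V →ₗ[ℂ] V))

variable {V : Type*} [AddCommGroup V] [Module ℂ V]

theorem comp_same (m : Fin n → ℤ) (w : V) : comp m (torusExp m ⊗ₜ w) = w := by
  simp [comp]

theorem comp_of_ne {m m' : Fin n → ℤ} (h : m' ≠ m) (w : V) : comp m (torusExp m' ⊗ₜ w) = 0 := by
  simp [comp, Pi.single_eq_of_ne h]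

theorem torusExp_tmul_injective (m : Fin n → ℤ) :
    Function.Injective fun w : V => (torusExp m ⊗ₜ[ℂ] w : TorusFun n ⊗[ℂ] V) :=
  Function.LeftInverse.injective (g := comp m) (comp_same m)

theorem exists_eq_sum_torusExp_tmul (t : TorusFun n ⊗[ℂ] V) :
    ∃ S : Finset (Fin n → ℤ), t = ∑ m ∈ S, torusExp m ⊗ₜ comp m t := by
  classical
  -- Allowing every larger index set lets the additive step pass to a union.
  suffices h : ∃ S : Finset (Fin n → ℤ), ∀ S', S ⊆ S' → t = ∑ m ∈ S', torusExp m ⊗ₜ comp m t from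
    h.imp fun S hS => hS S subset_rfl
  have ht : t ∈ Submodule.span ℂ _ := (span_torusExp_tmul (n := n) (V := V)) ▸ Submodule.mem_top
  induction ht using Submodule.span_induction with
  | zero => exact ⟨∅, fun _ _ => by simp⟩
  | add x y _ _ hx hy =>
    obtain ⟨S, hS⟩ := hx
    obtain ⟨T, hT⟩ := hy
    refine ⟨S ∪ T, fun S' h => ?_⟩
    simp only [map_add, TensorProduct.tmul_add, Finset.sum_add_distrib]
    rw [← hS S' (Finset.union_subset_left h), ← hT S' (Finset.union_subset_right h)]
  | smul c x _ hx =>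
    obtain ⟨S, hS⟩ := hx
    refine ⟨S, fun S' h => ?_⟩
    simp only [map_smul, TensorProduct.tmul_smul, ← Finset.smul_sum]
    rw [← hS S' h]
  | mem x hx =>
    obtain ⟨m, w, rfl⟩ := hx
    refine ⟨{m}, fun S' h => ?_⟩
    rw [Finset.sum_eq_single_of_mem m (h (Finset.mem_singleton_self m)), comp_same]
    intro b _ hb
    rw [comp_of_ne hb.symm, TensorProduct.tmul_zero]

end TorusSpan

/-! ### The relations satisfied by the operators of a realized module -/

section Realization

variable {n : ℕ} {g : Type u} [LieRing g] [LieAlgebra ℂ g]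
variable {U : Type v} [AddCommGroup U] [Module ℂ U]

/-- The relations between the operators `e^{-2πi s·x} d_j(s)` and `e^{-2πi s·x} (e^{2πi s·x} x)`. -/
structure JetRel (D : Fin n → (Fin n → ℤ) → Module.End ℂ U)
    (G : (Fin n → ℤ) → g →ₗ[ℂ] Module.End ℂ U) : Prop where
  vf_vf : ∀ j k s r, ⁅D j s, D k r⁆ =
    (r j : ℂ) • (D k (s + r) - D k r) - (s k : ℂ) • (D j (s + r) - D j s)
  vf_loop : ∀ j s r x, ⁅D j s, G r x⁆ = (r j : ℂ) • (G (s + r) x - G r x)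
  loop_loop : ∀ s r x y, ⁅G s x, G r y⁆ = G (s + r) ⁅x, y⁆

/-- `J` is identified with `F(𝕋ⁿ) ⊗ U`, where `𝔤` acts through the operators `D` and `G`. -/
structure Realizes (J : JMod.{u, v} n g) (D : Fin n → (Fin n → ℤ) → Module.End ℂ U)
    (G : (Fin n → ℤ) → g →ₗ[ℂ] Module.End ℂ U)
    (e : (TorusFun n ⊗[ℂ] U) ≃ₗ[TorusFun n] J.carrier) : Prop where
  vf_lie : ∀ (j : Fin n) (s m : Fin n → ℤ) (w : U),
    ⁅(vf (torusExp s • d j) : TorusLie n g), e (torusExp m ⊗ₜ w)⁆ =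
      e (torusExp (m + s) ⊗ₜ ((m j : ℂ) • w + D j s w))
  loop_lie : ∀ (x : g) (s m : Fin n → ℤ) (w : U),
    ⁅(loop (torusExp s ⊗ₜ x) : TorusLie n g), e (torusExp m ⊗ₜ w)⁆ =
      e (torusExp (m + s) ⊗ₜ G s x w)

variable {D : Fin n → (Fin n → ℤ) → Module.End ℂ U} {G : (Fin n → ℤ) → g →ₗ[ℂ] Module.End ℂ U}

theorem derAct_torusExp (j : Fin n) (s r : Fin n → ℤ) (x : g) :
    derAct (TorusFun n) g (torusExp s • d j) (torusExp r ⊗ₜ x) =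
      (r j : ℂ) • (torusExp (s + r) ⊗ₜ x) := by
  rw [derAct_tmul, smul_d_apply_torusExp, add_comm, TensorProduct.smul_tmul']

theorem lie_torusExp_tmul (s r : Fin n → ℤ) (x y : g) :
    ⁅(torusExp s ⊗ₜ x : TorusFun n ⊗[ℂ] g), (torusExp r ⊗ₜ y : TorusFun n ⊗[ℂ] g)⁆ =
      torusExp (s + r) ⊗ₜ ⁅x, y⁆ := by
  rw [LieAlgebra.ExtendScalars.bracket_tmul, torusExp_mul]

theorem lie_vf_vf_torusExp (j k : Fin n) (s r : Fin n → ℤ) :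
    ⁅(vf (torusExp s • d j) : TorusLie n g), (vf (torusExp r • d k) : TorusLie n g)⁆ =
      (r j : ℂ) • vf (torusExp (s + r) • d k) - (s k : ℂ) • vf (torusExp (s + r) • d j) := by
  rw [lie_vf_vf, lie_torusExp_smul_d]
  simp only [← vfLin_apply, map_sub, map_smul]

theorem lie_vf_loop_torusExp (j : Fin n) (s r : Fin n → ℤ) (x : g) :
    ⁅(vf (torusExp s • d j) : TorusLie n g), (loop (torusExp r ⊗ₜ x) : TorusLie n g)⁆ =
      (r j : ℂ) • loop (torusExp (s + r) ⊗ₜ x) := by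
  rw [lie_vf_loop, derAct_torusExp]
  simp only [← loopLin_apply, map_smul]

theorem lie_loop_loop_torusExp (s r : Fin n → ℤ) (x y : g) :
    ⁅(loop (torusExp s ⊗ₜ x) : TorusLie n g), (loop (torusExp r ⊗ₜ y) : TorusLie n g)⁆ =
      loop (torusExp (s + r) ⊗ₜ ⁅x, y⁆) := by
  rw [lie_loop_loop, lie_torusExp_tmul]

/-- Let a bracket of two generators of `𝔤` act on `e (1 ⊗ w)` in two ways. Both results lie along
the exponential with exponent `s + r`, so the coefficients in `U` can be compared. -/
theorem Realizes.jetRel {J : JMod.{u, v} n g} {e : (TorusFun n ⊗[ℂ] U) ≃ₗ[TorusFun n] J.carrier}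
    (h : Realizes J D G e) : JetRel D G := by
  have inj : ∀ m, Function.Injective fun w : U => e (torusExp m ⊗ₜ[ℂ] w) := fun m =>
    e.injective.comp (torusExp_tmul_injective m)
  have hs : ∀ (c : ℂ) (y : TorusFun n ⊗[ℂ] U), c • e y = e (c • y) := fun c y =>
    (LinearMap.map_smul_of_tower e.toLinearMap c y).symm
  refine ⟨fun j k s r => ?_, fun j s r x => ?_, fun s r x y => ?_⟩
  · ext w
    refine inj (s + r) ?_
    have h1 := lie_lie (vf (torusExp s • d j) : TorusLie n g) (vf (torusExp r • d k) : TorusLie n g)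
      (e (torusExp 0 ⊗ₜ[ℂ] w))
    rw [lie_vf_vf_torusExp, sub_lie, smul_lie, smul_lie] at h1
    simp only [h.vf_lie, hs, ← map_sub, zero_add, ← TensorProduct.tmul_smul,
      add_comm r s, ← TensorProduct.tmul_sub] at h1
    have h2 := inj _ h1
    simp only [Pi.zero_apply, Int.cast_zero, zero_smul, zero_add] at h2
    dsimp only
    congr 2
    simp only [LieRing.of_associative_ring_bracket, LinearMap.sub_apply, Module.End.mul_apply,
      LinearMap.smul_apply, smul_sub]
    rw [← sub_eq_zero] at h2 ⊢
    rw [← neg_eq_zero, ← h2]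
    abel
  · ext w
    refine inj (s + r) ?_
    have h1 := lie_lie (vf (torusExp s • d j) : TorusLie n g) (loop (torusExp r ⊗ₜ x) : TorusLie n g)
      (e (torusExp 0 ⊗ₜ[ℂ] w))
    rw [lie_vf_loop_torusExp, smul_lie] at h1
    simp only [h.vf_lie, h.loop_lie, hs, ← map_sub, zero_add, ← TensorProduct.tmul_smul,
      add_comm r s, ← TensorProduct.tmul_sub] at h1
    have h2 := inj _ h1
    simp only [Pi.zero_apply, Int.cast_zero, zero_smul, zero_add] at h2
    dsimp only
    congr 2
    simp only [LieRing.of_associative_ring_bracket, LinearMap.sub_apply, Module.End.mul_apply,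
      LinearMap.smul_apply, smul_sub]
    rw [← sub_eq_zero] at h2 ⊢
    rw [← neg_eq_zero, ← h2]
    abel
  · ext w
    refine inj (s + r) ?_
    have h1 := lie_lie (loop (torusExp s ⊗ₜ x) : TorusLie n g)
      (loop (torusExp r ⊗ₜ y) : TorusLie n g) (e (torusExp 0 ⊗ₜ[ℂ] w))
    rw [lie_loop_loop_torusExp] at h1
    simp only [h.loop_lie, ← map_sub, zero_add, add_comm r s, ← TensorProduct.tmul_sub] at h1
    exact h1.symm

end Realization

/-! ### Building a module in `𝒥` from operators that satisfy the relations -/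

section Construction

variable {n : ℕ} {g : Type u} [LieRing g] [LieAlgebra ℂ g]
variable {U : Type v} [AddCommGroup U] [Module ℂ U]
variable (D : Fin n → (Fin n → ℤ) → Module.End ℂ U) (G : (Fin n → ℤ) → g →ₗ[ℂ] Module.End ℂ U)

/-- The action of `f d_j` on `F(𝕋ⁿ) ⊗ U`. -/
def vfAct (j : Fin n) : TorusFun n →ₗ[ℂ] Module.End ℂ (TorusFun n ⊗[ℂ] U) :=
  torusLin fun s => TensorProduct.map (LinearMap.mulLeft ℂ (torusExp s)) (D j s) +
    (LinearMap.mulLeft ℂ (torusExp s) ∘ₗ (d j : TorusFun n →ₗ[ℂ] TorusFun n)).rTensor U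

/-- The action of vector fields on `F(𝕋ⁿ) ⊗ U`. -/
def vfHomLin : VectTorus n →ₗ[ℂ] Module.End ℂ (TorusFun n ⊗[ℂ] U) :=
  ∑ j, vfAct D j ∘ₗ vfCoeff j

theorem vfHomLin_torusExp (j : Fin n) (s m : Fin n → ℤ) (w : U) :
    vfHomLin D (torusExp s • d j) (torusExp m ⊗ₜ w) =
      torusExp (m + s) ⊗ₜ ((m j : ℂ) • w + D j s w) := by
  rw [vfHomLin, LinearMap.sum_apply, LinearMap.sum_apply, Finset.sum_eq_single j]
  · rw [LinearMap.comp_apply, vfCoeff_smul_d, if_pos rfl, vfAct, torusLin_torusExp,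
      LinearMap.add_apply, TensorProduct.map_tmul, LinearMap.rTensor_tmul, LinearMap.comp_apply,
      Derivation.coeFn_coe, d_torusExp, map_smul, LinearMap.mulLeft_apply, torusExp_mul,
      TensorProduct.tmul_add, TensorProduct.smul_tmul, add_comm s m, add_comm]
  · intro k _ hk
    rw [LinearMap.comp_apply, vfCoeff_smul_d, if_neg hk.symm, map_zero, LinearMap.zero_apply]
  · simp

/-- The action of the multi-loop algebra on `F(𝕋ⁿ) ⊗ U`. -/
def loopHomLin : TorusFun n ⊗[ℂ] g →ₗ[ℂ] Module.End ℂ (TorusFun n ⊗[ℂ] U) :=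
  TensorProduct.lift (torusLin (M := g →ₗ[ℂ] Module.End ℂ (TorusFun n ⊗[ℂ] U)) fun s =>
    TensorProduct.mapBilinear (RingHom.id ℂ) (TorusFun n) U (TorusFun n) U
      (LinearMap.mulLeft ℂ (torusExp s)) ∘ₗ G s)

theorem loopHomLin_torusExp (x : g) (s m : Fin n → ℤ) (w : U) :
    loopHomLin G (torusExp s ⊗ₜ x) (torusExp m ⊗ₜ w) = torusExp (m + s) ⊗ₜ G s x w := by
  rw [loopHomLin, TensorProduct.lift.tmul, torusLin_torusExp, LinearMap.comp_apply]
  simp [torusExp_mul, add_comm]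

variable {D G}

/-- The Lie algebra homomorphism through which vector fields act on `F(𝕋ⁿ) ⊗ U`. -/
def vfHom (h : JetRel D G) : VectTorus n →ₗ⁅ℂ⁆ Module.End ℂ (TorusFun n ⊗[ℂ] U) where
  __ := vfHomLin D
  map_lie' := by
    intro X Y
    refine map_lie_of_span (vfHomLin D) span_torusExp_smul_d ?_ X Y
    rintro _ ⟨j, s, rfl⟩ _ ⟨k, r, rfl⟩
    rw [lie_torusExp_smul_d, map_sub, map_smul _ (r j : ℂ), map_smul _ (s k : ℂ)]
    refine tensor_hom_ext fun m w => ?_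
    have hw := LinearMap.congr_fun (h.vf_vf j k s r) w
    rw [LieRing.of_associative_ring_bracket] at hw ⊢
    simp only [LinearMap.sub_apply, LinearMap.smul_apply, Module.End.mul_apply] at hw ⊢
    rw [vfHomLin_torusExp, vfHomLin_torusExp, vfHomLin_torusExp, vfHomLin_torusExp,
      vfHomLin_torusExp, vfHomLin_torusExp, add_assoc, add_assoc, add_comm r s,
      ← TensorProduct.tmul_smul, ← TensorProduct.tmul_smul, ← TensorProduct.tmul_sub,
      ← TensorProduct.tmul_sub]
    congr 1
    rw [sub_eq_iff_eq_add] at hw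
    simp only [map_add, map_smul, Pi.add_apply, Int.cast_add, hw]
    module

/-- The Lie algebra homomorphism through which the multi-loop algebra acts on `F(𝕋ⁿ) ⊗ U`. -/
def loopHom (h : JetRel D G) : TorusFun n ⊗[ℂ] g →ₗ⁅ℂ⁆ Module.End ℂ (TorusFun n ⊗[ℂ] U) where
  __ := loopHomLin G
  map_lie' := by
    intro X Y
    refine map_lie_of_span (loopHomLin G) span_torusExp_tmul ?_ X Y
    rintro _ ⟨s, x, rfl⟩ _ ⟨r, y, rfl⟩
    rw [lie_torusExp_tmul]
    refine tensor_hom_ext fun m w => ?_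
    have hw := LinearMap.congr_fun (h.loop_loop s r x y) w
    rw [LieRing.of_associative_ring_bracket] at hw ⊢
    simp only [LinearMap.sub_apply, Module.End.mul_apply, loopHomLin_torusExp, add_assoc,
      add_comm r s, ← TensorProduct.tmul_sub] at hw ⊢
    rw [hw]

theorem lie_vfHom_loopHom (h : JetRel D G) (X : VectTorus n) (y : TorusFun n ⊗[ℂ] g) :
    ⁅vfHom h X, loopHom h y⁆ = loopHom h (derAct _ g X y) := by
  have hX : X ∈ Submodule.span ℂ _ := span_torusExp_smul_d (n := n) ▸ Submodule.mem_top
  have hy : y ∈ Submodule.span ℂ _ := span_torusExp_tmul (n := n) (V := g) ▸ Submodule.mem_top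
  induction hX using Submodule.span_induction with
  | zero => simp
  | add x₁ x₂ _ _ h₁ h₂ => simp only [add_lie, map_add, h₁, h₂, LieDerivation.add_apply]
  | smul c x₁ _ h₁ => simp only [smul_lie, map_smul, h₁, LieDerivation.smul_apply]
  | mem X hX =>
    induction hy using Submodule.span_induction with
    | zero => simp
    | add x₁ x₂ _ _ h₁ h₂ => simp only [lie_add, map_add, h₁, h₂]
    | smul c x₁ _ h₁ => simp only [lie_smul, map_smul, h₁]
    | mem y hy =>
      obtain ⟨j, s, rfl⟩ := hX
      obtain ⟨r, x, rfl⟩ := hy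
      rw [derAct_torusExp, map_smul _ (r j : ℂ)]
      refine tensor_hom_ext fun m w => ?_
      change ⁅vfHomLin D (torusExp s • d j), loopHomLin G (torusExp r ⊗ₜ x)⁆ _ =
        ((r j : ℂ) • loopHomLin G (torusExp (s + r) ⊗ₜ x)) _
      have hw := LinearMap.congr_fun (h.vf_loop j s r x) w
      rw [LieRing.of_associative_ring_bracket] at hw ⊢
      simp only [LinearMap.sub_apply, LinearMap.smul_apply, Module.End.mul_apply] at hw ⊢
      rw [loopHomLin_torusExp, loopHomLin_torusExp, vfHomLin_torusExp, vfHomLin_torusExp,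
        loopHomLin_torusExp, add_assoc, add_assoc, add_comm r s, ← TensorProduct.tmul_smul,
        ← TensorProduct.tmul_sub]
      congr 1
      rw [sub_eq_iff_eq_add] at hw
      simp only [map_add, map_smul, Pi.add_apply, Int.cast_add, hw]
      module

/-- The Lie algebra homomorphism through which `𝔤` acts on `F(𝕋ⁿ) ⊗ U`. -/
def torusHom (h : JetRel D G) : TorusLie n g →ₗ⁅ℂ⁆ Module.End ℂ (TorusFun n ⊗[ℂ] U) :=
  semiDirectLift _ (loopHom h) (vfHom h) (lie_vfHom_loopHom h)

theorem torusHom_vf (h : JetRel D G) (X : VectTorus n) : torusHom h (vf X) = vfHomLin D X :=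
  semiDirectLift_inr _ _ _ _ X

theorem torusHom_loop (h : JetRel D G) (y : TorusFun n ⊗[ℂ] g) :
    torusHom h (loop y) = loopHomLin G y :=
  semiDirectLift_inl _ _ _ _ y

/-- Both sides are linear in the field, the function and the vector, so exponentials suffice; there
the two terms on the right come from `(m + r)_j = m_j + r_j`. -/
theorem vfHomLin_smul (X : VectTorus n) (f : TorusFun n) (w : TorusFun n ⊗[ℂ] U) :
    vfHomLin D X (f • w) = X f • w + f • vfHomLin D X w := by
  induction w using TensorProduct.induction_on with
  | zero => simp
  | add x y hx hy => simp only [smul_add, map_add, hx, hy]; abel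
  | tmul h u =>
    have hX : X ∈ Submodule.span ℂ _ := span_torusExp_smul_d (n := n) ▸ Submodule.mem_top
    induction hX using Submodule.span_induction with
    | zero => simp
    | add x₁ x₂ _ _ h₁ h₂ =>
      simp only [map_add, LinearMap.add_apply, h₁, h₂, Derivation.add_apply, add_smul, smul_add]
      abel
    | smul c x₁ _ h₁ =>
      simp only [map_smul, LinearMap.smul_apply, h₁, Derivation.smul_apply, smul_add, smul_assoc]
      rw [smul_comm c f (vfHomLin D x₁ (h ⊗ₜ[ℂ] u))]
    | mem X hX =>
      obtain ⟨j, s, rfl⟩ := hX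
      induction f using torusFun_induction with
      | h0 => simp
      | hadd x y hx hy => simp only [add_smul, map_add, hx, hy]; abel
      | hexp c m =>
        rw [Derivation.map_smul, smul_assoc, map_smul _ c, smul_assoc, smul_assoc, ← smul_add]
        congr 1
        induction h using torusFun_induction with
        | h0 => simp
        | hadd x y hx hy => simp only [TensorProduct.add_tmul, smul_add, map_add, hx, hy]; abel
        | hexp c' r =>
          rw [← TensorProduct.smul_tmul', smul_comm _ c', map_smul _ c', map_smul _ c',
            smul_comm _ c', smul_comm _ c', ← smul_add]
          congr 1
          rw [TensorProduct.smul_tmul', smul_eq_mul, torusExp_mul, vfHomLin_torusExp,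
            vfHomLin_torusExp, smul_d_apply_torusExp, TensorProduct.smul_tmul', smul_assoc,
            smul_eq_mul, torusExp_mul, TensorProduct.smul_tmul' (torusExp m), smul_eq_mul,
            torusExp_mul, ← TensorProduct.smul_tmul',
            add_right_comm m s r, add_assoc m r s, ← TensorProduct.tmul_smul,
            ← TensorProduct.tmul_add, Pi.add_apply, Int.cast_add, add_smul, add_assoc]

theorem loopHomLin_smul (y : TorusFun n ⊗[ℂ] g) (f : TorusFun n) (w : TorusFun n ⊗[ℂ] U) :
    loopHomLin G y (f • w) = f • loopHomLin G y w := by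
  have hy : y ∈ Submodule.span ℂ _ := span_torusExp_tmul (n := n) (V := g) ▸ Submodule.mem_top
  have hw : w ∈ Submodule.span ℂ _ := span_torusExp_tmul (n := n) (V := U) ▸ Submodule.mem_top
  induction hy using Submodule.span_induction with
  | zero => simp
  | add x₁ x₂ _ _ h₁ h₂ => simp only [map_add, LinearMap.add_apply, h₁, h₂, smul_add]
  | smul c x₁ _ h₁ =>
    rw [map_smul _ c, LinearMap.smul_apply, LinearMap.smul_apply, h₁, smul_comm]
  | mem y hy =>
    obtain ⟨s, x, rfl⟩ := hy
    induction hw using Submodule.span_induction with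
    | zero => simp
    | add x₁ x₂ _ _ h₁ h₂ => simp only [map_add, h₁, h₂, smul_add]
    | smul c x₁ _ h₁ => rw [smul_comm, map_smul _ c, map_smul _ c, h₁, smul_comm]
    | mem w hw =>
      obtain ⟨m, u, rfl⟩ := hw
      induction f using torusFun_induction with
      | h0 => simp
      | hadd x y hx hy => simp only [add_smul, map_add, hx, hy]
      | hexp c r =>
        rw [smul_assoc, smul_assoc, map_smul _ c, loopHomLin_torusExp, TensorProduct.smul_tmul',
          TensorProduct.smul_tmul', smul_eq_mul, smul_eq_mul, torusExp_mul, torusExp_mul,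
          loopHomLin_torusExp, add_assoc]

theorem iSup_eigenspace_eq_top_of_span {V : Type*} [AddCommGroup V] [Module ℂ V]
    (T : Module.End ℂ V) {S : Set V} (hS : Submodule.span ℂ S = ⊤)
    (h : ∀ v ∈ S, ∃ μ : ℂ, T v = μ • v) : ⨆ μ : ℂ, T.eigenspace μ = ⊤ := by
  rw [eq_top_iff, ← hS, Submodule.span_le]
  intro v hv
  obtain ⟨μ, hμ⟩ := h v hv
  exact Submodule.mem_iSup_of_mem μ (Module.End.mem_eigenspace_iff.mpr hμ)

/-- The module `F(𝕋ⁿ) ⊗ U` in `𝒥`, for operators `D`, `G` on `U` such that `D j 0` is a scalar. -/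
def jetMod [FiniteDimensional ℂ U] (h : JetRel D G) (lam : Fin n → ℂ)
    (hlam : ∀ j w, D j 0 w = lam j • w) : JMod.{u, v} n g :=
  letI : LieRingModule (TorusLie n g) (TorusFun n ⊗[ℂ] U) :=
    LieRingModule.compLieHom _ (torusHom h)
  letI : LieModule ℂ (TorusLie n g) (TorusFun n ⊗[ℂ] U) := LieModule.compLieHom _ (torusHom h)
  { carrier := TorusFun n ⊗[ℂ] U
    inCategory :=
      { diagonalizable := fun j => by
          refine iSup_eigenspace_eq_top_of_span _ span_torusExp_tmul ?_
          rintro _ ⟨m, w, rfl⟩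
          refine ⟨m j + lam j, ?_⟩
          change torusHom h (vf (d j)) _ = _
          have : (d j : VectTorus n) = torusExp (0 : Fin n → ℤ) • d j := by
            rw [torusExp_zero, one_smul]
          rw [torusHom_vf, this, vfHomLin_torusExp, hlam, add_zero, ← add_smul,
            TensorProduct.tmul_smul]
        free := inferInstance
        finite := inferInstance
        vf_smul := fun X f w => by
          change torusHom h (vf X) (f • w) = X f • w + f • torusHom h (vf X) w
          rw [torusHom_vf, vfHomLin_smul]
        loop_smul := fun y f w => by
          change torusHom h (loop y) (f • w) = f • torusHom h (loop y) w
          rw [torusHom_loop, loopHomLin_smul] } }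

theorem realizes_jetMod [FiniteDimensional ℂ U] (h : JetRel D G) (lam : Fin n → ℂ)
    (hlam : ∀ j w, D j 0 w = lam j • w) :
    Realizes (jetMod h lam hlam) D G (LinearEquiv.refl _ _) where
  vf_lie j s m w := by
    change torusHom h (vf (torusExp s • d j)) _ = _
    rw [torusHom_vf]
    exact vfHomLin_torusExp D j s m w
  loop_lie x s m w := by
    change torusHom h (loop _) _ = _
    rw [torusHom_loop]
    exact loopHomLin_torusExp G x s m w

end Construction

/-! ### Finite-dimensional representations of vector fields vanishing at a point -/

section Nilpotency

variable {F E ι : Type*} [CommRing F] [Algebra ℂ F] [Ring E] [Algebra ℂ E]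

/-- The operator `ad a` on a finite-dimensional algebra has finitely many eigenvalues, while `k + c`
takes each value at most once. -/
theorem exists_eq_zero_of_commutator [FiniteDimensional ℂ E] (a : E) (c : ℤ) :
    ∃ N : ℕ, ∀ k ≥ N, ∀ x : E, a * x - x * a = (((k : ℤ) + c : ℤ) : ℂ) • x → x = 0 := by
  let T : Module.End ℂ E := LinearMap.mulLeft ℂ a - LinearMap.mulRight ℂ a
  have hinj : Function.Injective fun k : ℕ => (((k : ℤ) + c : ℤ) : ℂ) := fun k l hkl => by
    have := Int.cast_injective hkl
    omega
  have hT : {μ : ℂ | T.HasEigenvalue μ}.Finite := Module.End.finite_hasEigenvalue T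
  obtain ⟨N, hN⟩ := (hT.preimage hinj.injOn).bddAbove
  refine ⟨N + 1, fun k hk x hx => ?_⟩
  by_contra hx0
  have : k ≤ N := hN (Module.End.hasEigenvalue_of_hasEigenvector (x := x)
    ⟨Module.End.mem_eigenspace_iff.mpr hx, hx0⟩)
  omega

variable [DecidableEq ι] {ε : F →ₐ[ℂ] ℂ} {p : ι → Derivation ℂ F F} {t : ι → F}
  {A : ι → F →ₗ[ℂ] E}

/-- Here `A i f` stands for the action of `f ∂/∂t_i`, and `hA` is the bracket of fields that vanish
at the point `ε`. An eigenvalue argument disposes of `t_i^k ∂/∂t_i`; brackets of these with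
arbitrary fields then dispose of all multiples. -/
theorem exists_pow_mul_eq_zero_same [FiniteDimensional ℂ E]
    (hpt : ∀ i j, p i (t j) = if i = j then 1 else 0)
    (hεt : ∀ i, ε (t i) = 0)
    (hA : ∀ i j f h, ε f = 0 → ε h = 0 →
      A i f * A j h - A j h * A i f = A j (f * p i h) - A i (h * p j f)) (i : ι) :
    ∃ N, ∀ k ≥ N, ∀ f, A i (t i ^ k * f) = 0 := by
  have hp : p i (t i) = 1 := by rw [hpt, if_pos rfl]
  have hpk : ∀ k : ℕ, p i (t i ^ (k + 1)) = ((k : ℂ) + 1) • t i ^ k := fun k => by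
    rw [Derivation.leibniz_pow, hp, Nat.add_sub_cancel]
    simp only [smul_eq_mul, mul_one, Algebra.smul_def]
    push_cast
    simp
  have hε : ∀ k f, ε (t i ^ (k + 1) * f) = 0 := fun k f => by
    rw [map_mul, map_pow, hεt, zero_pow k.succ_ne_zero, zero_mul]
  -- The shift is `-1` because `[t∂, t^k ∂] = (k - 1) t^k ∂`.
  obtain ⟨N', hN'⟩ := exists_eq_zero_of_commutator (A i (t i)) (-1)
  obtain ⟨N, hN⟩ : ∃ N, ∀ k ≥ N, A i (t i ^ k) = 0 := by
    refine ⟨N' + 1, fun k hk => hN' k (by omega) _ ?_⟩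
    obtain ⟨k, rfl⟩ := Nat.exists_eq_add_of_le' (show 1 ≤ k by omega)
    have h1 := hA i i (t i) (t i ^ (k + 1)) (hεt i) (by simpa using hε k 1)
    rw [h1, hpk, hp, mul_smul_comm, mul_one, map_smul, ← pow_succ']
    push_cast
    module
  refine ⟨N + 2, fun k hk f => ?_⟩
  obtain ⟨k, rfl⟩ := Nat.exists_eq_add_of_le' hk
  -- This is the bracket of `t^{l+1} ∂`, which already acts by zero, with `t f ∂`.
  have key : ∀ l ≥ N, ∀ f, A i (t i ^ (l + 1) * (t i * p i f) - (l : ℂ) • (t i ^ (l + 1) * f)) = 0 := by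
    intro l hl f
    have h1 := hA i i (t i ^ (l + 1)) (t i * f) (by simpa using hε l 1) (by simpa using hε 0 f)
    rw [hN _ (by omega), zero_mul, mul_zero, sub_zero, ← map_sub, eq_comm] at h1
    rw [← h1]
    congr 1
    rw [Derivation.leibniz, hp, hpk, smul_eq_mul, smul_eq_mul]
    simp only [Algebra.smul_def, map_add, map_one]
    ring
  -- For `(k + N, t f)` and `(k + N + 1, f)` the terms with the derivative of `f` coincide; the
  -- difference is `2 t^{k+N+2} f`.
  have h1 := key (k + N) (by omega) (t i * f)
  have h2 := key (k + N + 1) (by omega) f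
  rw [Derivation.leibniz, hp, smul_eq_mul, smul_eq_mul] at h1
  have h3 := sub_eq_zero.mpr (h1.trans h2.symm)
  rw [← map_sub] at h3
  have h4 : A i ((2 : ℂ) • (t i ^ (k + (N + 2)) * f)) = 0 := by
    rw [← h3]
    congr 1
    simp only [Algebra.smul_def, Nat.cast_add, Nat.cast_one, map_add, map_one, map_ofNat]
    ring
  rw [map_smul] at h4
  exact (smul_eq_zero.mp h4).resolve_left two_ne_zero

/-- For `i ≠ j` use `[t_i^N f ∂_i, t_i ∂_j] = t_i^N f ∂_j - t_i^{N+1} (∂_j f) ∂_i`: the left side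
and the last term act by zero by the case of equal indices. -/
theorem exists_pow_mul_eq_zero [FiniteDimensional ℂ E] [Finite ι]
    (hpt : ∀ i j, p i (t j) = if i = j then 1 else 0)
    (hεt : ∀ i, ε (t i) = 0)
    (hA : ∀ i j f h, ε f = 0 → ε h = 0 →
      A i f * A j h - A j h * A i f = A j (f * p i h) - A i (h * p j f)) :
    ∃ N > 0, ∀ i j f, A j (t i ^ N * f) = 0 := by
  choose N hN using exists_pow_mul_eq_zero_same hpt hεt hA
  obtain ⟨M, hM⟩ := (Set.finite_range N).bddAbove
  have hM' : ∀ i, N i ≤ M := fun i => hM ⟨i, rfl⟩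
  refine ⟨M + 1, M.succ_pos, fun i j f => ?_⟩
  by_cases hij : i = j
  · subst hij
    exact hN i _ (by have := hM' i; omega) f
  · have h1 := hA i j (t i ^ (M + 1) * f) (t i)
      (by rw [map_mul, map_pow, hεt, zero_pow M.succ_ne_zero, zero_mul]) (hεt i)
    rw [hN i _ (by have := hM' i; omega) f, zero_mul, mul_zero, sub_zero, hpt, if_pos rfl, mul_one,
      Derivation.leibniz, Derivation.leibniz_pow, hpt, if_neg (Ne.symm hij), smul_zero, smul_zero,
      smul_zero, add_zero, smul_eq_mul, mul_left_comm, hN i _ (by have := hM' i; omega),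
      sub_zero] at h1
    exact h1.symm

/-- For the loop part: `[t_i^N f ∂_i, t_i x] = t_i^N f x`, and the field on the left acts by zero.
-/
theorem pow_mul_eq_zero_of_commutator (hpt : ∀ i j, p i (t j) = if i = j then 1 else 0)
    (hεt : ∀ i, ε (t i) = 0) {N : ℕ} (hN0 : 0 < N) (hN : ∀ i f, A i (t i ^ N * f) = 0)
    {B : F →ₗ[ℂ] E}
    (hB : ∀ i f h, ε f = 0 → A i f * B h - B h * A i f = B (f * p i h)) (i : ι) (f : F) :
    B (t i ^ N * f) = 0 := by
  have h1 := hB i (t i ^ N * f) (t i)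
    (by rw [map_mul, map_pow, hεt, zero_pow hN0.ne', zero_mul])
  rw [hN, zero_mul, mul_zero, sub_zero, hpt, if_pos rfl, mul_one] at h1
  exact h1.symm

end Nilpotency

/-! ### Truncated logarithms and exponentials -/

section Log

open Polynomial

/-- The truncated logarithm `∑_{k < N} (-1)^k X^(k+1) / (k+1)`. -/
def logPoly (N : ℕ) : ℂ[X] := ∑ k ∈ Finset.range N, C ((-1) ^ k / ((k : ℂ) + 1)) * X ^ (k + 1)

theorem X_dvd_logPoly (N : ℕ) : X ∣ logPoly N :=
  Finset.dvd_sum fun _ _ => (dvd_pow_self X (Nat.succ_ne_zero _)).mul_left _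

/-- The derivative is a finite geometric series in `-X`. The error `(-X) ^ N` will lie in the ideal
that acts by zero. -/
theorem derivative_logPoly (N : ℕ) : (1 + X) * derivative (logPoly N) = 1 - (-X) ^ N := by
  have h : derivative (logPoly N) = ∑ k ∈ Finset.range N, (-X : ℂ[X]) ^ k := by
    rw [logPoly, derivative_sum]
    refine Finset.sum_congr rfl fun k _ => ?_
    rw [derivative_C_mul_X_pow, Nat.add_sub_cancel, Nat.cast_add, Nat.cast_one,
      div_mul_cancel₀ _ (Nat.cast_add_one_ne_zero k), neg_pow (X : ℂ[X]), C_pow, C_neg, C_1]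
  rw [h, ← mul_neg_geom_sum, sub_neg_eq_add]

/-- The truncated exponential `∑_{k < N} y^k / k!`. -/
def texp {R : Type*} [Ring R] [Algebra ℂ R] (N : ℕ) (y : R) : R :=
  ∑ k ∈ Finset.range N, ((k.factorial : ℂ)⁻¹) • y ^ k

/-- Up to high order `y = exp (log (1 + X))` solves `(1 + X) y' = y` with `y(0) = 1`. The resulting
recursion for the coefficients has the same solution as for `1 + X`. -/
theorem X_pow_dvd_texp_logPoly (N : ℕ) : X ^ N ∣ texp N (logPoly N) - (1 + X) := by
  obtain _ | M := N
  · simp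
  set L := logPoly (M + 1) with hL
  have hXL : ∀ k, X ^ k ∣ L ^ k := fun k => pow_dvd_pow_of_dvd (X_dvd_logPoly _) k
  have hder : derivative (texp (M + 1) L) = derivative L * (texp (M + 1) L -
      ((M.factorial : ℂ)⁻¹) • L ^ M) := by
    have h1 : texp (M + 1) L - ((M.factorial : ℂ)⁻¹) • L ^ M = texp M L := by
      rw [texp, Finset.sum_range_succ, add_sub_cancel_right, texp]
    rw [h1, texp, Finset.sum_range_succ', derivative_add, derivative_sum, texp, Finset.mul_sum]
    simp only [pow_zero, derivative_smul, derivative_one, smul_zero, add_zero]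
    refine Finset.sum_congr rfl fun k _ => ?_
    rw [derivative_pow, Nat.add_sub_cancel, Nat.factorial_succ, Nat.cast_mul, mul_inv,
      smul_eq_C_mul, smul_eq_C_mul, C_mul]
    have h2 : C (((k + 1 : ℕ) : ℂ)⁻¹) * C ((k + 1 : ℕ) : ℂ) = 1 := by
      rw [← C_mul, inv_mul_cancel₀ (Nat.cast_ne_zero.mpr k.succ_ne_zero), C_1]
    linear_combination (C ((k.factorial : ℂ)⁻¹) * L ^ k * derivative L) * h2
  -- One order is lost to the derivative; the recursion for indices below `M` still determines the
  -- coefficients up to index `M`, hence modulo `X ^ (M + 1)`.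
  have hdvd : X ^ M ∣ (1 + X) * derivative (texp (M + 1) L) - texp (M + 1) L := by
    rw [hder, ← mul_assoc, derivative_logPoly]
    have h3 : (1 - (-X) ^ (M + 1)) * (texp (M + 1) L - ((M.factorial : ℂ)⁻¹) • L ^ M) -
        texp (M + 1) L = X ^ M * ((-1) ^ M * X * (texp (M + 1) L - ((M.factorial : ℂ)⁻¹) • L ^ M)) -
          ((M.factorial : ℂ)⁻¹) • L ^ M := by
      rw [neg_pow]
      ring
    rw [h3]
    exact dvd_sub (dvd_mul_right _ _) (dvd_smul_of_dvd _ (hXL M))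
  have hcoeff0 : (texp (M + 1) L).coeff 0 = 1 := by
    have hL0 : L.coeff 0 = 0 := X_dvd_iff.mp (X_dvd_logPoly _)
    rw [texp, finsetSum_coeff, Finset.sum_eq_single 0]
    · simp
    · intro k _ hk
      rw [coeff_smul, coeff_zero_eq_eval_zero, eval_pow, ← coeff_zero_eq_eval_zero, hL0,
        zero_pow hk, smul_zero]
    · simp
  have hrec : ∀ k < M, ((k : ℂ) + 1) * (texp (M + 1) L).coeff (k + 1) =
      (1 - k) * (texp (M + 1) L).coeff k := by
    intro k hk
    have h4 := X_pow_dvd_iff.mp hdvd k hk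
    rw [add_mul, one_mul, coeff_sub, coeff_add, coeff_derivative] at h4
    have h5 : (X * derivative (texp (M + 1) L)).coeff k = k * (texp (M + 1) L).coeff k := by
      cases k with
      | zero => simp
      | succ k => rw [coeff_X_mul, coeff_derivative, mul_comm]; push_cast; rfl
    rw [h5] at h4
    linear_combination h4
  have hval : ∀ k < M + 1, (texp (M + 1) L).coeff k = if k ≤ 1 then 1 else 0 := by
    intro k
    induction k with
    | zero => intro _; simpa using hcoeff0
    | succ k ih =>
      intro hk
      have h6 := hrec k (by omega)
      rw [ih (by omega)] at h6
      have hk1 : (k : ℂ) + 1 ≠ 0 := Nat.cast_add_one_ne_zero k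
      obtain rfl | rfl | hk2 : k = 0 ∨ k = 1 ∨ 2 ≤ k := by omega
      · simpa using h6
      · simpa [hk1] using h6
      · rw [if_neg (by omega), mul_zero, mul_eq_zero] at h6
        rw [if_neg (by omega)]
        exact h6.resolve_left hk1
  rw [X_pow_dvd_iff]
  intro k hk
  rw [coeff_sub, hval k hk, coeff_add, coeff_one, coeff_X]
  rcases k with _ | _ | k <;> simp

/-- Truncated exponentials at nilpotent elements are multiplicative. -/
theorem texp_add_smul {R : Type*} [CommRing R] [Algebra ℂ R] {N : ℕ} {y : R} (hy : y ^ N = 0)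
    (a b : ℂ) : texp N ((a + b) • y) = texp N (a • y) * texp N (b • y) := by
  -- `IsNilpotent.exp` needs rational scalars; they are restricted from `ℂ` so that both scalar
  -- actions agree by definition.
  let _ : Algebra ℚ R := Algebra.compHom R (algebraMap ℚ ℂ)
  have hq : ∀ (q : ℚ) (x : R), q • x = (q : ℂ) • x := fun q x => rfl
  have hn : ∀ c : ℂ, (c • y) ^ N = 0 := fun c => by rw [_root_.smul_pow, hy, smul_zero]
  have he : ∀ c : ℂ, texp N (c • y) = IsNilpotent.exp (c • y) := fun c => by
    rw [IsNilpotent.exp_eq_sum (hn c), texp]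
    refine Finset.sum_congr rfl fun k _ => ?_
    rw [hq]
    push_cast
    rfl
  rw [he, he, he, add_smul]
  exact IsNilpotent.exp_add_of_commute (Commute.all _ _) ⟨N, hn a⟩ ⟨N, hn b⟩

theorem texp_zero_smul {R : Type*} [CommRing R] [Algebra ℂ R] {N : ℕ} (hN : 0 < N) (y : R) :
    texp N ((0 : ℂ) • y) = 1 := by
  rw [zero_smul, texp, Finset.sum_eq_single 0]
  · simp
  · intro k _ hk
    rw [zero_pow hk, smul_zero]
  · intro h
    exact absurd (Finset.mem_range.mpr hN) h

end Log

/-! ### From the torus to polynomial vector fields -/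

section Box

variable {n : ℕ}

/-- The exponents that are everywhere less than `N`. -/
def box (n N : ℕ) : Finset (Fin n →₀ ℕ) :=
  (Fintype.piFinset fun _ : Fin n => Finset.range N).map Finsupp.equivFunOnFinite.symm.toEmbedding

theorem mem_box {N : ℕ} {β : Fin n →₀ ℕ} : β ∈ box n N ↔ ∀ i, β i < N := by
  simp [box, Finset.mem_map_equiv, Fintype.mem_piFinset]

/-- Truncating each one-variable exponential separately is what makes the index set a box rather
than a simplex. -/
theorem prod_texp {R : Type*} [CommRing R] [Algebra ℂ R] (N : ℕ) (s : Fin n → ℤ) (y : Fin n → R) :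
    ∏ i, texp N ((s i : ℂ) • y i) = ∑ β ∈ box n N, coef s β • ∏ i, y i ^ β i := by
  simp only [texp]
  rw [Finset.prod_univ_sum, box, Finset.sum_map]
  refine Finset.sum_congr rfl fun β _ => ?_
  simp only [smul_pow, smul_smul, coef]
  rw [Finset.prod_smul, ← Finset.prod_div_distrib]
  congr 1
  refine Finset.prod_congr rfl fun i _ => ?_
  rw [div_eq_inv_mul]
  rfl

/-- Used to pass between sums over `β > 0` and sums over all `β` when the constant term contributes
nothing. -/
theorem finsum_ne_zero {M α : Type*} [AddCommMonoid M] (a : α) (f : α → M) (hf : f a = 0) :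
    ∑ᶠ b : {b // b ≠ a}, f b.1 = ∑ᶠ b, f b := by
  rw [finsum_subtype_eq_finsum_cond]
  refine finsum_congr fun b => ?_
  by_cases hb : b = a
  · simp [hb, hf]
  · simp [hb]

end Box

/-! ### Logarithmic coordinates at the origin of the torus -/

section LogCoord

variable {n : ℕ}

/-- The value of a trigonometric polynomial at the origin. -/
def augment : TorusFun n →ₐ[ℂ] ℂ := AddMonoidAlgebra.lift ℂ ℂ (Fin n → ℤ) 1

@[simp]
theorem augment_torusExp (m : Fin n → ℤ) : augment (torusExp m) = 1 := by
  simp [augment, torusExp]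

/-- The function `e^{2πi xⁱ} - 1`. -/
def tCoord (i : Fin n) : TorusFun n := torusExp (Pi.single i 1) - 1

theorem augment_tCoord (i : Fin n) : augment (tCoord i) = 0 := by
  simp [tCoord]

/-- The truncated logarithm of `e^{2πi xⁱ}`. -/
def logCoord (N : ℕ) (i : Fin n) : TorusFun n := Polynomial.aeval (tCoord i) (logPoly N)

theorem tCoord_dvd_logCoord (N : ℕ) (i : Fin n) : tCoord i ∣ logCoord N i := by
  obtain ⟨q, hq⟩ := X_dvd_logPoly N
  exact ⟨Polynomial.aeval (tCoord i) q, by rw [logCoord, hq, map_mul, Polynomial.aeval_X]⟩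

theorem d_tCoord (j i : Fin n) : d j (tCoord i) = if i = j then 1 + tCoord i else 0 := by
  rw [tCoord, map_sub, Derivation.map_one_eq_zero, sub_zero, d_torusExp]
  split_ifs with h
  · subst h
    simp
  · rw [Pi.single_eq_of_ne (Ne.symm h)]
    simp

theorem d_logCoord (N : ℕ) (j i : Fin n) :
    d j (logCoord N i) = if i = j then 1 - (-tCoord i) ^ N else 0 := by
  have h : d j (logCoord N i) =
      Polynomial.aeval (tCoord i) (Polynomial.derivative (logPoly N)) * d j (tCoord i) :=
    Derivation.map_aeval _ _ _
  rw [h, d_tCoord]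
  split_ifs with hij
  · have := congrArg (Polynomial.aeval (tCoord i)) (derivative_logPoly N)
    simp only [map_mul, map_add, map_one, Polynomial.aeval_X, map_sub, map_pow, map_neg] at this
    rw [mul_comm, this]
  · rw [mul_zero]

/-- The substitution of logarithms into polynomials. -/
def logSubst (N : ℕ) : MvPolynomial (Fin n) ℂ →ₐ[ℂ] TorusFun n := MvPolynomial.aeval (logCoord N)

theorem logSubst_monomial (N : ℕ) (β : Fin n →₀ ℕ) :
    logSubst N (MvPolynomial.monomial β 1) = ∏ i, logCoord N i ^ β i := by
  rw [logSubst, MvPolynomial.aeval_monomial, map_one, one_mul,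
    Finsupp.prod_fintype _ _ fun i => pow_zero _]

theorem augment_logSubst (N : ℕ) (q : MvPolynomial (Fin n) ℂ) :
    augment (logSubst N q) = MvPolynomial.constantCoeff q := by
  have : (augment.comp (logSubst N) : MvPolynomial (Fin n) ℂ →ₐ[ℂ] ℂ) =
      MvPolynomial.aeval (fun _ => (0 : ℂ)) := by
    refine MvPolynomial.algHom_ext fun i => ?_
    obtain ⟨q, hq⟩ := tCoord_dvd_logCoord N i
    rw [AlgHom.comp_apply, logSubst, MvPolynomial.aeval_X, MvPolynomial.aeval_X, hq, map_mul,
      augment_tCoord, zero_mul]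
  have h := AlgHom.congr_fun this q
  rw [AlgHom.comp_apply] at h
  rw [h, MvPolynomial.aeval_zero']
  rfl

/-- The chain rule, with `d_j z_i = δ_ij` up to the truncation error of the logarithm. -/
theorem d_logSubst (N : ℕ) (j : Fin n) (q : MvPolynomial (Fin n) ℂ) :
    d j (logSubst N q) = logSubst N (MvPolynomial.pderiv j q) * (1 - (-tCoord j) ^ N) := by
  induction q using MvPolynomial.induction_on with
  | C a =>
    rw [logSubst, MvPolynomial.aeval_C, Derivation.map_algebraMap, MvPolynomial.pderiv_C, map_zero,
      zero_mul]
  | add p q hp hq => simp only [map_add, hp, hq, add_mul]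
  | mul_X p i hp =>
    simp only [map_mul, Derivation.leibniz, hp, map_add, smul_eq_mul, MvPolynomial.pderiv_X]
    have hX : logSubst N (MvPolynomial.X i) = logCoord N i := MvPolynomial.aeval_X _ i
    rw [hX, d_logCoord]
    by_cases hij : i = j
    · subst hij
      simp only [if_true, Pi.single_eq_same, map_one]
      ring
    · rw [if_neg hij, Pi.single_eq_of_ne hij, map_zero]
      ring

/-- A linear map that kills the ideal generated by the `N`-th powers of the coordinates. -/
def KillsPow {E : Type*} [AddCommGroup E] [Module ℂ E] (N : ℕ) (a : TorusFun n →ₗ[ℂ] E) : Prop :=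
  ∀ i f, a (tCoord i ^ N * f) = 0

variable {E : Type*} [AddCommGroup E] [Module ℂ E] {N : ℕ} {a : TorusFun n →ₗ[ℂ] E}

theorem KillsPow.eq_of_mk_eq (ha : KillsPow N a) {f h : TorusFun n}
    (hfh : Ideal.Quotient.mk (Ideal.span (Set.range fun i : Fin n => tCoord i ^ N)) f =
      Ideal.Quotient.mk _ h) : a f = a h := by
  rw [Ideal.Quotient.eq] at hfh
  have key : ∀ x ∈ Ideal.span (Set.range fun i : Fin n => tCoord i ^ N), ∀ f', a (x * f') = 0 := by
    intro x hx
    induction hx using Submodule.span_induction with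
    | mem x hx =>
      obtain ⟨i, rfl⟩ := hx
      exact ha i
    | zero => simp
    | add x y _ _ hx hy => intro f'; rw [add_mul, map_add, hx, hy, add_zero]
    | smul c x _ hx => intro f'; rw [smul_eq_mul, mul_comm c x, mul_assoc, hx]
  have := key _ hfh 1
  rwa [mul_one, map_sub, sub_eq_zero] at this

/-- The truncation error is a multiple of `t_j^N`. So, as far as `a` can see, `d_j` is `∂/∂z_j`. -/
theorem KillsPow.d_logSubst (ha : KillsPow N a) (f : TorusFun n) (j : Fin n)
    (q : MvPolynomial (Fin n) ℂ) :
    a (f * d j (logSubst N q)) = a (f * logSubst N (MvPolynomial.pderiv j q)) := by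
  rw [JetModules.d_logSubst, mul_sub, mul_one, mul_sub, map_sub, neg_pow]
  have : f * (logSubst N (MvPolynomial.pderiv j q) * ((-1) ^ N * tCoord j ^ N)) =
    tCoord j ^ N * (f * logSubst N (MvPolynomial.pderiv j q) * (-1) ^ N) := by ring
  rw [this, ha, sub_zero]

/-- Since `t_i` divides `log (1 + t_i)`, an exponent `β i ≥ N` makes the substituted monomial
divisible by `t_i^N`. -/
theorem KillsPow.monomial_eq_zero (ha : KillsPow N a) {β : Fin n →₀ ℕ} (hβ : β ∉ box n N) :
    a (logSubst N (MvPolynomial.monomial β 1)) = 0 := by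
  rw [mem_box] at hβ
  push Not at hβ
  obtain ⟨i, hi⟩ := hβ
  have : tCoord i ^ N ∣ logSubst N (MvPolynomial.monomial β 1) := by
    rw [logSubst_monomial]
    exact (pow_dvd_pow_of_dvd (tCoord_dvd_logCoord N i) N).trans
      ((pow_dvd_pow _ hi).trans (Finset.dvd_prod_of_mem _ (Finset.mem_univ i)))
  obtain ⟨f, hf⟩ := this
  rw [hf, ha]

/-- In the quotient by the ideal, `e^{2πi s·x}` is the product of the exponentials of `s_i z_i`,
where `z_i` is nilpotent and truncation loses nothing. Expanding the product gives the sum. -/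
theorem KillsPow.torusExp_eq_sum (hN : 0 < N) (ha : KillsPow N a) (s : Fin n → ℤ) :
    a (torusExp s) = ∑ β ∈ box n N, coef s β • a (logSubst N (MvPolynomial.monomial β 1)) := by
  simp only [← map_smul, ← map_sum]
  refine ha.eq_of_mk_eq ?_
  set I := Ideal.span (Set.range fun i : Fin n => tCoord i ^ N) with hI
  let π : TorusFun n →ₐ[ℂ] TorusFun n ⧸ I := Ideal.Quotient.mkₐ ℂ I
  change π _ = π _
  have ht : ∀ i, π (tCoord i) ^ N = 0 := fun i => by
    rw [← map_pow]
    exact Ideal.Quotient.eq_zero_iff_mem.mpr (Ideal.subset_span ⟨i, rfl⟩)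
  have hℓ : ∀ i, π (logCoord N i) ^ N = 0 := fun i => by
    obtain ⟨q, hq⟩ := tCoord_dvd_logCoord N i
    rw [hq, map_mul, mul_pow, ht, zero_mul]
  have h1 : ∀ i, texp N (π (logCoord N i)) = π (torusExp (Pi.single i 1)) := fun i => by
    obtain ⟨q, hq⟩ := X_pow_dvd_texp_logPoly N
    have h2 := congrArg (fun P => π (Polynomial.aeval (tCoord i) P)) hq
    simp only [map_sub, map_add, map_mul, map_pow, map_one, Polynomial.aeval_X, ht, zero_mul,
      texp, map_sum, map_smul] at h2
    rw [sub_eq_zero] at h2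
    have h3 : π (torusExp (Pi.single i 1)) = 1 + π (tCoord i) := by
      rw [tCoord, map_sub, map_one, add_sub_cancel]
    rw [h3, ← h2]
    rfl
  -- Both sides are multiplicative in `z` and agree at `z = 1`. The case `z = 0` needs `0 < N`,
  -- since the truncation of length `0` is `0` rather than `1`.
  have hz : ∀ i (z : ℤ), texp N ((z : ℂ) • π (logCoord N i)) = π (torusExp (Pi.single i z)) := by
    intro i z
    induction z using Int.induction_on with
    | zero => simp only [Int.cast_zero, texp_zero_smul hN, Pi.single_zero, torusExp_zero, map_one]
    | succ z ih =>
      rw [Int.cast_add, texp_add_smul (hℓ i), ih, Int.cast_one, one_smul, h1, ← map_mul,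
        torusExp_mul, Pi.single_add]
    | pred z ih =>
      have hu : π (torusExp (-Pi.single i 1)) * π (torusExp (Pi.single i 1)) = 1 := by
        rw [← map_mul, torusExp_neg_mul, map_one]
      have h4 := texp_add_smul (hℓ i) (((-z - 1 : ℤ)) : ℂ) 1
      rw [one_smul, h1] at h4
      have h5 : (((-z - 1 : ℤ)) : ℂ) + 1 = ((-z : ℤ) : ℂ) := by push_cast; ring
      rw [h5, ih] at h4
      have h6 : (Pi.single i (-(z : ℤ) - 1) : Fin n → ℤ) = Pi.single i (-(z : ℤ)) + -Pi.single i 1 := by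
        funext k
        by_cases hk : k = i
        · subst hk
          simp [sub_eq_add_neg]
        · simp [Pi.single_eq_of_ne hk]
      rw [h6, ← torusExp_mul, map_mul, h4, mul_assoc, mul_comm (π (torusExp (Pi.single i 1))), hu,
        mul_one]
  have hs : torusExp s = ∏ i, torusExp (Pi.single i (s i)) := by
    have : ∀ S : Finset (Fin n), ∏ i ∈ S, torusExp (Pi.single i (s i)) =
        torusExp (∑ i ∈ S, Pi.single i (s i)) := fun S => by
      induction S using Finset.induction_on with
      | empty => rfl
      | insert i S hi ih => rw [Finset.prod_insert hi, Finset.sum_insert hi, ih, torusExp_mul]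
    rw [this, Finset.univ_sum_single]
  rw [hs, map_prod]
  simp only [map_sum, map_smul, logSubst_monomial, map_prod, map_pow, ← hz]
  exact prod_texp N s _

end LogCoord

/-! ### The `𝔤⁺`-module attached to a module in `𝒥` -/

section PolyHom

variable {n : ℕ} {g : Type u} [LieRing g] [LieAlgebra ℂ g]
variable {U : Type v} [AddCommGroup U] [Module ℂ U]
variable {D : Fin n → (Fin n → ℤ) → Module.End ℂ U} {G : (Fin n → ℤ) → g →ₗ[ℂ] Module.End ℂ U}

/-- The relation at `s = 0`. These commutations let `D j 0` be subtracted without changing any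
bracket. -/
theorem JetRel.lie_zero (h : JetRel D G) (j k : Fin n) (s : Fin n → ℤ) :
    D j 0 * D k s = D k s * D j 0 := by
  have := h.vf_vf j k 0 s
  rw [zero_add, sub_self, smul_zero, Pi.zero_apply, Int.cast_zero, zero_smul, sub_zero,
    LieRing.of_associative_ring_bracket, sub_eq_zero] at this
  exact this

theorem JetRel.loop_lie_zero (h : JetRel D G) (j : Fin n) (s : Fin n → ℤ) (x : g) :
    D j 0 * G s x = G s x * D j 0 := by
  have := h.vf_loop j 0 s x
  rw [zero_add, sub_self, smul_zero, LieRing.of_associative_ring_bracket, sub_eq_zero] at this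
  exact this

variable (D) in
/-- The linear extension of `s ↦ D j s - D j 0`. -/
def vfSymbol (j : Fin n) : TorusFun n →ₗ[ℂ] Module.End ℂ U := torusLin fun s => D j s - D j 0

theorem vfSymbol_one (j : Fin n) : vfSymbol D j 1 = 0 := by
  rw [← torusExp_zero, vfSymbol, torusLin_torusExp, sub_self]

/-- The right side is the bracket of the fields `(f - f(0)) d_i` and `(f' - f'(0)) d_k`. By
bilinearity it suffices to take exponentials, where it is the relation between the `D j s` after the
commuting `D j 0` are removed. -/
theorem JetRel.vfSymbol_comm (h : JetRel D G) (i k : Fin n) (f f' : TorusFun n) :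
    vfSymbol D i f * vfSymbol D k f' - vfSymbol D k f' * vfSymbol D i f =
      vfSymbol D k ((f - algebraMap ℂ _ (augment f)) * d i f') -
        vfSymbol D i ((f' - algebraMap ℂ _ (augment f')) * d k f) := by
  induction f using torusFun_induction with
  | h0 => simp
  | hadd x y hx hy =>
    simp only [map_add, map_sub, add_mul, mul_add, sub_mul] at hx hy ⊢
    linear_combination (norm := abel) hx + hy
  | hexp c s =>
    induction f' using torusFun_induction with
    | h0 => simp
    | hadd x y hx hy =>
      simp only [map_add, map_sub, add_mul, mul_add, sub_mul] at hx hy ⊢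
      linear_combination (norm := abel) hx + hy
    | hexp c' r =>
      have h1 := h.vf_vf i k s r
      rw [LieRing.of_associative_ring_bracket] at h1
      have h2 : vfSymbol D i (torusExp s) * vfSymbol D k (torusExp r) -
          vfSymbol D k (torusExp r) * vfSymbol D i (torusExp s) =
          (r i : ℂ) • (vfSymbol D k (torusExp (s + r)) - vfSymbol D k (torusExp r)) -
          (s k : ℂ) • (vfSymbol D i (torusExp (s + r)) - vfSymbol D i (torusExp s)) := by
        simp only [vfSymbol, torusLin_torusExp, sub_sub_sub_cancel_right, ← h1, sub_mul, mul_sub]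
        rw [h.lie_zero i k r, ← h.lie_zero k i s, h.lie_zero i k 0]
        abel
      simp only [map_smul, Derivation.map_smul, d_torusExp, augment_torusExp, smul_eq_mul, mul_one]
      have e1 : (c • torusExp s - algebraMap ℂ (TorusFun n) c) * c' • (r i : ℂ) • torusExp r =
          (c * c') • ((r i : ℂ) • (torusExp (s + r) - torusExp r)) := by
        rw [← torusExp_mul]
        simp only [Algebra.smul_def, map_mul]
        ring
      have e2 : (c' • torusExp r - algebraMap ℂ (TorusFun n) c') * c • (s k : ℂ) • torusExp s =
          (c * c') • ((s k : ℂ) • (torusExp (s + r) - torusExp s)) := by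
        rw [← torusExp_mul]
        simp only [Algebra.smul_def, map_mul]
        ring
      rw [e1, e2]
      simp only [map_smul, map_sub, smul_mul_smul_comm, mul_comm c' c, ← smul_sub]
      rw [h2]

theorem JetRel.vfSymbol_loop_comm (h : JetRel D G) (i : Fin n) (f f' : TorusFun n) (x : g) :
    vfSymbol D i f * torusLin G f' x - torusLin G f' x * vfSymbol D i f =
      torusLin G ((f - algebraMap ℂ _ (augment f)) * d i f') x := by
  induction f using torusFun_induction with
  | h0 => simp
  | hadd x y hx hy =>
    simp only [map_add, add_mul, mul_add, sub_mul, LinearMap.add_apply, map_sub,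
      LinearMap.sub_apply] at hx hy ⊢
    linear_combination (norm := abel) hx + hy
  | hexp c s =>
    induction f' using torusFun_induction with
    | h0 => simp
    | hadd x y hx hy =>
      simp only [map_add, add_mul, mul_add, sub_mul, LinearMap.add_apply, map_sub,
        LinearMap.sub_apply] at hx hy ⊢
      linear_combination (norm := abel) hx + hy
    | hexp c' r =>
      have h1 := h.vf_loop i s r x
      rw [LieRing.of_associative_ring_bracket] at h1
      have h2 : vfSymbol D i (torusExp s) * G r x - G r x * vfSymbol D i (torusExp s) =
          (r i : ℂ) • (G (s + r) x - G r x) := by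
        simp only [vfSymbol, torusLin_torusExp, ← h1, sub_mul, mul_sub, h.loop_lie_zero]
        abel
      simp only [map_smul, Derivation.map_smul, d_torusExp, augment_torusExp, smul_eq_mul, mul_one]
      have e1 : (c • torusExp s - algebraMap ℂ (TorusFun n) c) * c' • (r i : ℂ) • torusExp r =
          (c * c') • ((r i : ℂ) • (torusExp (s + r) - torusExp r)) := by
        rw [← torusExp_mul]
        simp only [Algebra.smul_def, map_mul]
        ring
      rw [e1]
      simp only [map_smul, map_sub, torusLin_torusExp, LinearMap.smul_apply, LinearMap.sub_apply,
        smul_mul_smul_comm, mul_comm c' c, ← smul_sub]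
      rw [h2]

theorem JetRel.loop_comm (h : JetRel D G) (f f' : TorusFun n) (x y : g) :
    torusLin G f x * torusLin G f' y - torusLin G f' y * torusLin G f x =
      torusLin G (f * f') ⁅x, y⁆ := by
  induction f using torusFun_induction with
  | h0 => simp
  | hadd x y hx hy =>
    simp only [map_add, add_mul, mul_add, LinearMap.add_apply] at hx hy ⊢
    linear_combination (norm := abel) hx + hy
  | hexp c s =>
    induction f' using torusFun_induction with
    | h0 => simp
    | hadd x y hx hy =>
      simp only [map_add, add_mul, mul_add, LinearMap.add_apply] at hx hy ⊢
      linear_combination (norm := abel) hx + hy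
    | hexp c' r =>
      have h1 := h.loop_loop s r x y
      rw [LieRing.of_associative_ring_bracket] at h1
      simp only [map_smul, torusLin_torusExp, LinearMap.smul_apply, smul_mul_smul_comm,
        torusExp_mul, mul_comm c' c, ← smul_sub, h1]

/-- The coordinate vector field `∂ / ∂tᵢ`, where `tᵢ = e^{2πi xⁱ} - 1`. -/
def dCoord (i : Fin n) : VectTorus n := torusExp (-Pi.single i 1) • d i

theorem dCoord_tCoord (i j : Fin n) : dCoord i (tCoord j) = if i = j then 1 else 0 := by
  rw [dCoord, Derivation.smul_apply, d_tCoord]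
  by_cases hij : i = j
  · subst hij
    rw [if_pos rfl, if_pos rfl, tCoord, add_sub_cancel, smul_eq_mul, torusExp_neg_mul]
  · rw [if_neg hij, if_neg (Ne.symm hij), smul_zero]

/-- In the coordinates `t_i` one has `∂/∂t_i = e^{-2πi xⁱ} d_i`; after this twist by a unit the
nilpotency lemmas apply, and multiplying by units does not change the ideal. -/
theorem JetRel.exists_killsPow [FiniteDimensional ℂ U] (h : JetRel D G) :
    ∃ N > 0, (∀ j, KillsPow N (vfSymbol D j)) ∧ ∀ x, KillsPow N ((torusLin G).flip x) := by
  let A : Fin n → TorusFun n →ₗ[ℂ] Module.End ℂ U := fun i =>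
    vfSymbol D i ∘ₗ LinearMap.mulLeft ℂ (torusExp (-Pi.single i 1))
  have hA' : ∀ i f, A i f = vfSymbol D i (torusExp (-Pi.single i 1) * f) := fun _ _ => rfl
  have hA : ∀ i j f f', augment f = 0 → augment f' = 0 →
      A i f * A j f' - A j f' * A i f = A j (f * dCoord i f') - A i (f' * dCoord j f) := by
    intro i j f f' hf hf'
    simp only [hA']
    have e1 : augment (torusExp (-Pi.single i 1) * f) = 0 := by rw [map_mul, hf, mul_zero]
    have e2 : augment (torusExp (-Pi.single j 1) * f') = 0 := by rw [map_mul, hf', mul_zero]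
    rw [h.vfSymbol_comm, e1, e2, map_zero, sub_zero, sub_zero,
      Derivation.leibniz, Derivation.leibniz, d_torusExp, d_torusExp, dCoord, dCoord,
      Derivation.smul_apply, Derivation.smul_apply]
    simp only [smul_eq_mul, mul_add, map_add]
    -- Differentiating the unit factors contributes only for equal indices, where the two extra
    -- terms are symmetric and cancel.
    by_cases hij : i = j
    · subst hij
      have e : ∀ a b : TorusFun n, torusExp (-Pi.single i 1) * a * (torusExp (-Pi.single i 1) * b) =
        torusExp (-Pi.single i 1) * (a * (torusExp (-Pi.single i 1) * b)) := fun a b => by ring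
      have e' : torusExp (-Pi.single i 1) * f *
          (f' * (((-Pi.single i 1 : Fin n → ℤ) i : ℂ) • torusExp (-Pi.single i 1))) =
          torusExp (-Pi.single i 1) * f' *
          (f * (((-Pi.single i 1 : Fin n → ℤ) i : ℂ) • torusExp (-Pi.single i 1))) := by
        ring
      rw [e, e, e']
      abel
    · have h0 : ((-Pi.single j 1 : Fin n → ℤ) i : ℂ) = 0 := by simp [Pi.single_eq_of_ne hij]
      have h0' : ((-Pi.single i 1 : Fin n → ℤ) j : ℂ) = 0 := by
        simp [Pi.single_eq_of_ne (Ne.symm hij)]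
      rw [h0, h0']
      simp only [zero_smul, mul_zero, map_zero, add_zero]
      congr 2 <;> ring
  obtain ⟨N, hN0, hN⟩ := exists_pow_mul_eq_zero dCoord_tCoord augment_tCoord hA
  -- Inserting the unit and its inverse undoes the twist in `A`.
  have hinv : ∀ (i j : Fin n) f, tCoord i ^ N * f =
      torusExp (-Pi.single j 1) * (tCoord i ^ N * (torusExp (Pi.single j 1) * f)) := by
    intro i j f
    linear_combination (-(tCoord i ^ N * f)) * torusExp_neg_mul (Pi.single j (1 : ℤ))
  refine ⟨N, hN0, fun j i f => ?_, fun x i f => ?_⟩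
  · rw [hinv i j f, ← hA', hN]
  · refine pow_mul_eq_zero_of_commutator (B := (torusLin G).flip x) dCoord_tCoord augment_tCoord hN0
      (fun i f => hN i i f) (fun i f f' hf => ?_) i f
    have e1 : augment (torusExp (-Pi.single i 1) * f) = 0 := by rw [map_mul, hf, mul_zero]
    rw [hA', LinearMap.flip_apply, LinearMap.flip_apply, h.vfSymbol_loop_comm, e1, map_zero, sub_zero, dCoord, Derivation.smul_apply, smul_eq_mul]
    congr 2
    ring

end PolyHom

/-! ### The action of polynomial vector fields and polynomial loops on `U` -/

section PolyHom

variable {n : ℕ} {g : Type u} [LieRing g] [LieAlgebra ℂ g]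
variable {U : Type v} [AddCommGroup U] [Module ℂ U]
variable {D : Fin n → (Fin n → ℤ) → Module.End ℂ U} {G : (Fin n → ℤ) → g →ₗ[ℂ] Module.End ℂ U}

theorem derivation_apply_eq_sum (X : Derivation ℂ (MvPolynomial (Fin n) ℂ) (MvPolynomial (Fin n) ℂ))
    (q : MvPolynomial (Fin n) ℂ) :
    X q = ∑ j, X (MvPolynomial.X j) * MvPolynomial.pderiv j q := by
  have : X = ∑ j, X (MvPolynomial.X j) • MvPolynomial.pderiv j := by
    refine MvPolynomial.derivation_ext fun i => ?_
    rw [← Derivation.coeFnAddMonoidHom_apply (∑ j, _), map_sum, Finset.sum_apply,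
      Finset.sum_eq_single i]
    · simp
    · intro j _ hj
      simp [Pi.single_eq_of_ne hj.symm]
    · simp
  conv_lhs => rw [this]
  rw [← Derivation.coeFnAddMonoidHom_apply (∑ j, _), map_sum, Finset.sum_apply]
  rfl

/-- Fields in `W_n⁺` vanish at the origin; this removes the corrections by values at the origin from
the commutator formulas. -/
theorem WPlus.constantCoeff_apply_X (X : WPlus n) (j : Fin n) :
    MvPolynomial.constantCoeff (X.1 (MvPolynomial.X j)) = 0 := by
  obtain ⟨X, hX⟩ := X
  change X ∈ Submodule.span ℂ _ at hX
  change MvPolynomial.constantCoeff (X (MvPolynomial.X j)) = 0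
  induction hX using Submodule.span_induction with
  | zero => simp
  | add x y _ _ hx hy => rw [Derivation.add_apply, map_add, hx, hy, add_zero]
  | smul c x _ hx => rw [Derivation.smul_apply, MvPolynomial.constantCoeff_smul, hx, smul_zero]
  | mem x hx =>
    obtain ⟨α, k, hα, rfl⟩ := hx
    rw [zd, Derivation.smul_apply, smul_eq_mul, map_mul, MvPolynomial.constantCoeff_monomial,
      if_neg hα, zero_mul]

/-- The coefficient of a polynomial vector field along `∂ / ∂z_j`. -/
def wCoeff (j : Fin n) : WPlus n →ₗ[ℂ] MvPolynomial (Fin n) ℂ where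
  toFun X := X.1 (MvPolynomial.X j)
  map_add' _ _ := rfl
  map_smul' _ _ := rfl

/-- The element `z^β ∂/∂z_j`, `β ≠ 0`, of `W_n⁺`. -/
def zdW (β : {β : Fin n →₀ ℕ // β ≠ 0}) (j : Fin n) : WPlus n :=
  ⟨zd β.1 j, Submodule.subset_span ⟨β.1, j, β.2, rfl⟩⟩

theorem zdPlus_eq (β : {β : Fin n →₀ ℕ // β ≠ 0}) (j : Fin n) :
    (zdPlus β j : PolyLie n g) = LieAlgebra.SemiDirectSum.inr _ (zdW β j) := rfl

theorem wCoeff_zdW (β : {β : Fin n →₀ ℕ // β ≠ 0}) (j k : Fin n) :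
    wCoeff j (zdW β k) = if k = j then MvPolynomial.monomial β.1 1 else 0 := by
  change MvPolynomial.monomial β.1 (1 : ℂ) •
    MvPolynomial.pderiv k (MvPolynomial.X j : MvPolynomial (Fin n) ℂ) = _
  split_ifs with h
  · subst h
    rw [MvPolynomial.pderiv_X_self, smul_eq_mul, mul_one]
  · rw [MvPolynomial.pderiv_X_of_ne (Ne.symm h), smul_zero]

variable (D) in
/-- The action on `U` of polynomial vector fields. -/
def wActLin (N : ℕ) : WPlus n →ₗ[ℂ] Module.End ℂ U :=
  ∑ j, vfSymbol D j ∘ₗ (logSubst N).toLinearMap ∘ₗ wCoeff j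

theorem wActLin_apply (N : ℕ) (X : WPlus n) :
    wActLin D N X = ∑ j, vfSymbol D j (logSubst N (X.1 (MvPolynomial.X j))) := by
  rw [wActLin, LinearMap.sum_apply]
  rfl

theorem augment_logSubst_wPlus (N : ℕ) (X : WPlus n) (j : Fin n) :
    augment (logSubst N (X.1 (MvPolynomial.X j))) = 0 := by
  rw [augment_logSubst, WPlus.constantCoeff_apply_X]

variable (G) in
/-- The action on `U` of polynomials with values in `g`. -/
def polyActLin (N : ℕ) : MvPolynomial (Fin n) ℂ ⊗[ℂ] g →ₗ[ℂ] Module.End ℂ U :=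
  TensorProduct.lift (torusLin G ∘ₗ (logSubst N).toLinearMap)

theorem polyActLin_tmul (N : ℕ) (q : MvPolynomial (Fin n) ℂ) (x : g) :
    polyActLin G N (q ⊗ₜ x) = torusLin G (logSubst N q) x := rfl

/-- The coefficients vanish at the origin, and `d_j` acts as `∂/∂z_j` modulo the ideal, so
`JetRel.vfSymbol_comm` becomes the bracket of polynomial vector fields. -/
theorem JetRel.wActLin_lie (h : JetRel D G) {N : ℕ} (hN : ∀ j, KillsPow N (vfSymbol D j))
    (X Y : WPlus n) : wActLin D N ⁅X, Y⁆ = ⁅wActLin D N X, wActLin D N Y⁆ := by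
  rw [LieRing.of_associative_ring_bracket, wActLin_apply, wActLin_apply, wActLin_apply,
    Finset.sum_mul_sum, Finset.sum_mul_sum]
  have h1 : ∀ j k, vfSymbol D j (logSubst N (X.1 (MvPolynomial.X j))) *
      vfSymbol D k (logSubst N (Y.1 (MvPolynomial.X k))) -
      vfSymbol D k (logSubst N (Y.1 (MvPolynomial.X k))) *
      vfSymbol D j (logSubst N (X.1 (MvPolynomial.X j))) =
      vfSymbol D k (logSubst N (X.1 (MvPolynomial.X j) *
        MvPolynomial.pderiv j (Y.1 (MvPolynomial.X k)))) -
      vfSymbol D j (logSubst N (Y.1 (MvPolynomial.X k) *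
        MvPolynomial.pderiv k (X.1 (MvPolynomial.X j)))) := fun j k => by
    rw [h.vfSymbol_comm, augment_logSubst_wPlus, augment_logSubst_wPlus, map_zero, sub_zero,
      sub_zero, (hN k).d_logSubst, (hN j).d_logSubst, map_mul (logSubst N),
      map_mul (logSubst N)]
  have h2 : (∑ j, ∑ k, vfSymbol D j (logSubst N (Y.1 (MvPolynomial.X j))) *
      vfSymbol D k (logSubst N (X.1 (MvPolynomial.X k)))) =
      ∑ j, ∑ k, vfSymbol D k (logSubst N (Y.1 (MvPolynomial.X k))) *
      vfSymbol D j (logSubst N (X.1 (MvPolynomial.X j))) := Finset.sum_comm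
  rw [h2]
  simp only [← Finset.sum_sub_distrib, h1]
  simp only [Finset.sum_sub_distrib]
  rw [Finset.sum_comm]
  simp only [← map_sum, ← derivation_apply_eq_sum]
  rw [← Finset.sum_sub_distrib]
  refine Finset.sum_congr rfl fun j _ => ?_
  rw [← map_sub, ← map_sub]
  rfl

theorem JetRel.polyActLin_lie (h : JetRel D G) (N : ℕ) (a b : MvPolynomial (Fin n) ℂ ⊗[ℂ] g) :
    polyActLin G N ⁅a, b⁆ = ⁅polyActLin G N a, polyActLin G N b⁆ := by
  induction a using TensorProduct.induction_on with
  | zero => simp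
  | add a₁ a₂ h₁ h₂ => simp only [add_lie, map_add, h₁, h₂]
  | tmul f x =>
    induction b using TensorProduct.induction_on with
    | zero => simp
    | add a₁ a₂ h₁ h₂ => simp only [lie_add, map_add, h₁, h₂]
    | tmul f' y =>
      rw [LieAlgebra.ExtendScalars.bracket_tmul, polyActLin_tmul, polyActLin_tmul, polyActLin_tmul,
        LieRing.of_associative_ring_bracket, h.loop_comm, map_mul]

theorem JetRel.wActLin_polyActLin (h : JetRel D G) {N : ℕ}
    (hN : ∀ x, KillsPow N ((torusLin G).flip x)) (X : WPlus n)
    (b : MvPolynomial (Fin n) ℂ ⊗[ℂ] g) :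
    ⁅wActLin D N X, polyActLin G N b⁆ = polyActLin G N (derAct _ g X.1 b) := by
  induction b using TensorProduct.induction_on with
  | zero => simp
  | add a₁ a₂ h₁ h₂ => simp only [lie_add, map_add, h₁, h₂]
  | tmul f' y =>
    rw [derAct_tmul, polyActLin_tmul, polyActLin_tmul, LieRing.of_associative_ring_bracket,
      wActLin_apply, Finset.sum_mul, Finset.mul_sum, ← Finset.sum_sub_distrib,
      derivation_apply_eq_sum, map_sum, map_sum, LinearMap.sum_apply]
    refine Finset.sum_congr rfl fun j _ => ?_
    rw [h.vfSymbol_loop_comm, augment_logSubst_wPlus, map_zero, sub_zero,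
      map_mul (logSubst N)]
    exact (hN y).d_logSubst (logSubst N (X.1 (MvPolynomial.X j))) j f'

/-- The `𝔤⁺`-module structure given by operators that satisfy the relations of a module in `𝒥`. -/
theorem JetRel.exists_polyHom [FiniteDimensional ℂ U] (h : JetRel D G) :
    ∃ (N : ℕ) (ρ : PolyLie n g →ₗ⁅ℂ⁆ Module.End ℂ U),
      (∀ (β : {β : Fin n →₀ ℕ // β ≠ 0}) j, β.1 ∉ box n N → ρ (zdPlus β j) = 0) ∧
      (∀ (β : Fin n →₀ ℕ) x, β ∉ box n N → ρ (zPlus β x) = 0) ∧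
      (∀ j s, D j s = D j 0 +
        ∑ᶠ β : {β : Fin n →₀ ℕ // β ≠ 0}, coef s β.1 • ρ (zdPlus β j)) ∧
      ∀ s x, G s x = ∑ᶠ β : Fin n →₀ ℕ, coef s β • ρ (zPlus β x) := by
  obtain ⟨N, hN0, hA, hB⟩ := h.exists_killsPow
  let ρ : PolyLie n g →ₗ⁅ℂ⁆ Module.End ℂ U := semiDirectLift _
    { polyActLin G N with map_lie' := fun {a b} => h.polyActLin_lie N a b }
    { wActLin D N with map_lie' := fun {a b} => h.wActLin_lie hA a b }
    (fun X b => h.wActLin_polyActLin hB X b)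
  have hd : ∀ β j, ρ (zdPlus β j) = vfSymbol D j (logSubst N (MvPolynomial.monomial β.1 1)) := by
    intro β j
    refine (semiDirectLift_inr _ _ _ _ _).trans ?_
    change wActLin D N (zdW β j) = _
    rw [wActLin, LinearMap.sum_apply, Finset.sum_eq_single j]
    · rw [LinearMap.comp_apply, LinearMap.comp_apply, wCoeff_zdW, if_pos rfl]
      rfl
    · intro k _ hk
      rw [LinearMap.comp_apply, LinearMap.comp_apply, wCoeff_zdW, if_neg hk.symm, map_zero, map_zero]
    · simp
  have hz : ∀ β x, ρ (zPlus β x) = (torusLin G).flip x (logSubst N (MvPolynomial.monomial β 1)) :=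
    fun β x => semiDirectLift_inl _ _ _ _ _
  refine ⟨N, ρ, fun β j hβ => ?_, fun β x hβ => ?_, fun j s => ?_, fun s x => ?_⟩
  · rw [hd, (hA j).monomial_eq_zero hβ]
  · rw [hz, (hB x).monomial_eq_zero hβ]
  · simp only [hd]
    -- The term `β = 0` may be added because the symbol kills constants.
    rw [finsum_ne_zero (0 : Fin n →₀ ℕ) (fun β => coef s β •
      vfSymbol D j (logSubst N (MvPolynomial.monomial β 1)))]
    · rw [finsum_eq_sum_of_support_subset (s := box n N), ← (hA j).torusExp_eq_sum hN0, vfSymbol,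
        torusLin_torusExp, add_sub_cancel]
      intro β hβ
      by_contra hβ'
      refine hβ ?_
      beta_reduce
      rw [(hA j).monomial_eq_zero hβ', smul_zero]
    · have : (MvPolynomial.monomial 0 (1 : ℂ) : MvPolynomial (Fin n) ℂ) = 1 := rfl
      rw [this, map_one, vfSymbol_one, smul_zero]
  · simp only [hz]
    rw [finsum_eq_sum_of_support_subset (s := box n N), ← (hB x).torusExp_eq_sum hN0,
      LinearMap.flip_apply, torusLin_torusExp]
    intro β hβ
    by_contra hβ'
    refine hβ ?_
    beta_reduce
    rw [(hB x).monomial_eq_zero hβ', smul_zero]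

end PolyHom

/-! ### From polynomial vector fields to the torus -/

section ExpPoly

open MvPolynomial

variable {n : ℕ} {E : Type*} [AddCommGroup E] [Module ℂ E]

/-- The truncated exponential of `∑ sᵢ zᵢ`. -/
def expPoly (N : ℕ) (s : Fin n → ℤ) : MvPolynomial (Fin n) ℂ := ∏ i, texp N ((s i : ℂ) • X i)

/-- A linear map that kills the ideal generated by the `N`-th powers of the variables. -/
def KillsX (N : ℕ) (a : MvPolynomial (Fin n) ℂ →ₗ[ℂ] E) : Prop := ∀ i f, a (X i ^ N * f) = 0

variable {N : ℕ} {a : MvPolynomial (Fin n) ℂ →ₗ[ℂ] E}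

theorem killsX_of_monomial (h : ∀ β ∉ box n N, a (monomial β 1) = 0) : KillsX N a := by
  intro i f
  induction f using MvPolynomial.induction_on' with
  | add p q hp hq => rw [mul_add, map_add, hp, hq, add_zero]
  | monomial β c =>
    have : X i ^ N * monomial β c = c • monomial (Finsupp.single i N + β) (1 : ℂ) := by
      rw [X_pow_eq_monomial, monomial_mul, smul_monomial, one_mul, smul_eq_mul, mul_one]
    rw [this, map_smul, h, smul_zero]
    intro hβ
    have := mem_box.mp hβ i
    simp at this

theorem KillsX.succ (ha : KillsX N a) : KillsX (N + 1) a := fun i f => by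
  rw [pow_succ, mul_assoc, ha]

theorem expPoly_eq_sum (N : ℕ) (s : Fin n → ℤ) :
    expPoly N s = ∑ β ∈ box n N, coef s β • monomial β 1 := by
  rw [expPoly, prod_texp]
  refine Finset.sum_congr rfl fun β _ => ?_
  rw [monomial_eq, map_one, one_mul, Finsupp.prod_fintype _ _ fun i => pow_zero _]

/-- Modulo `X_i^N` the variables are nilpotent, so truncated exponentials are multiplicative there.
-/
theorem KillsX.expPoly_mul (ha : KillsX N a) (s r : Fin n → ℤ) (f : MvPolynomial (Fin n) ℂ) :
    a (f * (expPoly N s * expPoly N r)) = a (f * expPoly N (s + r)) := by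
  set I : Ideal (MvPolynomial (Fin n) ℂ) := Ideal.span (Set.range fun i : Fin n => X i ^ N) with hI
  have key : ∀ x ∈ I, ∀ f', a (x * f') = 0 := by
    intro x hx
    induction hx using Submodule.span_induction with
    | mem x hx =>
      obtain ⟨i, rfl⟩ := hx
      exact ha i
    | zero => simp
    | add x y _ _ hx hy => intro f'; rw [add_mul, map_add, hx, hy, add_zero]
    | smul c x _ hx => intro f'; rw [smul_eq_mul, mul_comm c x, mul_assoc, hx]
  let π : MvPolynomial (Fin n) ℂ →ₐ[ℂ] MvPolynomial (Fin n) ℂ ⧸ I := Ideal.Quotient.mkₐ ℂ I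
  have hX : ∀ i, π (X i) ^ N = 0 := fun i => by
    rw [← map_pow]
    exact Ideal.Quotient.eq_zero_iff_mem.mpr (Ideal.subset_span ⟨i, rfl⟩)
  have hπ : ∀ s, π (expPoly N s) = ∏ i, texp N ((s i : ℂ) • π (X i)) := fun s => by
    rw [expPoly, map_prod]
    refine Finset.prod_congr rfl fun i _ => ?_
    simp only [texp, map_sum, map_smul, map_pow]
  have hmul : π (expPoly N s * expPoly N r) = π (expPoly N (s + r)) := by
    rw [map_mul, hπ, hπ, hπ, ← Finset.prod_mul_distrib]
    refine Finset.prod_congr rfl fun i _ => ?_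
    rw [← texp_add_smul (hX i), Pi.add_apply, Int.cast_add]
  have := key _ (Ideal.Quotient.eq.mp hmul) f
  rwa [sub_mul, map_sub, sub_eq_zero, mul_comm _ f, mul_comm _ f] at this

theorem pderiv_texp (N : ℕ) (c : ℂ) (i j : Fin n) :
    pderiv j (texp (N + 1) (c • X i : MvPolynomial (Fin n) ℂ)) =
      if i = j then c • texp N (c • X i) else 0 := by
  have h : pderiv j (c • X i : MvPolynomial (Fin n) ℂ) = if i = j then C c else 0 := by
    rw [Derivation.map_smul, pderiv_X]
    split_ifs with h
    · subst h
      rw [Pi.single_eq_same, smul_eq_C_mul, mul_one]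
    · rw [Pi.single_eq_of_ne h, smul_zero]
  rw [texp, map_sum, Finset.sum_range_succ', texp, Finset.smul_sum]
  simp only [Derivation.map_smul, Derivation.leibniz_pow, h, Nat.add_sub_cancel, zero_smul,
    smul_zero, add_zero]
  split_ifs with hij
  · refine Finset.sum_congr rfl fun k _ => ?_
    rw [smul_eq_mul, mul_comm _ (C c), ← smul_eq_C_mul, Nat.factorial_succ, Nat.cast_mul, mul_inv,
      ← Nat.cast_smul_eq_nsmul ℂ, smul_smul, smul_comm c, smul_smul _ c, smul_smul]
    congr 1
    field_simp
  · simp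

/-- The derivative of a truncation of length `N + 1` is `r_j` times the truncation of length `N`;
the missing term is a multiple of `X_j^N`. This is why exponentials are truncated one step later
than the ideal. -/
theorem KillsX.pderiv_expPoly (ha : KillsX N a) (j : Fin n) (r : Fin n → ℤ)
    (f : MvPolynomial (Fin n) ℂ) :
    a (f * pderiv j (expPoly (N + 1) r)) = (r j : ℂ) • a (f * expPoly (N + 1) r) := by
  set R := ∏ i ∈ Finset.univ.erase j, texp (N + 1) ((r i : ℂ) • X i : MvPolynomial (Fin n) ℂ) with hR
  have h1 : expPoly (N + 1) r = texp (N + 1) ((r j : ℂ) • X j) * R :=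
    (Finset.mul_prod_erase _ _ (Finset.mem_univ j)).symm
  have h2 : pderiv j R = 0 := by
    refine Finset.prod_induction _ (fun q => pderiv j q = 0) (fun p q hp hq => ?_) (by simp)
      fun i hi => ?_
    · rw [Derivation.leibniz, hp, hq, smul_zero, smul_zero, add_zero]
    · rw [pderiv_texp, if_neg (Finset.ne_of_mem_erase hi)]
  have h3 : texp (N + 1) ((r j : ℂ) • X j : MvPolynomial (Fin n) ℂ) =
      texp N ((r j : ℂ) • X j) + (((N.factorial : ℂ)⁻¹) * (r j : ℂ) ^ N) • X j ^ N := by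
    rw [texp, Finset.sum_range_succ, texp, smul_pow, smul_smul]
  have h4 : f * pderiv j (expPoly (N + 1) r) = (r j : ℂ) • (f * expPoly (N + 1) r) -
      X j ^ N * (((r j : ℂ) * (((N.factorial : ℂ)⁻¹) * (r j : ℂ) ^ N)) • (f * R)) := by
    rw [h1, Derivation.leibniz, h2, pderiv_texp, if_pos rfl, h3]
    simp only [smul_eq_mul, mul_zero, zero_add, Algebra.smul_def, map_mul]
    ring
  rw [h4, map_sub, ha, sub_zero, map_smul]

theorem constantCoeff_expPoly (N : ℕ) (s : Fin n → ℤ) : constantCoeff (expPoly (N + 1) s) = 1 := by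
  rw [expPoly, map_prod]
  refine Finset.prod_eq_one fun i _ => ?_
  rw [texp, map_sum, Finset.sum_range_succ']
  simp [constantCoeff_smul]

theorem KillsX.map_expPoly_eq_finsum (ha : ∀ β ∉ box n N, a (monomial β 1) = 0) (s : Fin n → ℤ) :
    a (expPoly (N + 1) s) = ∑ᶠ β, coef s β • a (monomial β 1) := by
  rw [finsum_eq_sum_of_support_subset (s := box n (N + 1)), expPoly_eq_sum, map_sum]
  · simp only [map_smul]
  · intro β hβ
    rw [Finset.mem_coe, mem_box]
    intro i
    by_contra h
    refine hβ ?_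
    beta_reduce
    rw [ha _ fun hb => ?_, smul_zero]
    have := mem_box.mp hb i
    omega

end ExpPoly

/-! ### Commutators in a representation of `𝔤⁺` -/

section Converse

variable {n : ℕ} {g : Type u} [LieRing g] [LieAlgebra ℂ g]
variable {U : Type v} [AddCommGroup U] [Module ℂ U]

open MvPolynomial

theorem smul_pderiv_mem (q : MvPolynomial (Fin n) ℂ) (j : Fin n) :
    (q - C (constantCoeff q)) • pderiv j ∈ WPlus n := by
  change _ ∈ Submodule.span ℂ {D | ∃ (α : Fin n →₀ ℕ) (j : Fin n), α ≠ 0 ∧ D = zd α j}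
  induction q using MvPolynomial.induction_on' with
  | add p q hp hq =>
    have : (p + q - C (constantCoeff (p + q))) • pderiv j =
        (p - C (constantCoeff p)) • (pderiv j : Derivation ℂ _ (MvPolynomial (Fin n) ℂ)) +
          (q - C (constantCoeff q)) • pderiv j := by
      rw [← add_smul]
      congr 1
      simp only [map_add]
      ring
    rw [this]
    exact Submodule.add_mem _ hp hq
  | monomial β c =>
    by_cases hβ : β = 0
    · subst hβ
      have : (monomial 0 c : MvPolynomial (Fin n) ℂ) -
          C (constantCoeff (monomial 0 c : MvPolynomial (Fin n) ℂ)) = 0 := by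
        rw [constantCoeff_monomial, if_pos rfl, C_apply, sub_self]
      rw [this, zero_smul]
      exact Submodule.zero_mem _
    · rw [constantCoeff_monomial, if_neg hβ, C_0, sub_zero]
      have : (monomial β c : MvPolynomial (Fin n) ℂ) = c • monomial β 1 := by
        rw [smul_monomial, smul_eq_mul, mul_one]
      rw [this, smul_assoc]
      exact Submodule.smul_mem _ c (Submodule.subset_span ⟨β, j, hβ, rfl⟩)

/-- The vector field `(q - q(0)) ∂/∂z_j`. -/
def wOf (j : Fin n) : MvPolynomial (Fin n) ℂ →ₗ[ℂ] WPlus n where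
  toFun q := ⟨(q - C (constantCoeff q)) • pderiv j, smul_pderiv_mem q j⟩
  map_add' p q := by
    refine Subtype.ext ?_
    change _ = (p - C (constantCoeff p)) • (pderiv j : Derivation ℂ _ (MvPolynomial (Fin n) ℂ)) +
          (q - C (constantCoeff q)) • pderiv j
    rw [← add_smul]
    change (_ - _) • _ = _
    congr 1
    simp only [map_add]
    ring
  map_smul' c p := by
    refine Subtype.ext ?_
    change (c • p - C (constantCoeff (c • p))) • _ =
      c • (p - C (constantCoeff p)) • (pderiv j : Derivation ℂ _ (MvPolynomial (Fin n) ℂ))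
    rw [← smul_assoc, constantCoeff_smul, smul_eq_mul, C_mul, smul_sub, smul_eq_C_mul, smul_eq_C_mul]

theorem wOf_C (j : Fin n) (c : ℂ) : wOf j (C c) = 0 := by
  refine Subtype.ext ?_
  change (C c - C (constantCoeff (C c))) • (pderiv j : Derivation ℂ _ (MvPolynomial (Fin n) ℂ)) = 0
  rw [constantCoeff_C, sub_self, zero_smul]

theorem wOf_monomial (β : {β : Fin n →₀ ℕ // β ≠ 0}) (j : Fin n) :
    wOf j (monomial β.1 1) = zdW β j := by
  refine Subtype.ext ?_
  change (monomial β.1 (1 : ℂ) - C (constantCoeff (monomial β.1 (1 : ℂ)))) •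
    (pderiv j : Derivation ℂ _ (MvPolynomial (Fin n) ℂ)) = monomial β.1 1 • pderiv j
  rw [constantCoeff_monomial, if_neg β.2, C_0, sub_zero]

/-- The second derivatives of the coordinates vanish, so only the derivatives of the coefficients
remain. -/
theorem lie_smul_pderiv (p q : MvPolynomial (Fin n) ℂ) (j k : Fin n) :
    ⁅p • (pderiv j : Derivation ℂ (MvPolynomial (Fin n) ℂ) (MvPolynomial (Fin n) ℂ)),
      q • (pderiv k : Derivation ℂ (MvPolynomial (Fin n) ℂ) (MvPolynomial (Fin n) ℂ))⁆ =
      (p * pderiv j q) • pderiv k - (q * pderiv k p) • pderiv j := by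
  refine derivation_ext fun i => ?_
  have h : ∀ (a b c : Fin n), pderiv a (pderiv b (X c : MvPolynomial (Fin n) ℂ)) = 0 := by
    intro a b c
    rw [pderiv_X]
    by_cases hbc : c = b
    · subst hbc
      simp
    · simp [Pi.single_eq_of_ne hbc]
  simp only [Derivation.commutator_apply, Derivation.smul_apply, Derivation.sub_apply,
    Derivation.leibniz, smul_eq_mul, h]
  ring

theorem lie_wOf (p q : MvPolynomial (Fin n) ℂ) (j k : Fin n) :
    ⁅wOf j p, wOf k q⁆ = wOf k ((p - C (constantCoeff p)) * pderiv j q) -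
      wOf j ((q - C (constantCoeff q)) * pderiv k p) := by
  refine Subtype.ext ?_
  change ⁅(p - C (constantCoeff p)) • (pderiv j : Derivation ℂ (MvPolynomial (Fin n) ℂ) (MvPolynomial (Fin n) ℂ)),
    (q - C (constantCoeff q)) • (pderiv k : Derivation ℂ (MvPolynomial (Fin n) ℂ) (MvPolynomial (Fin n) ℂ))⁆ =
      (_ - C (constantCoeff _)) • (pderiv k : Derivation ℂ (MvPolynomial (Fin n) ℂ) (MvPolynomial (Fin n) ℂ)) -
        (_ - C (constantCoeff _)) • (pderiv j : Derivation ℂ (MvPolynomial (Fin n) ℂ) (MvPolynomial (Fin n) ℂ))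
  rw [lie_smul_pderiv]
  simp only [map_mul, map_sub, constantCoeff_C, sub_self, zero_mul, C_0, sub_zero, pderiv_C]

variable (ρ : PolyLie n g →ₗ⁅ℂ⁆ Module.End ℂ U)

/-- The linear map `q ↦ ρ((q - q(0)) ∂/∂z_j)`. -/
def rhoW (j : Fin n) : MvPolynomial (Fin n) ℂ →ₗ[ℂ] Module.End ℂ U where
  toFun q := ρ (LieAlgebra.SemiDirectSum.inr _ (wOf j q))
  map_add' p q := by rw [map_add, map_add, map_add]
  map_smul' c p := by rw [map_smul, map_smul, map_smul, RingHom.id_apply]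

/-- The linear map `q ↦ ρ(q x)`. -/
def rhoL : MvPolynomial (Fin n) ℂ →ₗ[ℂ] g →ₗ[ℂ] Module.End ℂ U :=
  LinearMap.mk₂ ℂ (fun q x => ρ (LieAlgebra.SemiDirectSum.inl _ (q ⊗ₜ x)))
    (fun p q x => by rw [TensorProduct.add_tmul, map_add, map_add])
    (fun c p x => by rw [← TensorProduct.smul_tmul', map_smul, map_smul])
    (fun p x y => by rw [TensorProduct.tmul_add, map_add, map_add])
    (fun c p x => by rw [TensorProduct.tmul_smul, map_smul, map_smul])

theorem rhoW_monomial (β : {β : Fin n →₀ ℕ // β ≠ 0}) (j : Fin n) :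
    rhoW ρ j (monomial β.1 1) = ρ (zdPlus β j) := by
  change ρ (LieAlgebra.SemiDirectSum.inr _ (wOf j _)) = _
  rw [wOf_monomial]
  rfl

theorem rhoW_C (j : Fin n) (c : ℂ) : rhoW ρ j (C c) = 0 := by
  change ρ (LieAlgebra.SemiDirectSum.inr _ (wOf j _)) = _
  rw [wOf_C, map_zero, map_zero]

theorem lie_rhoW_rhoW (p q : MvPolynomial (Fin n) ℂ) (j k : Fin n) :
    ⁅rhoW ρ j p, rhoW ρ k q⁆ = rhoW ρ k ((p - C (constantCoeff p)) * pderiv j q) -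
      rhoW ρ j ((q - C (constantCoeff q)) * pderiv k p) := by
  change ⁅ρ _, ρ _⁆ = ρ _ - ρ _
  rw [← map_sub, ← map_sub, ← lie_wOf, LieHom.map_lie, LieHom.map_lie]

theorem lie_rhoW_rhoL (p q : MvPolynomial (Fin n) ℂ) (j : Fin n) (x : g) :
    ⁅rhoW ρ j p, rhoL ρ q x⁆ = rhoL ρ ((p - C (constantCoeff p)) * pderiv j q) x := by
  change ⁅ρ _, ρ _⁆ = ρ _
  rw [← LieHom.map_lie, lie_inr_inl]
  rfl

theorem lie_rhoL_rhoL (p q : MvPolynomial (Fin n) ℂ) (x y : g) :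
    ⁅rhoL ρ p x, rhoL ρ q y⁆ = rhoL ρ (p * q) ⁅x, y⁆ := by
  change ⁅ρ _, ρ _⁆ = ρ _
  rw [← LieHom.map_lie, ← LieHom.map_lie, LieAlgebra.ExtendScalars.bracket_tmul]

end Converse

/-! ### The grading by the Euler field -/

section Euler

variable {n : ℕ} {g : Type u} [LieRing g] [LieAlgebra ℂ g]

open MvPolynomial

/-- The Euler vector field `∑ z_i ∂/∂z_i`, as an element of `W_n⁺`. -/
def eulerW (n : ℕ) : WPlus n := ∑ i, zdW ⟨Finsupp.single i 1, by simp⟩ i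

theorem eulerW_apply (f : MvPolynomial (Fin n) ℂ) : (eulerW n).1 f = ∑ i, X i * pderiv i f := by
  have : (eulerW n).1 = ∑ i : Fin n, zd (Finsupp.single i 1) i := by
    rw [eulerW]
    exact map_sum (WPlus n).toSubmodule.subtype _ _
  rw [this]
  change Derivation.coeFnAddMonoidHom (∑ i : Fin n, zd (Finsupp.single i 1) i) f = _
  rw [map_sum, Finset.sum_apply]
  rfl

theorem eulerW_monomial (β : Fin n →₀ ℕ) (c : ℂ) :
    (eulerW n).1 (monomial β c) = (β.degree : ℂ) • monomial β c := by
  rw [eulerW_apply, (isHomogeneous_monomial c rfl).sum_X_mul_pderiv, Nat.cast_smul_eq_nsmul]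

theorem lie_eulerW_zd (β : Fin n →₀ ℕ) (j : Fin n) :
    ⁅(eulerW n).1, zd β j⁆ = ((β.degree : ℂ) - 1) • zd β j := by
  refine derivation_ext fun i => ?_
  have h1 : (eulerW n).1 (X i) = X i := by
    rw [X, eulerW_monomial]; simp
  have h2 : zd β j (X i) = monomial β 1 * pderiv j (X i) := rfl
  rw [Derivation.commutator_apply, Derivation.smul_apply, h1, h2, sub_smul, one_smul]
  congr 1
  rw [pderiv_X]
  by_cases h : i = j
  · subst h
    rw [Pi.single_eq_same, mul_one, eulerW_monomial]
  · rw [Pi.single_eq_of_ne h, mul_zero, map_zero, smul_zero]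

theorem lie_eulerW_zdW (β : {β : Fin n →₀ ℕ // β ≠ 0}) (j : Fin n) :
    ⁅eulerW n, zdW β j⁆ = ((β.1.degree : ℂ) - 1) • zdW β j :=
  Subtype.ext (lie_eulerW_zd β.1 j)

/-- The Euler vector field, as an element of `𝔤⁺`. -/
def euler (n : ℕ) (g : Type u) [LieRing g] [LieAlgebra ℂ g] : PolyLie n g :=
  LieAlgebra.SemiDirectSum.inr _ (eulerW n)

theorem lie_euler_zdPlus (β : {β : Fin n →₀ ℕ // β ≠ 0}) (j : Fin n) :
    ⁅euler n g, (zdPlus β j : PolyLie n g)⁆ = ((β.1.degree : ℂ) - 1) • zdPlus β j := by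
  rw [zdPlus_eq, euler, ← LieHom.map_lie, lie_eulerW_zdW, map_smul]

theorem lie_euler_zPlus (β : Fin n →₀ ℕ) (x : g) :
    ⁅euler n g, zPlus β x⁆ = (β.degree : ℂ) • zPlus β x := by
  rw [zPlus, euler, lie_inr_inl, ← map_smul, TensorProduct.smul_tmul', ← eulerW_monomial]
  rfl

variable {U : Type v} [AddCommGroup U] [Module ℂ U] (ρ : PolyLie n g →ₗ⁅ℂ⁆ Module.End ℂ U)

/-- The element `z^β ∂/∂z_j` has degree `|β| - 1` under the Euler field and `z^β x` has degree
`|β|`. Only finitely many degrees occur in `End U`, and outside the box `|β|` is large. -/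
theorem exists_forall_notMem_box [FiniteDimensional ℂ U] : ∃ N : ℕ,
    (∀ (β : {β : Fin n →₀ ℕ // β ≠ 0}) j, β.1 ∉ box n N → ρ (zdPlus β j) = 0) ∧
      ∀ (β : Fin n →₀ ℕ) x, β ∉ box n N → ρ (zPlus β x) = 0 := by
  obtain ⟨N, hN⟩ := exists_eq_zero_of_commutator (ρ (euler n g)) (-1)
  obtain ⟨M, hM⟩ := exists_eq_zero_of_commutator (ρ (euler n g)) 0
  have hdeg : ∀ {β : Fin n →₀ ℕ}, β ∉ box n (max N M) → max N M ≤ β.degree := by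
    intro β hβ
    rw [mem_box] at hβ
    push Not at hβ
    obtain ⟨i, hi⟩ := hβ
    exact hi.trans (Finsupp.le_degree i β)
  refine ⟨max N M, fun β j hβ => hN β.1.degree ((le_max_left _ _).trans (hdeg hβ)) _ ?_,
    fun β x hβ => hM β.degree ((le_max_right _ _).trans (hdeg hβ)) _ ?_⟩
  · rw [← LieRing.of_associative_ring_bracket, ← LieHom.map_lie, lie_euler_zdPlus, map_smul]
    push_cast
    rfl
  · rw [← LieRing.of_associative_ring_bracket, ← LieHom.map_lie, lie_euler_zPlus, map_smul]
    push_cast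
    rw [add_zero]

end Euler

/-! ### Operators on `U` defined by a `𝔤⁺`-module -/

section Jet

variable {n : ℕ} {g : Type u} [LieRing g] [LieAlgebra ℂ g]
variable {U : Type v} [AddCommGroup U] [Module ℂ U]

/-- The operators `D`, `G` are given by the polynomial formulas with the `𝔤⁺`-action `ρ`. -/
structure IsJet (D : Fin n → (Fin n → ℤ) → Module.End ℂ U)
    (G : (Fin n → ℤ) → g →ₗ[ℂ] Module.End ℂ U) (lam : Fin n → ℂ)
    (ρ : PolyLie n g →ₗ⁅ℂ⁆ Module.End ℂ U) : Prop where
  vf_eq : ∀ j s, D j s = lam j • (1 : Module.End ℂ U) +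
    ∑ᶠ β : {β : Fin n →₀ ℕ // β ≠ 0}, coef s β.1 • ρ (zdPlus β j)
  loop_eq : ∀ s x, G s x = ∑ᶠ β : Fin n →₀ ℕ, coef s β • ρ (zPlus β x)

theorem coef_zero_left {β : Fin n →₀ ℕ} (hβ : β ≠ 0) : coef (0 : Fin n → ℤ) β = 0 := by
  obtain ⟨i, hi⟩ := Finsupp.ne_iff.mp hβ
  rw [coef, Finset.prod_eq_zero (Finset.mem_univ i), zero_div]
  simpa using hi

theorem IsJet.vf_zero {D : Fin n → (Fin n → ℤ) → Module.End ℂ U}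
    {G : (Fin n → ℤ) → g →ₗ[ℂ] Module.End ℂ U} {lam : Fin n → ℂ}
    {ρ : PolyLie n g →ₗ⁅ℂ⁆ Module.End ℂ U} (h : IsJet D G lam ρ) (j : Fin n) (w : U) :
    D j 0 w = lam j • w := by
  rw [h.vf_eq, finsum_eq_zero_of_forall_eq_zero, add_zero]
  · rfl
  · intro β
    rw [coef_zero_left β.2, zero_smul]

open MvPolynomial in
-- Take `D j s = λ_j + ρ((e^{s·z} - 1) ∂/∂z_j)` and `G s x = ρ(e^{s·z} x)` with truncated
-- exponentials. The relations follow from `e^{s·z} e^{r·z} = e^{(s+r)·z}` and `∂_j e^{r·z} = r_j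
-- e^{r·z}`, valid modulo what `ρ` kills.
theorem exists_isJet [FiniteDimensional ℂ U] (lam : Fin n → ℂ)
    (ρ : PolyLie n g →ₗ⁅ℂ⁆ Module.End ℂ U) : ∃ D G, JetRel D G ∧ IsJet D G lam ρ := by
  obtain ⟨N, hW, hL⟩ := exists_forall_notMem_box ρ
  have hW' : ∀ j, ∀ β ∉ box n N, rhoW ρ j (monomial β 1) = 0 := by
    intro j β hβ
    by_cases h0 : β = 0
    · subst h0
      exact rhoW_C ρ j 1
    · rw [rhoW_monomial ρ ⟨β, h0⟩, hW ⟨β, h0⟩ j hβ]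
  have hL' : ∀ x, ∀ β ∉ box n N, (rhoL ρ).flip x (monomial β 1) = 0 := fun x β hβ => hL β x hβ
  have kW := fun j => killsX_of_monomial (hW' j)
  have kL := fun x => killsX_of_monomial (hL' x)
  -- The identity `(e^{s·z} - 1) ∂_j e^{r·z} = r_j (e^{(s+r)·z} - e^{r·z})`, as seen by `ρ`.
  have mW : ∀ (j k : Fin n) (s r : Fin n → ℤ), rhoW ρ k ((expPoly (N + 1) s - C 1) *
      pderiv j (expPoly (N + 1) r)) =
      (r j : ℂ) • (rhoW ρ k (expPoly (N + 1) (s + r)) - rhoW ρ k (expPoly (N + 1) r)) := by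
    intro j k s r
    have h := (kW k).succ.expPoly_mul s r 1
    rw [one_mul, one_mul] at h
    rw [(kW k).pderiv_expPoly, sub_mul, C_1, one_mul, map_sub, h]
  refine ⟨fun j s => lam j • 1 + rhoW ρ j (expPoly (N + 1) s), fun s => rhoL ρ (expPoly (N + 1) s),
    ⟨fun j k s r => ?_, fun j s r x => ?_, fun s r x y => ?_⟩, ⟨fun j s => ?_, fun s x => ?_⟩⟩
  · have h : ∀ (a b : ℂ) (x y : Module.End ℂ U), ⁅a • 1 + x, b • 1 + y⁆ = ⁅x, y⁆ := by
      intro a b x y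
      simp only [LieRing.of_associative_ring_bracket, add_mul, mul_add, smul_mul_assoc,
        mul_smul_comm, one_mul, mul_one, smul_add, smul_comm a b]
      abel
    rw [h, lie_rhoW_rhoW, constantCoeff_expPoly, constantCoeff_expPoly, mW, mW, add_comm r s,
      add_sub_add_left_eq_sub, add_sub_add_left_eq_sub]
  · have h : ∀ (a : ℂ) (x y : Module.End ℂ U), ⁅a • 1 + x, y⁆ = ⁅x, y⁆ := by
      intro a x y
      simp only [LieRing.of_associative_ring_bracket, add_mul, mul_add, smul_mul_assoc,
        mul_smul_comm, one_mul, mul_one]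
      abel
    rw [h, lie_rhoW_rhoL, constantCoeff_expPoly]
    change (rhoL ρ).flip x _ = _ • ((rhoL ρ).flip x _ - (rhoL ρ).flip x _)
    have h := (kL x).succ.expPoly_mul s r 1
    rw [one_mul, one_mul] at h
    rw [(kL x).pderiv_expPoly, sub_mul, C_1, one_mul, map_sub, h]
  · rw [lie_rhoL_rhoL]
    change (rhoL ρ).flip _ _ = (rhoL ρ).flip _ _
    have := (kL ⁅x, y⁆).succ.expPoly_mul s r 1
    rwa [one_mul, one_mul] at this
  · rw [KillsX.map_expPoly_eq_finsum (hW' j), ← finsum_ne_zero (0 : Fin n →₀ ℕ)]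
    · simp only [rhoW_monomial]
    · rw [show (monomial (0 : Fin n →₀ ℕ) (1 : ℂ)) = C 1 from rfl, rhoW_C, smul_zero]
  · exact KillsX.map_expPoly_eq_finsum (hL' x) s

end Jet

/-! ### The tensor product formulas in terms of operators -/

section JetRealizes

variable {n : ℕ} {g : Type u} [LieRing g] [LieAlgebra ℂ g]

theorem tmul_finsum_apply {ι : Type*} {U : Type v} [AddCommGroup U] [Module ℂ U]
    (m : Fin n → ℤ) (w : U) (c : ι → ℂ) (T : ι → Module.End ℂ U) (hT : {i | T i ≠ 0}.Finite) :
    (torusExp m ⊗ₜ[ℂ] (∑ᶠ i, c i • T i) w : TorusFun n ⊗[ℂ] U) =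
      ∑ᶠ i, c i • (torusExp m ⊗ₜ T i w) := by
  let φ : Module.End ℂ U →ₗ[ℂ] TorusFun n ⊗[ℂ] U :=
    TensorProduct.mk ℂ (TorusFun n) U (torusExp m) ∘ₗ LinearMap.applyₗ w
  have := AddMonoidHom.map_finsum φ.toAddMonoidHom (f := fun i => c i • T i)
    (hT.subset fun i hi h => hi (by beta_reduce; rw [h, smul_zero]))
  refine this.trans (finsum_congr fun i => ?_)
  exact φ.map_smul (c i) (T i)

section

variable {U : Type v} [AddCommGroup U] [Module ℂ U] {D : Fin n → (Fin n → ℤ) → Module.End ℂ U}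
  {G : (Fin n → ℤ) → g →ₗ[ℂ] Module.End ℂ U} {lam : Fin n → ℂ}
  {ρ : PolyLie n g →ₗ⁅ℂ⁆ Module.End ℂ U}

theorem finite_setOf_zdPlus_ne_zero [FiniteDimensional ℂ U] (ρ : PolyLie n g →ₗ⁅ℂ⁆ Module.End ℂ U)
    (j : Fin n) : {β | ρ (zdPlus β j) ≠ 0}.Finite := by
  obtain ⟨N, hW, -⟩ := exists_forall_notMem_box ρ
  refine ((box n N).finite_toSet.preimage Subtype.val_injective.injOn).subset fun β hβ => ?_
  by_contra h
  exact hβ (hW β j h)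

theorem finite_setOf_zPlus_ne_zero [FiniteDimensional ℂ U] (ρ : PolyLie n g →ₗ⁅ℂ⁆ Module.End ℂ U)
    (x : g) : {β | ρ (zPlus β x) ≠ 0}.Finite := by
  obtain ⟨N, -, hL⟩ := exists_forall_notMem_box ρ
  refine (box n N).finite_toSet.subset fun β hβ => ?_
  by_contra h
  exact hβ (hL β x h)

theorem IsJet.torusExp_tmul_vf [FiniteDimensional ℂ U] (h : IsJet D G lam ρ) (j : Fin n)
    (s m : Fin n → ℤ) (w : U) :
    ((m j : ℂ) + lam j) • (torusExp (m + s) ⊗ₜ[ℂ] w) +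
      ∑ᶠ β : {β : Fin n →₀ ℕ // β ≠ 0}, coef s β.1 • (torusExp (m + s) ⊗ₜ[ℂ] ρ (zdPlus β j) w) =
      torusExp (m + s) ⊗ₜ ((m j : ℂ) • w + D j s w) := by
  rw [h.vf_eq, LinearMap.add_apply, LinearMap.smul_apply, Module.End.one_apply, ← add_assoc,
    ← add_smul, TensorProduct.tmul_add, TensorProduct.tmul_smul,
    tmul_finsum_apply _ _ _ _ (finite_setOf_zdPlus_ne_zero ρ j)]

theorem IsJet.torusExp_tmul_loop [FiniteDimensional ℂ U] (h : IsJet D G lam ρ) (x : g)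
    (s m : Fin n → ℤ) (w : U) :
    ∑ᶠ β : Fin n →₀ ℕ, coef s β • (torusExp (m + s) ⊗ₜ[ℂ] ρ (zPlus β x) w) =
      torusExp (m + s) ⊗ₜ G s x w := by
  rw [h.loop_eq, tmul_finsum_apply _ _ _ _ (finite_setOf_zPlus_ne_zero ρ x)]

end

/-- The finiteness clauses hold for every finite-dimensional `𝔤⁺`-module, so only the existence of
the isomorphism has content. -/
theorem jetRealizes_iff {J : JMod.{u, v} n g} {lam : Fin n → ℂ} {U : FDMod.{u, v} (PolyLie n g)}
    {D : Fin n → (Fin n → ℤ) → Module.End ℂ U.carrier}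
    {G : (Fin n → ℤ) → g →ₗ[ℂ] Module.End ℂ U.carrier}
    (h : IsJet D G lam (LieModule.toEnd ℂ (PolyLie n g) U.carrier)) :
    JetRealizes J lam U ↔ ∃ e, Realizes J D G e := by
  constructor
  · rintro ⟨_, _, e, h3, h4⟩
    exact ⟨e, fun j s m w => (h3 j s m w).trans (congrArg e (h.torusExp_tmul_vf j s m w)),
      fun x s m w => (h4 x s m w).trans (congrArg e (h.torusExp_tmul_loop x s m w))⟩
  · rintro ⟨e, he⟩
    exact ⟨finite_setOf_zdPlus_ne_zero _, finite_setOf_zPlus_ne_zero _, e,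
      fun j s m w => (he.vf_lie j s m w).trans (congrArg e (h.torusExp_tmul_vf j s m w).symm),
      fun x s m w => (he.loop_lie x s m w).trans (congrArg e (h.torusExp_tmul_loop x s m w).symm)⟩

end JetRealizes

/-! ### Weight spaces -/

section Joint

variable {V ι K : Type*} [AddCommGroup V] [Module ℂ V] {f : ι → Module.End ℂ V}

/-- Induction on `S`: applying `f i - χ a i` to the sum removes `x a` and rescales the other terms.
For `W = ⊥` this is the independence of joint eigenvectors with different characters. -/
theorem mem_of_sum_mem_of_eigen {W : Submodule ℂ V} (hW : ∀ i, ∀ w ∈ W, f i w ∈ W)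
    (χ : K → ι → ℂ) (hχ : Function.Injective χ) (S : Finset K) :
    ∀ x : K → V, (∀ k i, f i (x k) = χ k i • x k) → ∑ k ∈ S, x k ∈ W → ∀ k ∈ S, x k ∈ W := by
  classical
  induction S using Finset.induction_on with
  | empty => simp
  | insert a S ha ih =>
    intro x hx hs
    have hS : ∀ k ∈ S, x k ∈ W := by
      intro k hk
      -- The operator is chosen after `k`: one that separates the characters of `k` and `a`.
      obtain ⟨i, hi⟩ := Function.ne_iff.mp (hχ.ne (ne_of_mem_of_not_mem hk ha))
      have := ih (fun k => (χ k i - χ a i) • x k)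
        (fun k j => by rw [map_smul, hx, smul_comm]) ?_ k hk
      · exact (W.smul_mem_iff (sub_ne_zero.mpr hi)).mp this
      · have h1 := W.sub_mem (hW i _ hs) (W.smul_mem (χ a i) hs)
        rw [map_sum, Finset.smul_sum, ← Finset.sum_sub_distrib, Finset.sum_insert ha, hx, sub_self,
          zero_add] at h1
        simpa only [hx, ← sub_smul] using h1
    intro k hk
    obtain rfl | hk := Finset.mem_insert.mp hk
    · rw [Finset.sum_insert ha] at hs
      exact (W.add_mem_iff_left (W.sum_mem hS)).mp hs
    · exact hS k hk

/-- Operators are added one at a time. A joint eigenspace is stable under the next one, so the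
eigencomponents of its vectors stay inside it. -/
theorem iSup_iInf_eigenspace_eq_top [Finite ι] (hc : ∀ i j, Commute (f i) (f j))
    (hf : ∀ i, ⨆ μ, (f i).eigenspace μ = ⊤) :
    ⨆ χ : ι → ℂ, ⨅ i, (f i).eigenspace (χ i) = ⊤ := by
  classical
  have := Fintype.ofFinite ι
  suffices h : ∀ s : Finset ι, ⨆ χ : ι → ℂ, ⨅ i ∈ s, (f i).eigenspace (χ i) = ⊤ by
    simpa using h Finset.univ
  intro s
  induction s using Finset.induction_on with
  | empty => simp
  | insert a s ha ih =>
    rw [eq_top_iff, ← ih, iSup_le_iff]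
    intro χ x hx
    set W : Submodule ℂ V := ⨅ i ∈ s, (f i).eigenspace (χ i) with hWdef
    have memW : ∀ w, w ∈ W ↔ ∀ i ∈ s, f i w = χ i • w := fun w => by
      simp only [hWdef, Submodule.mem_iInf, Module.End.mem_eigenspace_iff]
    have hWa : ∀ w ∈ W, f a w ∈ W := by
      intro w hw
      rw [memW] at hw ⊢
      intro i hi
      have := LinearMap.congr_fun (hc i a) w
      rw [Module.End.mul_apply, Module.End.mul_apply, hw i hi, map_smul] at this
      exact this
    have hx' : x ∈ ⨆ μ, (f a).eigenspace μ := hf a ▸ Submodule.mem_top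
    obtain ⟨y, hy, rfl⟩ := (Submodule.mem_iSup_iff_exists_finsupp _ _).mp hx'
    have hyW : ∀ μ ∈ y.support, y μ ∈ W :=
      mem_of_sum_mem_of_eigen (f := fun _ : Unit => f a) (fun _ => hWa) (fun μ _ => μ)
        (fun μ ν h => congr_fun h ()) y.support y
        (fun μ _ => Module.End.mem_eigenspace_iff.mp (hy μ)) hx
    refine Submodule.sum_mem _ fun μ hμ => ?_
    refine Submodule.mem_iSup_of_mem (Function.update χ a μ) ?_
    simp only [Submodule.mem_iInf, Module.End.mem_eigenspace_iff, Finset.mem_insert]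
    rintro i (rfl | hi)
    · rw [Function.update_self]
      exact Module.End.mem_eigenspace_iff.mp (hy μ)
    · rw [Function.update_of_ne (ne_of_mem_of_not_mem hi ha)]
      exact (memW _).mp (hyW μ hμ) i hi

end Joint

/-! ### Weight spaces of modules in `𝒥` -/

section Weights

variable {n : ℕ} {g : Type u} [LieRing g] [LieAlgebra ℂ g] (J : JMod.{u, v} n g)

/-- The operators `d_j` on `J`. -/
def dOp (j : Fin n) : Module.End ℂ J.carrier := LieModule.toEnd ℂ (TorusLie n g) J.carrier (vf (d j))

/-- The weight space of `J` for the weight `μ`. -/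
def wt (μ : Fin n → ℂ) : Submodule ℂ J.carrier := ⨅ j, (dOp J j).eigenspace (μ j)

variable {J}

theorem mem_wt {μ : Fin n → ℂ} {w : J.carrier} :
    w ∈ wt J μ ↔ ∀ j, ⁅(vf (d j) : TorusLie n g), w⁆ = μ j • w := by
  simp only [wt, Submodule.mem_iInf, Module.End.mem_eigenspace_iff]
  rfl

theorem torusExp_zero_smul_d (j : Fin n) : torusExp (0 : Fin n → ℤ) • d j = d j := by
  rw [torusExp_zero, one_smul]

theorem lie_vf_d_vf (j k : Fin n) (s : Fin n → ℤ) :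
    ⁅(vf (d j) : TorusLie n g), (vf (torusExp s • d k) : TorusLie n g)⁆ =
      (s j : ℂ) • vf (torusExp s • d k) := by
  have := lie_vf_vf_torusExp (g := g) j k 0 s
  rwa [torusExp_zero_smul_d, zero_add, Pi.zero_apply, Int.cast_zero, zero_smul, sub_zero] at this

theorem lie_vf_d_loop (j : Fin n) (s : Fin n → ℤ) (x : g) :
    ⁅(vf (d j) : TorusLie n g), (loop (torusExp s ⊗ₜ x) : TorusLie n g)⁆ =
      (s j : ℂ) • loop (torusExp s ⊗ₜ x) := by
  have := lie_vf_loop_torusExp j 0 s x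
  rwa [torusExp_zero_smul_d, zero_add] at this

theorem commute_dOp (j k : Fin n) : Commute (dOp J j) (dOp J k) := by
  refine LinearMap.ext fun w => ?_
  have h := lie_vf_d_vf (g := g) j k 0
  rw [torusExp_zero_smul_d, Pi.zero_apply, Int.cast_zero, zero_smul] at h
  have := leibniz_lie (vf (d j) : TorusLie n g) (vf (d k) : TorusLie n g) w
  rw [h, zero_lie, zero_add] at this
  exact this

theorem iSup_wt : ⨆ μ, wt J μ = ⊤ :=
  iSup_iInf_eigenspace_eq_top commute_dOp J.inCategory.diagonalizable

/-- The weight `m ∈ ℤⁿ`. -/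
def intWt (m : Fin n → ℤ) : Fin n → ℂ := fun j => (m j : ℂ)

theorem intWt_injective : Function.Injective (intWt (n := n)) := fun _ _ h => funext fun j =>
  Int.cast_injective (congr_fun h j)

theorem intWt_add (m m' : Fin n → ℤ) : intWt (m + m') = intWt m + intWt m' :=
  funext fun _ => Int.cast_add _ _

theorem intWt_neg (m : Fin n → ℤ) : intWt (-m) = -intWt m := funext fun _ => Int.cast_neg _

theorem intWt_zero : intWt (0 : Fin n → ℤ) = 0 := funext fun _ => Int.cast_zero

theorem mem_intLattice {μ : Fin n → ℂ} : μ ∈ intLattice n ↔ ∃ m, intWt m = μ := Iff.rfl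

theorem torusExp_smul_mem_wt {μ : Fin n → ℂ} {w : J.carrier} (hw : w ∈ wt J μ) (s : Fin n → ℤ) :
    torusExp s • w ∈ wt J (μ + intWt s) := by
  rw [mem_wt] at hw ⊢
  intro j
  rw [J.inCategory.vf_smul, hw, d_torusExp, smul_assoc, smul_comm (torusExp s) (μ j), ← add_smul,
    add_comm]
  rfl

theorem lie_mem_wt_of_lie {μ : Fin n → ℂ} {w : J.carrier} (hw : w ∈ wt J μ) (s : Fin n → ℤ)
    {y : TorusLie n g} (hy : ∀ j, ⁅(vf (d j) : TorusLie n g), y⁆ = (s j : ℂ) • y) :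
    ⁅y, w⁆ ∈ wt J (μ + intWt s) := by
  rw [mem_wt] at hw ⊢
  intro j
  rw [leibniz_lie, hy, smul_lie, hw, lie_smul, ← add_smul, add_comm]
  rfl

theorem vf_lie_mem_wt {μ : Fin n → ℂ} {w : J.carrier} (hw : w ∈ wt J μ) (j : Fin n)
    (s : Fin n → ℤ) : ⁅(vf (torusExp s • d j) : TorusLie n g), w⁆ ∈ wt J (μ + intWt s) :=
  lie_mem_wt_of_lie hw s fun k => lie_vf_d_vf k j s

theorem loop_lie_mem_wt {μ : Fin n → ℂ} {w : J.carrier} (hw : w ∈ wt J μ) (x : g)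
    (s : Fin n → ℤ) : ⁅(loop (torusExp s ⊗ₜ x) : TorusLie n g), w⁆ ∈ wt J (μ + intWt s) :=
  lie_mem_wt_of_lie hw s fun k => lie_vf_d_loop k s x

theorem mem_of_sum_mem_of_wt {K : Type*} {W : Submodule ℂ J.carrier}
    (hW : ∀ j, ∀ w ∈ W, ⁅(vf (d j) : TorusLie n g), w⁆ ∈ W)
    {χ : K → Fin n → ℂ} (hχ : Function.Injective χ) {S : Finset K}
    {x : K → J.carrier} (hx : ∀ k, x k ∈ wt J (χ k)) (hs : ∑ k ∈ S, x k ∈ W) :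
    ∀ k ∈ S, x k ∈ W :=
  mem_of_sum_mem_of_eigen (f := dOp J) hW χ hχ S x (fun k => mem_wt.mp (hx k)) hs

end Weights

/-! ### `J` as functions tensored with a sum of weight spaces -/

section Transversal

variable {n : ℕ} {g : Type u} [LieRing g] [LieAlgebra ℂ g]

/-- A set of weights meeting every coset of `ℤⁿ` at most once, and each coset that contains a weight
of `J` exactly once. -/
structure IsTransversal (J : JMod.{u, v} n g) (T : Set (Fin n → ℂ)) : Prop where
  inj : Function.Injective fun p : T × (Fin n → ℤ) => p.1.1 + intWt p.2
  cover : ∀ μ, wt J μ ≠ ⊥ → ∃ t ∈ T, ∃ m, μ = t + intWt m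

variable {J : JMod.{u, v} n g} {T : Set (Fin n → ℂ)}

/-- The sum of the weight spaces with weights in `T`. -/
def wtSum (J : JMod.{u, v} n g) (T : Set (Fin n → ℂ)) : Submodule ℂ J.carrier :=
  ⨆ t : T, wt J t.1

/-- Multiplication of functions with elements of a subspace of `J`. -/
def mulMap (J : JMod.{u, v} n g) (U : Submodule ℂ J.carrier) :
    TorusFun n ⊗[ℂ] U →ₗ[TorusFun n] J.carrier :=
  LinearMap.liftBaseChange (TorusFun n) U.subtype

theorem mulMap_tmul (U : Submodule ℂ J.carrier) (f : TorusFun n) (w : U) :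
    mulMap J U (f ⊗ₜ w) = f • (w : J.carrier) := LinearMap.liftBaseChange_tmul _ _ _ _

theorem torusExp_smul_neg_smul (m : Fin n → ℤ) (w : J.carrier) :
    torusExp m • torusExp (-m) • w = w := by
  rw [smul_smul, mul_comm, torusExp_neg_mul, one_smul]

theorem torusExp_neg_smul_smul (m : Fin n → ℤ) (w : J.carrier) :
    torusExp (-m) • torusExp m • w = w := by
  rw [smul_smul, torusExp_neg_mul, one_smul]

theorem wtSum_le_of_forall {N : Submodule ℂ J.carrier} (h : ∀ t ∈ T, wt J t ≤ N) : wtSum J T ≤ N :=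
  iSup_le fun t => h t.1 t.2

theorem wt_le_wtSum {t : Fin n → ℂ} (ht : t ∈ T) : wt J t ≤ wtSum J T :=
  le_iSup (fun t : T => wt J t.1) ⟨t, ht⟩

/-- A vector of weight `t + m` is `e^{2πi m·x}` times a vector of weight `t`. -/
theorem IsTransversal.surjective (hT : IsTransversal J T) :
    Function.Surjective (mulMap J (wtSum J T)) := by
  suffices h : ⨆ μ, wt J μ ≤ LinearMap.range ((mulMap J (wtSum J T)).restrictScalars ℂ) by
    intro w
    rw [iSup_wt] at h
    exact h (Submodule.mem_top (x := w))
  refine iSup_le fun μ w hw => ?_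
  by_cases h0 : wt J μ = ⊥
  · rw [h0, Submodule.mem_bot] at hw
    rw [hw]
    exact Submodule.zero_mem _
  · obtain ⟨t, ht, m, rfl⟩ := hT.cover μ h0
    have := torusExp_smul_mem_wt hw (-m)
    rw [intWt_neg, add_neg_cancel_right] at this
    refine ⟨torusExp m ⊗ₜ ⟨_, wt_le_wtSum ht this⟩, ?_⟩
    rw [LinearMap.restrictScalars_apply, mulMap_tmul]
    exact torusExp_smul_neg_smul m w

/-- The products `e^{2πi m·x} y` with `y` of weight `t ∈ T` have different weights `t + m` for
different pairs `(t, m)`, so no cancellation can occur. -/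
theorem IsTransversal.injective (hT : IsTransversal J T) :
    Function.Injective (mulMap J (wtSum J T)) := by
  classical
  refine (injective_iff_map_eq_zero _).mpr fun t ht => ?_
  obtain ⟨S, hS⟩ := exists_eq_sum_torusExp_tmul t
  have hc : ∀ m, ∃ y : T →₀ J.carrier, (∀ i, y i ∈ wt J i.1) ∧
      (y.sum fun _ x => x) = (comp m t : wtSum J T) := fun m =>
    (Submodule.mem_iSup_iff_exists_finsupp _ _).mp (comp m t).2
  choose y hy hsum using hc
  set R : Finset T := S.biUnion fun m => (y m).support
  have hsum' : ∀ m ∈ S, ((comp m t : wtSum J T) : J.carrier) = ∑ i ∈ R, y m i := fun m hm => by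
    rw [← hsum, Finsupp.sum_of_support_subset _ (Finset.subset_biUnion_of_mem (fun m => (y m).support) hm) _
      fun _ _ => rfl]
  have h0 : ∑ p ∈ R ×ˢ S, torusExp p.2 • y p.2 p.1 ∈ (⊥ : Submodule ℂ J.carrier) := by
    rw [Submodule.mem_bot, Finset.sum_product_right, ← ht, hS, map_sum]
    refine Finset.sum_congr rfl fun m hm => ?_
    rw [mulMap_tmul, hsum' m hm, Finset.smul_sum]
  have key := mem_of_sum_mem_of_wt (W := ⊥) (fun j w hw => by
    rw [Submodule.mem_bot] at hw ⊢; rw [hw, lie_zero]) hT.inj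
    (fun p => torusExp_smul_mem_wt (hy p.2 p.1) p.2) h0
  rw [hS]
  refine Finset.sum_eq_zero fun m hm => ?_
  have : comp m t = 0 := by
    refine Subtype.ext ?_
    rw [hsum' m hm]
    refine Finset.sum_eq_zero fun i hi => ?_
    have := key (i, m) (Finset.mk_mem_product hi hm)
    rw [Submodule.mem_bot] at this
    rw [← torusExp_neg_smul_smul m (y m i), this, smul_zero]
  rw [this, TensorProduct.tmul_zero]

/-- `J` as the tensor product of functions with a sum of weight spaces. -/
def IsTransversal.equiv (hT : IsTransversal J T) :
    (TorusFun n ⊗[ℂ] wtSum J T) ≃ₗ[TorusFun n] J.carrier :=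
  LinearEquiv.ofBijective (mulMap J (wtSum J T)) ⟨hT.injective, hT.surjective⟩

theorem IsTransversal.equiv_tmul (hT : IsTransversal J T) (f : TorusFun n) (w : wtSum J T) :
    hT.equiv (f ⊗ₜ w) = f • (w : J.carrier) := mulMap_tmul _ f w

/-- A basis of `U` over `ℂ` becomes a basis over `F` of a finitely generated module. -/
theorem finiteDimensional_of_equiv {U : Type*} [AddCommGroup U] [Module ℂ U]
    (e : (TorusFun n ⊗[ℂ] U) ≃ₗ[TorusFun n] J.carrier) : FiniteDimensional ℂ U := by
  have := J.inCategory.finite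
  have hfin : Module.Finite (TorusFun n) (TorusFun n ⊗[ℂ] U) := Module.Finite.equiv e.symm
  let b := Module.Free.chooseBasis ℂ U
  have := Module.Finite.finite_basis (b.baseChange (TorusFun n))
  exact Module.Finite.of_basis b

/-- The element `y` raises weights by `s` and the exponential lowers them back. -/
theorem smul_lie_mem_wtSum {y : TorusLie n g} {s : Fin n → ℤ}
    (hy : ∀ j, ⁅(vf (d j) : TorusLie n g), y⁆ = (s j : ℂ) • y) :
    ∀ w ∈ wtSum J T, torusExp (-s) • ⁅y, w⁆ ∈ wtSum J T := by
  intro w hw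
  induction hw using Submodule.iSup_induction' with
  | mem t w hw =>
    refine wt_le_wtSum t.2 ?_
    have := torusExp_smul_mem_wt (lie_mem_wt_of_lie hw s hy) (-s)
    rwa [intWt_neg, add_neg_cancel_right] at this
  | zero => rw [lie_zero, smul_zero]; exact Submodule.zero_mem _
  | add x y _ _ hx hy => rw [lie_add, smul_add]; exact Submodule.add_mem _ hx hy

theorem vf_smul_lie_mem_wtSum (j : Fin n) (s : Fin n → ℤ) :
    ∀ w ∈ wtSum J T, torusExp (-s) • ⁅(vf (torusExp s • d j) : TorusLie n g), w⁆ ∈ wtSum J T :=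
  smul_lie_mem_wtSum fun k => lie_vf_d_vf k j s

theorem loop_smul_lie_mem_wtSum (x : g) (s : Fin n → ℤ) :
    ∀ w ∈ wtSum J T, torusExp (-s) • ⁅(loop (torusExp s ⊗ₜ x) : TorusLie n g), w⁆ ∈ wtSum J T :=
  smul_lie_mem_wtSum fun k => lie_vf_d_loop k s x

variable (J T)

/-- The operators `e^{-2πi s·x} d_j(s)` on a sum of weight spaces. -/
def vfOp (j : Fin n) (s : Fin n → ℤ) : Module.End ℂ (wtSum J T) where
  toFun w := ⟨_, vf_smul_lie_mem_wtSum j s w.1 w.2⟩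
  map_add' w w' := Subtype.ext (by simp only [Submodule.coe_add, lie_add, smul_add])
  map_smul' c w := Subtype.ext (by
    simp only [Submodule.coe_smul, lie_smul, RingHom.id_apply]; rw [smul_comm])

/-- The operators `e^{-2πi s·x} (e^{2πi s·x} x)` on a sum of weight spaces. -/
def loopOp (s : Fin n → ℤ) : g →ₗ[ℂ] Module.End ℂ (wtSum J T) where
  toFun x :=
    { toFun := fun w => ⟨_, loop_smul_lie_mem_wtSum x s w.1 w.2⟩
      map_add' := fun w w' => Subtype.ext (by simp only [Submodule.coe_add, lie_add, smul_add])
      map_smul' := fun c w => Subtype.ext (by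
        simp only [Submodule.coe_smul, lie_smul, RingHom.id_apply]; rw [smul_comm]) }
  map_add' x y := LinearMap.ext fun w => Subtype.ext (by
    simp only [LinearMap.coe_mk, AddHom.coe_mk, LinearMap.add_apply, Submodule.coe_add,
      TensorProduct.tmul_add, ← loopLin_apply, map_add, add_lie, smul_add])
  map_smul' c x := LinearMap.ext fun w => Subtype.ext (by
    simp only [LinearMap.coe_mk, AddHom.coe_mk, LinearMap.smul_apply, Submodule.coe_smul,
      TensorProduct.tmul_smul, ← loopLin_apply, map_smul, smul_lie, RingHom.id_apply]
    rw [smul_comm])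

variable {J T}

theorem IsTransversal.realizes (hT : IsTransversal J T) :
    Realizes J (vfOp J T) (loopOp J T) hT.equiv where
  vf_lie j s m w := by
    have h1 : ((vfOp J T j s w : wtSum J T) : J.carrier) =
      torusExp (-s) • ⁅(vf (torusExp s • d j) : TorusLie n g), (w : J.carrier)⁆ := rfl
    rw [hT.equiv_tmul, hT.equiv_tmul, J.inCategory.vf_smul, smul_d_apply_torusExp,
      Submodule.coe_add, Submodule.coe_smul, h1, smul_add, ← torusExp_mul m s, mul_smul (torusExp m)
      (torusExp s) (torusExp (-s) • _), torusExp_smul_neg_smul, torusExp_mul, smul_assoc,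
      smul_comm _ (m j : ℂ), add_comm m s]
  loop_lie x s m w := by
    have h1 : ((loopOp J T s x w : wtSum J T) : J.carrier) =
      torusExp (-s) • ⁅(loop (torusExp s ⊗ₜ x) : TorusLie n g), (w : J.carrier)⁆ := rfl
    rw [hT.equiv_tmul, hT.equiv_tmul, J.inCategory.loop_smul, h1, ← torusExp_mul m s,
      mul_smul, torusExp_smul_neg_smul]

theorem vfOp_singleton_zero (lam : Fin n → ℂ) (j : Fin n) (w : wtSum J {lam}) :
    vfOp J {lam} j 0 w = lam j • w := by
  refine Subtype.ext ?_
  change torusExp (-0) • ⁅(vf (torusExp 0 • d j) : TorusLie n g), (w : J.carrier)⁆ =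
    lam j • (w : J.carrier)
  have hw : (w : J.carrier) ∈ wt J lam := wtSum_le_of_forall (T := {lam})
    (fun t ht => by rw [Set.mem_singleton_iff.mp ht]) w.2
  rw [neg_zero, torusExp_zero_smul_d, torusExp_zero, one_smul, mem_wt.mp hw]

end Transversal

/-! ### Transversals exist; modules in `𝒥` are polynomial -/

section Existence

variable {n : ℕ} {g : Type u} [LieRing g] [LieAlgebra ℂ g]

theorem exists_isTransversal (J : JMod.{u, v} n g) : ∃ T, IsTransversal J T := by
  refine ⟨Set.range (Quotient.out : (Fin n → ℂ) ⧸ intLattice n → Fin n → ℂ), ⟨?_, ?_⟩⟩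
  · rintro ⟨⟨_, a, rfl⟩, m⟩ ⟨⟨_, b, rfl⟩, m'⟩ h
    have hm : ∀ m : Fin n → ℤ, intWt m ∈ intLattice n := fun m => mem_intLattice.mpr ⟨m, rfl⟩
    dsimp only at h
    have hab : a = b := by
      have := congrArg (QuotientAddGroup.mk (s := intLattice n)) h
      rw [QuotientAddGroup.mk_add, QuotientAddGroup.mk_add,
        (QuotientAddGroup.eq_zero_iff _).mpr (hm m), (QuotientAddGroup.eq_zero_iff _).mpr (hm m'),
        add_zero, add_zero] at this
      rwa [QuotientAddGroup.out_eq', QuotientAddGroup.out_eq'] at this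
    subst hab
    rw [intWt_injective (add_left_cancel h)]
  · intro μ _
    refine ⟨_, ⟨QuotientAddGroup.mk μ, rfl⟩, ?_⟩
    have : -(QuotientAddGroup.mk μ : (Fin n → ℂ) ⧸ intLattice n).out + μ ∈ intLattice n :=
      QuotientAddGroup.eq.mp (QuotientAddGroup.out_eq' _)
    obtain ⟨m, hm⟩ := mem_intLattice.mp this
    exact ⟨m, by rw [hm, add_neg_cancel_left]⟩

/-- Every module in `𝒥` is polynomial. -/
theorem isPolynomial (J : JMod.{u, v} n g) : J.IsPolynomial := by
  classical
  obtain ⟨T, hT⟩ := exists_isTransversal J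
  have := finiteDimensional_of_equiv hT.equiv
  have hR := hT.realizes
  obtain ⟨N, ρ, hW, hL, hD, hG⟩ := hR.jetRel.exists_polyHom
  set b := Module.finBasis ℂ (wtSum J T)
  set B : Module.Basis _ (TorusFun n) J.carrier := (b.baseChange (TorusFun n)).map hT.equiv
  have hB : ∀ (m : Fin n → ℤ) r, torusExp m • B r = hT.equiv (torusExp m ⊗ₜ b r) := by
    intro m r
    rw [Module.Basis.map_apply, Module.Basis.baseChange_apply, ← map_smul, TensorProduct.smul_tmul',
      smul_eq_mul, mul_one]
  have hBs : ∀ (m : Fin n → ℤ) w, hT.equiv (torusExp m ⊗ₜ w) =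
      ∑ l, b.repr w l • (torusExp m • B l) := by
    intro m w
    conv_lhs => rw [← b.sum_repr w, TensorProduct.tmul_sum, map_sum]
    refine Finset.sum_congr rfl fun l _ => ?_
    rw [TensorProduct.tmul_smul, hB]
    exact LinearMap.map_smul_of_tower hT.equiv.toLinearMap _ _
  let c : (Fin n →₀ ℕ) → ℂ := fun β => ∏ i, ((β i).factorial : ℂ)
  let M : (Fin n →₀ ℕ) → MvPolynomial (Fin n ⊕ Fin n) ℂ := fun β =>
    MvPolynomial.C (c β)⁻¹ * ∏ i, MvPolynomial.X (Sum.inl i) ^ β i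
  have hM : ∀ (s m : Fin n → ℤ) β,
      MvPolynomial.eval (Sum.elim (fun i => (s i : ℂ)) (fun i => (m i : ℂ))) (M β) = coef s β := by
    intro s m β
    simp only [M, map_mul, MvPolynomial.eval_C, map_prod, map_pow, MvPolynomial.eval_X,
      Sum.elim_inl]
    rw [coef, div_eq_inv_mul]
  -- `J` may be decomposable here, so `vfOp J T j 0` need not be a scalar; it enters only as a
  -- constant matrix.
  have hD' : ∀ j s, vfOp J T j s = vfOp J T j 0 + ∑ β ∈ box n N,
      coef s β • (if h : β ≠ 0 then ρ (zdPlus ⟨β, h⟩ j) else 0) := by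
    intro j s
    rw [hD j s]
    congr 1
    rw [← finsum_eq_sum_of_support_subset, ← finsum_ne_zero (0 : Fin n →₀ ℕ)]
    · exact finsum_congr fun β => by rw [dif_pos β.2]
    · rw [dif_neg (by simp), smul_zero]
    · intro β hβ
      by_contra h
      refine hβ ?_
      beta_reduce
      split_ifs with h'
      · rw [hW ⟨β, h'⟩ j h, smul_zero]
      · rw [smul_zero]
  have hG' : ∀ s x, loopOp J T s x = ∑ β ∈ box n N, coef s β • ρ (zPlus β x) := by
    intro s x
    rw [hG s x, finsum_eq_sum_of_support_subset]
    intro β hβ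
    by_contra h
    refine hβ ?_
    beta_reduce
    rw [hL β x h, smul_zero]
  -- The three summands are the diagonal term `m_j`, the constant matrix of `vfOp J T j 0`, and the
  -- polynomial in `s`.
  refine ⟨_, B, fun j r l => (if r = l then MvPolynomial.X (Sum.inr j) else 0) +
      MvPolynomial.C (b.repr (vfOp J T j 0 (b r)) l) + ∑ β ∈ box n N, M β *
      MvPolynomial.C (b.repr ((if h : β ≠ 0 then ρ (zdPlus ⟨β, h⟩ j) else 0) (b r)) l),
    fun x r l => ∑ β ∈ box n N, M β * MvPolynomial.C (b.repr (ρ (zPlus β x) (b r)) l), ?_, ?_⟩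
  · intro j s m r
    rw [hB, hR.vf_lie, hBs]
    refine Finset.sum_congr rfl fun l _ => ?_
    congr 1
    rw [hD' j s]
    simp only [map_add, map_sum, map_mul, hM, MvPolynomial.eval_C, LinearMap.add_apply,
      LinearMap.sum_apply, LinearMap.smul_apply, map_smul, Finsupp.add_apply, Finsupp.smul_apply,
      Finsupp.finsetSum_apply, Module.Basis.repr_self, smul_eq_mul, ← add_assoc]
    congr 2
    split_ifs with h
    · subst h; simp
    · simp [Finsupp.single_eq_of_ne' h]
  · intro x s m r
    rw [hB, hR.loop_lie, hBs]
    refine Finset.sum_congr rfl fun l _ => ?_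
    congr 1
    rw [hG' s x]
    simp only [map_sum, map_mul, hM, MvPolynomial.eval_C, LinearMap.sum_apply,
      LinearMap.smul_apply, map_smul, Finsupp.smul_apply, Finsupp.finsetSum_apply, smul_eq_mul]

end Existence

/-! ### Recovering the coefficients of a polynomial in `s` from its values on `ℤⁿ` -/

section Coefficients

variable {n : ℕ} {E : Type*} [AddCommGroup E] [Module ℂ E]

open MvPolynomial in
-- If some `v β` were outside `W`, a functional vanishing on `W` but not at `v β` would give a
-- nonzero polynomial in `s` that vanishes on all of `ℤⁿ`.
theorem mem_of_sum_coef_mem {S : Finset (Fin n →₀ ℕ)} {v : (Fin n →₀ ℕ) → E} (W : Submodule ℂ E)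
    (h : ∀ s : Fin n → ℤ, ∑ β ∈ S, coef s β • v β ∈ W) : ∀ β ∈ S, v β ∈ W := by
  classical
  intro β hβ
  by_contra hv
  obtain ⟨f, hf, hW⟩ := Submodule.exists_le_ker_of_notMem hv
  let c : (Fin n →₀ ℕ) → ℂ := fun β => ∏ i, ((β i).factorial : ℂ)
  have hc : c β ≠ 0 := Finset.prod_ne_zero_iff.mpr fun i _ =>
    Nat.cast_ne_zero.mpr (Nat.factorial_ne_zero _)
  let p : MvPolynomial (Fin n) ℂ := ∑ β ∈ S, monomial β (f (v β) / c β)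
  have hp : p = 0 := by
    refine funext_set (fun _ => Set.range ((↑) : ℤ → ℂ))
      (fun _ => Set.infinite_range_of_injective Int.cast_injective) fun x hx => ?_
    choose s hs using fun i => hx i (Set.mem_univ i)
    obtain rfl : (fun i => (s i : ℂ)) = x := funext hs
    have := hW (h s)
    rw [LinearMap.mem_ker, map_sum] at this
    rw [map_zero, ← this, map_sum]
    refine Finset.sum_congr rfl fun β _ => ?_
    rw [eval_monomial, map_smul, smul_eq_mul, coef, Finsupp.prod_fintype _ _ fun i => pow_zero _]
    ring
  have := congrArg (coeff β) hp
  rw [coeff_sum, coeff_zero, Finset.sum_eq_single_of_mem β hβ, coeff_monomial, if_pos rfl,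
    div_eq_zero_iff] at this
  · exact hf (this.resolve_right hc)
  · intro γ _ hγ
    rw [coeff_monomial, if_neg hγ]

theorem mem_of_finsum_coef_mem {v : (Fin n →₀ ℕ) → E} (hv : (Function.support v).Finite)
    (W : Submodule ℂ E) (h : ∀ s : Fin n → ℤ, ∑ᶠ β, coef s β • v β ∈ W) (β : Fin n →₀ ℕ) :
    v β ∈ W := by
  by_cases h0 : v β = 0
  · rw [h0]; exact W.zero_mem
  · refine mem_of_sum_coef_mem (S := hv.toFinset) W (fun s => ?_) β (by simpa using h0)
    rw [← finsum_eq_sum_of_support_subset]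
    · exact h s
    · intro γ hγ
      rw [Set.Finite.coe_toFinset]
      exact fun h => hγ (by beta_reduce; rw [h, smul_zero])

theorem mem_of_finsum_coef_mem_of_ne {v : {β : Fin n →₀ ℕ // β ≠ 0} → E}
    (hv : (Function.support v).Finite) (W : Submodule ℂ E)
    (h : ∀ s : Fin n → ℤ, ∑ᶠ β, coef s β.1 • v β ∈ W) (β : {β : Fin n →₀ ℕ // β ≠ 0}) :
    v β ∈ W := by
  classical
  let v' : (Fin n →₀ ℕ) → E := fun β => if hβ : β ≠ 0 then v ⟨β, hβ⟩ else 0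
  have h' : ∀ β : {β : Fin n →₀ ℕ // β ≠ 0}, v' β.1 = v β := fun β => dif_pos β.2
  have := mem_of_finsum_coef_mem (v := v') ?_ W (fun s => ?_) β.1
  · rwa [h'] at this
  · refine (hv.image Subtype.val).subset fun γ hγ => ?_
    by_cases h0 : γ ≠ 0
    · refine ⟨⟨γ, h0⟩, ?_, rfl⟩
      rw [Function.mem_support] at hγ ⊢
      rwa [← h']
    · exact absurd (dif_neg h0) hγ
  · rw [← finsum_ne_zero (0 : Fin n →₀ ℕ)]
    · simpa only [h'] using h s
    · rw [show v' 0 = 0 from dif_neg (by simp), smul_zero]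

end Coefficients

/-! ### Generators of `𝔤⁺` -/

section PolyLie

variable {n : ℕ} {g : Type u} [LieRing g] [LieAlgebra ℂ g]

theorem polyLie_induction {p : PolyLie n g → Prop}
    (hadd : ∀ x y, p x → p y → p (x + y)) (hsmul : ∀ (c : ℂ) x, p x → p (c • x))
    (hzd : ∀ β j, p (zdPlus β j)) (hz : ∀ β x, p (zPlus β x)) (x : PolyLie n g) : p x := by
  have h0 : p 0 := by
    have := hsmul 0 _ (hz 0 0)
    rwa [zero_smul] at this
  rw [semiDirectSum_eq _ x]
  refine hadd _ _ ?_ ?_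
  · generalize x.left = y
    induction y using TensorProduct.induction_on with
    | zero => rwa [map_zero]
    | add a b ha hb => rw [map_add]; exact hadd _ _ ha hb
    | tmul q x =>
      induction q using MvPolynomial.induction_on' with
      | add a b ha hb => rw [TensorProduct.add_tmul, map_add]; exact hadd _ _ ha hb
      | monomial β c =>
        have : (MvPolynomial.monomial β c : MvPolynomial (Fin n) ℂ) =
            c • MvPolynomial.monomial β 1 := by
          rw [MvPolynomial.smul_monomial, smul_eq_mul, mul_one]
        rw [this, ← TensorProduct.smul_tmul', map_smul]
        exact hsmul _ _ (hz β x)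
  · obtain ⟨X, hX⟩ := x.right
    have hX' : X ∈ Submodule.span ℂ {D | ∃ (α : Fin n →₀ ℕ) (j : Fin n), α ≠ 0 ∧ D = zd α j} := hX
    induction hX' using Submodule.span_induction with
    | zero =>
      have : (⟨0, hX⟩ : WPlus n) = 0 := rfl
      rwa [this, map_zero]
    | add a b ha hb ha' hb' =>
      have : (⟨a + b, hX⟩ : WPlus n) = ⟨a, ha⟩ + ⟨b, hb⟩ := rfl
      rw [this, map_add]
      exact hadd _ _ (ha' ha) (hb' hb)
    | smul c a ha ha' =>
      have : (⟨c • a, hX⟩ : WPlus n) = c • ⟨a, ha⟩ := rfl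
      rw [this, map_smul]
      exact hsmul _ _ (ha' ha)
    | mem X hX'' =>
      obtain ⟨α, j, hα, rfl⟩ := hX''
      exact hzd ⟨α, hα⟩ j

end PolyLie

/-! ### Passing between the operators `D`, `G` and the `𝔤⁺`-action -/

section Stability

theorem finsum_coef_apply {ι : Type*} {E : Type*} [AddCommGroup E] [Module ℂ E]
    (c : ι → ℂ) {T : ι → Module.End ℂ E}
    (hT : {i | T i ≠ 0}.Finite) (w : E) : (∑ᶠ i, c i • T i) w = ∑ᶠ i, c i • T i w :=
  (LinearMap.applyₗ w : Module.End ℂ E →ₗ[ℂ] E).toAddMonoidHom.map_finsum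
    (hT.subset fun i hi h => hi (by beta_reduce; rw [h, smul_zero]))

variable {n : ℕ} {g : Type u} [LieRing g] [LieAlgebra ℂ g]
variable {U : Type v} [AddCommGroup U] [Module ℂ U] [FiniteDimensional ℂ U]
  {D : Fin n → (Fin n → ℤ) → Module.End ℂ U} {G : (Fin n → ℤ) → g →ₗ[ℂ] Module.End ℂ U}
  {lam : Fin n → ℂ} {ρ : PolyLie n g →ₗ⁅ℂ⁆ Module.End ℂ U}

theorem IsJet.vf_apply (h : IsJet D G lam ρ) (j : Fin n) (s : Fin n → ℤ) (w : U) :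
    D j s w = lam j • w +
      ∑ᶠ β : {β : Fin n →₀ ℕ // β ≠ 0}, coef s β.1 • ρ (zdPlus β j) w := by
  rw [h.vf_eq, LinearMap.add_apply, finsum_coef_apply _ (finite_setOf_zdPlus_ne_zero ρ j)]
  rfl

theorem IsJet.loop_apply (h : IsJet D G lam ρ) (x : g) (s : Fin n → ℤ) (w : U) :
    G s x w = ∑ᶠ β : Fin n →₀ ℕ, coef s β • ρ (zPlus β x) w := by
  rw [h.loop_eq, finsum_coef_apply _ (finite_setOf_zPlus_ne_zero ρ x)]

/-- The action of the generators of `𝔤⁺` consists of the coefficients of `D j s w` and `G s x w` as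
polynomials in `s`. -/
theorem IsJet.stable_of_stable (h : IsJet D G lam ρ) {W : Submodule ℂ U}
    (hD : ∀ j s, ∀ w ∈ W, D j s w ∈ W) (hG : ∀ s x, ∀ w ∈ W, G s x w ∈ W) (y : PolyLie n g) :
    ∀ w ∈ W, ρ y w ∈ W := by
  intro w hw
  induction y using polyLie_induction with
  | hadd x y hx hy => rw [map_add]; exact W.add_mem hx hy
  | hsmul c x hx => rw [map_smul]; exact W.smul_mem c hx
  | hzd β j =>
    refine mem_of_finsum_coef_mem_of_ne (v := fun β => ρ (zdPlus β j) w)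
      ((finite_setOf_zdPlus_ne_zero ρ j).subset fun β hβ h => hβ (by beta_reduce; rw [h]; rfl)) W
      (fun s => ?_) β
    rw [← add_sub_cancel_left (lam j • w) (∑ᶠ _, _), ← h.vf_apply]
    exact W.sub_mem (hD j s w hw) (W.smul_mem _ hw)
  | hz β x =>
    refine mem_of_finsum_coef_mem (v := fun β => ρ (zPlus β x) w)
      ((finite_setOf_zPlus_ne_zero ρ x).subset fun β hβ h => hβ (by beta_reduce; rw [h]; rfl)) W
      (fun s => ?_) β
    rw [← h.loop_apply]
    exact hG s x w hw

theorem IsJet.vf_mem (h : IsJet D G lam ρ) {W : Submodule ℂ U}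
    (hW : ∀ y, ∀ w ∈ W, ρ y w ∈ W) (j : Fin n) (s : Fin n → ℤ) : ∀ w ∈ W, D j s w ∈ W :=
  fun w hw => by
    rw [h.vf_apply]
    exact W.add_mem (W.smul_mem _ hw) (finsum_induction (· ∈ W) W.zero_mem
      (fun _ _ => W.add_mem) fun β => W.smul_mem _ (hW _ w hw))

theorem IsJet.loop_mem (h : IsJet D G lam ρ) {W : Submodule ℂ U}
    (hW : ∀ y, ∀ w ∈ W, ρ y w ∈ W) (s : Fin n → ℤ) (x : g) : ∀ w ∈ W, G s x w ∈ W :=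
  fun w hw => by
    rw [h.loop_apply]
    exact finsum_induction (· ∈ W) W.zero_mem
      (fun _ _ => W.add_mem) fun β => W.smul_mem _ (hW _ w hw)

variable {U' : Type v} [AddCommGroup U'] [Module ℂ U'] [FiniteDimensional ℂ U']
  {D' : Fin n → (Fin n → ℤ) → Module.End ℂ U'} {G' : (Fin n → ℤ) → g →ₗ[ℂ] Module.End ℂ U'}
  {lam' : Fin n → ℂ} {ρ' : PolyLie n g →ₗ⁅ℂ⁆ Module.End ℂ U'}

/-- A linear map that intertwines the operators of two modules up to scalars intertwines the
`𝔤⁺`-actions. -/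
theorem IsJet.intertwine (h : IsJet D G lam ρ) (h' : IsJet D' G' lam' ρ') (φ : U →ₗ[ℂ] U')
    (c : Fin n → ℂ) (hD : ∀ j s w, φ (D j s w) = c j • φ w + D' j s (φ w))
    (hG : ∀ s x w, φ (G s x w) = G' s x (φ w)) (y : PolyLie n g) (w : U) :
    φ (ρ y w) = ρ' y (φ w) := by
  rw [← sub_eq_zero]
  induction y using polyLie_induction generalizing w with
  | hadd x y hx hy =>
    rw [map_add, map_add, LinearMap.add_apply, LinearMap.add_apply, map_add, add_sub_add_comm, hx,
      hy, add_zero]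
  | hsmul a x hx =>
    rw [map_smul, map_smul, LinearMap.smul_apply, LinearMap.smul_apply, map_smul, ← smul_sub, hx,
      smul_zero]
  | hzd β j =>
    have hf := finite_setOf_zdPlus_ne_zero ρ j
    have hf' := finite_setOf_zdPlus_ne_zero ρ' j
    have h1 : ∀ s, φ (∑ᶠ β : {β : Fin n →₀ ℕ // β ≠ 0}, coef s β.1 • ρ (zdPlus β j) w) =
        ∑ᶠ β : {β : Fin n →₀ ℕ // β ≠ 0}, coef s β.1 • φ (ρ (zdPlus β j) w) := fun s => by
      refine (φ.toAddMonoidHom.map_finsum (hf.subset fun β hβ h => hβ ?_)).trans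
        (finsum_congr fun β => φ.map_smul _ _)
      rw [h]
      exact smul_zero _
    refine (Submodule.mem_bot ℂ).mp (mem_of_finsum_coef_mem_of_ne
      (v := fun β => φ (ρ (zdPlus β j) w) - ρ' (zdPlus β j) (φ w))
      ((hf.union hf').subset fun β hβ => ?_) ⊥ (fun s => ?_) β)
    · by_contra hn
      rw [Set.mem_union, not_or, Set.mem_ofPred_eq, Set.mem_ofPred_eq, not_not, not_not] at hn
      refine hβ ?_
      beta_reduce
      rw [hn.1, hn.2]
      simp
    · simp only [smul_sub]
      -- At `s = 0` only the scalars remain; subtracting this cancels `lam`, `lam'` and `c`.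
      have e0 := hD j 0 w
      have e1 := hD j s w
      rw [h.vf_zero, h'.vf_zero] at e0
      rw [h.vf_apply, h'.vf_apply, map_add, h1, e0, ← add_assoc, add_right_inj] at e1
      rw [finsum_sub_distrib, e1, sub_self]
      · exact Submodule.zero_mem _
      · exact hf.subset fun β hβ h => hβ (by beta_reduce; rw [h]; simp)
      · exact hf'.subset fun β hβ h => hβ (by beta_reduce; rw [h]; simp)
  | hz β x =>
    have hf := finite_setOf_zPlus_ne_zero ρ x
    have hf' := finite_setOf_zPlus_ne_zero ρ' x
    have h1 : ∀ s, φ (∑ᶠ β : Fin n →₀ ℕ, coef s β • ρ (zPlus β x) w) =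
        ∑ᶠ β : Fin n →₀ ℕ, coef s β • φ (ρ (zPlus β x) w) := fun s => by
      refine (φ.toAddMonoidHom.map_finsum (hf.subset fun β hβ h => hβ ?_)).trans
        (finsum_congr fun β => φ.map_smul _ _)
      rw [h]
      exact smul_zero _
    refine (Submodule.mem_bot ℂ).mp (mem_of_finsum_coef_mem
      (v := fun β => φ (ρ (zPlus β x) w) - ρ' (zPlus β x) (φ w))
      ((hf.union hf').subset fun β hβ => ?_) ⊥ (fun s => ?_) β)
    · by_contra hn
      rw [Set.mem_union, not_or, Set.mem_ofPred_eq, Set.mem_ofPred_eq, not_not, not_not] at hn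
      refine hβ ?_
      beta_reduce
      rw [hn.1, hn.2]
      simp
    · simp only [smul_sub]
      have e1 := hG s x w
      rw [h.loop_apply, h'.loop_apply, h1] at e1
      rw [finsum_sub_distrib, e1, sub_self]
      · exact Submodule.zero_mem _
      · exact hf.subset fun β hβ h => hβ (by beta_reduce; rw [h]; simp)
      · exact hf'.subset fun β hβ h => hβ (by beta_reduce; rw [h]; simp)

theorem IsJet.map_equiv (h : IsJet D G lam ρ) (h' : IsJet D' G' lam ρ') (φ : U ≃ₗ[ℂ] U')
    (hφ : ∀ y w, φ (ρ y w) = ρ' y (φ w)) :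
    (∀ j s w, φ (D j s w) = D' j s (φ w)) ∧ ∀ s x w, φ (G s x w) = G' s x (φ w) := by
  refine ⟨fun j s w => ?_, fun s x w => ?_⟩
  · rw [h.vf_apply, h'.vf_apply, map_add, map_smul]
    congr 1
    refine (φ.toAddEquiv.map_finsum _).trans (finsum_congr fun β => ?_)
    exact (φ.map_smul _ _).trans (by rw [hφ])
  · rw [h.loop_apply, h'.loop_apply]
    refine (φ.toAddEquiv.map_finsum _).trans (finsum_congr fun β => ?_)
    exact (φ.map_smul _ _).trans (by rw [hφ])

end Stability

/-! ### Submodules and weights of a realized module -/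

section Components

variable {n : ℕ} {V : Type*} [AddCommGroup V] [Module ℂ V]

theorem torusTensor_induction {p : TorusFun n ⊗[ℂ] V → Prop} (h0 : p 0)
    (hadd : ∀ x y, p x → p y → p (x + y)) (h : ∀ (m : Fin n → ℤ) w, p (torusExp m ⊗ₜ w))
    (t : TorusFun n ⊗[ℂ] V) : p t := by
  obtain ⟨S, hS⟩ := exists_eq_sum_torusExp_tmul t
  rw [hS]
  exact Finset.sum_induction _ p hadd h0 fun m _ => h m _

theorem comp_ext {t t' : TorusFun n ⊗[ℂ] V} (h : ∀ m, comp m t = comp m t') : t = t' := by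
  rw [← sub_eq_zero]
  obtain ⟨S, hS⟩ := exists_eq_sum_torusExp_tmul (t - t')
  rw [hS]
  exact Finset.sum_eq_zero fun m _ => by rw [map_sub, h, sub_self, TensorProduct.tmul_zero]

theorem comp_torusExp_smul (m s : Fin n → ℤ) (t : TorusFun n ⊗[ℂ] V) :
    comp (m + s) (torusExp s • t) = comp m t := by
  induction t using torusTensor_induction with
  | h0 => rw [smul_zero, map_zero, map_zero]
  | hadd x y hx hy => rw [smul_add, map_add, map_add, hx, hy]
  | h k w =>
    rw [TensorProduct.smul_tmul', smul_eq_mul, torusExp_mul, add_comm s k]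
    by_cases hk : k = m
    · rw [hk, comp_same, comp_same]
    · rw [comp_of_ne hk, comp_of_ne fun h => hk (add_right_cancel h)]

end Components

/-! ### Isomorphisms, weights and submodules of a realized module -/

section Realized

variable {n : ℕ} {g : Type u} [LieRing g] [LieAlgebra ℂ g] {J : JMod.{u, v} n g}
variable {U : Type v} [AddCommGroup U] [Module ℂ U]
  {D : Fin n → (Fin n → ℤ) → Module.End ℂ U} {G : (Fin n → ℤ) → g →ₗ[ℂ] Module.End ℂ U}
  {lam : Fin n → ℂ} {e : (TorusFun n ⊗[ℂ] U) ≃ₗ[TorusFun n] J.carrier}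

theorem equiv_smul (e : (TorusFun n ⊗[ℂ] U) ≃ₗ[TorusFun n] J.carrier) (c : ℂ)
    (t : TorusFun n ⊗[ℂ] U) : e (c • t) = c • e t :=
  LinearMap.map_smul_of_tower e.toLinearMap c t

theorem equiv_symm_smul (e : (TorusFun n ⊗[ℂ] U) ≃ₗ[TorusFun n] J.carrier) (c : ℂ)
    (w : J.carrier) : e.symm (c • w) = c • e.symm w :=
  LinearMap.map_smul_of_tower e.symm.toLinearMap c w

theorem equiv_torusExp_add_tmul (e : (TorusFun n ⊗[ℂ] U) ≃ₗ[TorusFun n] J.carrier)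
    (m s : Fin n → ℤ) (w : U) :
    e (torusExp (m + s) ⊗ₜ w) = torusExp s • e (torusExp m ⊗ₜ w) := by
  rw [← map_smul, TensorProduct.smul_tmul', smul_eq_mul, torusExp_mul, add_comm]

theorem equiv_torusExp_tmul (e : (TorusFun n ⊗[ℂ] U) ≃ₗ[TorusFun n] J.carrier)
    (m : Fin n → ℤ) (w : U) :
    e (torusExp m ⊗ₜ w) = torusExp m • e (torusExp 0 ⊗ₜ w) := by
  rw [← equiv_torusExp_add_tmul, zero_add]

theorem nontrivial_iff_of_equiv (e : (TorusFun n ⊗[ℂ] U) ≃ₗ[TorusFun n] J.carrier) :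
    Nontrivial J.carrier ↔ Nontrivial U := by
  rw [← not_iff_not, not_nontrivial_iff_subsingleton, not_nontrivial_iff_subsingleton,
    ← e.toEquiv.subsingleton_congr]
  exact ⟨fun _ => (torusExp_tmul_injective (n := n) (0 : Fin n → ℤ)).subsingleton,
    fun _ => ⟨fun a b => comp_ext fun _ => Subsingleton.elim _ _⟩⟩

/-- Two modules in `𝒥` that are realized by the same operators are isomorphic. -/
theorem Realizes.iso {J' : JMod.{u, v} n g}
    {e' : (TorusFun n ⊗[ℂ] U) ≃ₗ[TorusFun n] J'.carrier} (h : Realizes J D G e)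
    (h' : Realizes J' D G e') : J.Iso J' := by
  refine ⟨e.symm.trans e', fun y w => ?_⟩
  obtain ⟨t, rfl⟩ := e.surjective w
  rw [LinearEquiv.trans_apply, LinearEquiv.trans_apply, LinearEquiv.symm_apply_apply]
  induction y using torusLie_induction generalizing t with
  | hadd x y hx hy => rw [add_lie, add_lie, map_add, map_add, hx, hy]
  | hsmul c x hx => rw [smul_lie, smul_lie, equiv_symm_smul, equiv_smul, hx]
  | hvf j s =>
    induction t using torusTensor_induction with
    | h0 => simp
    | hadd x y hx hy => simp only [map_add, lie_add, hx, hy]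
    | h m w => rw [h.vf_lie, h'.vf_lie, LinearEquiv.symm_apply_apply]
  | hloop s x =>
    induction t using torusTensor_induction with
    | h0 => simp
    | hadd x y hx hy => simp only [map_add, lie_add, hx, hy]
    | h m w => rw [h.loop_lie, h'.loop_lie, LinearEquiv.symm_apply_apply]

theorem Realizes.congr_iso {J' : JMod.{u, v} n g} (h : Realizes J D G e) (hJ : J.Iso J') :
    ∃ e', Realizes J' D G e' := by
  obtain ⟨ε, hε⟩ := hJ
  refine ⟨e.trans ε, ⟨fun j s m w => ?_, fun x s m w => ?_⟩⟩
  · rw [LinearEquiv.trans_apply, ← hε, h.vf_lie, LinearEquiv.trans_apply]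
  · rw [LinearEquiv.trans_apply, ← hε, h.loop_lie, LinearEquiv.trans_apply]

theorem Realizes.congr_equiv {U' : Type v} [AddCommGroup U'] [Module ℂ U']
    {D' : Fin n → (Fin n → ℤ) → Module.End ℂ U'} {G' : (Fin n → ℤ) → g →ₗ[ℂ] Module.End ℂ U'}
    (h : Realizes J D G e) (φ : U' ≃ₗ[ℂ] U) (hD : ∀ j s w, φ (D' j s w) = D j s (φ w))
    (hG : ∀ s x w, φ (G' s x w) = G s x (φ w)) : ∃ e', Realizes J D' G' e' := by
  have he : ∀ (m : Fin n → ℤ) w, ((φ.baseChange ℂ (TorusFun n) U' U).trans e) (torusExp m ⊗ₜ w) =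
      e (torusExp m ⊗ₜ φ w) := fun m w => rfl
  refine ⟨(φ.baseChange ℂ (TorusFun n) U' U).trans e, ⟨fun j s m w => ?_, fun x s m w => ?_⟩⟩
  · rw [he, he, h.vf_lie, map_add, map_smul, hD]
  · rw [he, he, h.loop_lie, hG]

/-- Shift of the weight by a vector in `ℤⁿ`. -/
theorem Realizes.shift (h : Realizes J D G e) (k : Fin n → ℤ) :
    ∃ e', Realizes J (fun j s => D j s + (k j : ℂ) • 1) G e' := by
  let a : (TorusFun n)ˣ := ⟨torusExp k, torusExp (-k), by rw [mul_comm, torusExp_neg_mul],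
    torusExp_neg_mul k⟩
  have he : ∀ (m : Fin n → ℤ) w, ((LinearEquiv.smulOfUnit a).trans e) (torusExp m ⊗ₜ w) =
      e (torusExp (m + k) ⊗ₜ w) := fun m w => by
    rw [equiv_torusExp_add_tmul, ← map_smul]; rfl
  refine ⟨(LinearEquiv.smulOfUnit a).trans e, ⟨fun j s m w => ?_, fun x s m w => ?_⟩⟩
  · rw [he, he, h.vf_lie, add_right_comm m k s]
    congr 2
    simp only [Pi.add_apply, Int.cast_add, LinearMap.add_apply, LinearMap.smul_apply,
      Module.End.one_apply]
    module
  · rw [he, he, h.loop_lie, add_right_comm m k s]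

theorem Realizes.mem_wt (h : Realizes J D G e) (h0 : ∀ j w, D j 0 w = lam j • w)
    (m : Fin n → ℤ) (w : U) : e (torusExp m ⊗ₜ w) ∈ wt J (lam + intWt m) := by
  rw [JetModules.mem_wt]
  intro j
  rw [← torusExp_zero_smul_d, h.vf_lie, h0, ← add_smul, add_zero, TensorProduct.tmul_smul,
    equiv_smul, add_comm]
  rfl

theorem Realizes.comp_lie (h : Realizes J D G e) (h0 : ∀ j w, D j 0 w = lam j • w)
    (m : Fin n → ℤ) (j : Fin n) (w : J.carrier) :
    comp m (e.symm ⁅(vf (d j) : TorusLie n g), w⁆) = (lam j + m j) • comp m (e.symm w) := by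
  obtain ⟨t, rfl⟩ := e.surjective w
  rw [LinearEquiv.symm_apply_apply]
  induction t using torusTensor_induction with
  | h0 => simp
  | hadd x y hx hy => simp only [map_add, lie_add, smul_add, hx, hy]
  | h k w =>
    rw [JetModules.mem_wt.mp (h.mem_wt h0 k w), ← equiv_smul, LinearEquiv.symm_apply_apply,
      map_smul]
    by_cases hk : k = m
    · subst hk
      rfl
    · rw [comp_of_ne hk, smul_zero, smul_zero]

/-- If `μ` differs from every `lam + m`, each component of `w` is multiplied by two different
scalars under some `d_j`, hence vanishes. -/
theorem Realizes.exists_of_mem_wt (h : Realizes J D G e) (h0 : ∀ j w, D j 0 w = lam j • w)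
    {μ : Fin n → ℂ} {w : J.carrier} (hw : w ∈ wt J μ) (hw0 : w ≠ 0) :
    ∃ m, μ = lam + intWt m := by
  by_contra! hμ
  refine hw0 (e.symm.injective (comp_ext fun m => ?_))
  obtain ⟨j, hj⟩ := Function.ne_iff.mp (hμ m)
  have := h.comp_lie h0 m j w
  rw [JetModules.mem_wt.mp hw, equiv_symm_smul, map_smul, ← sub_eq_zero, ← sub_smul,
    smul_eq_zero] at this
  rw [map_zero, map_zero]
  exact this.resolve_left (sub_ne_zero.mpr hj)

/-- A weight vector has no component along any other exponential, so a weight space is a copy of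
`U`. -/
theorem Realizes.eq_of_mem_wt (h : Realizes J D G e) (h0 : ∀ j w, D j 0 w = lam j • w)
    {k : Fin n → ℤ} {w : J.carrier} (hw : w ∈ wt J (lam + intWt k)) :
    e (torusExp k ⊗ₜ comp k (e.symm w)) = w := by
  refine e.symm.injective (comp_ext fun m => ?_)
  rw [LinearEquiv.symm_apply_apply]
  by_cases hm : k = m
  · subst hm
    rw [comp_same]
  · rw [comp_of_ne hm]
    obtain ⟨j, hj⟩ := Function.ne_iff.mp (intWt_injective.ne hm)
    have := h.comp_lie h0 m j w
    rw [JetModules.mem_wt.mp hw, equiv_symm_smul, map_smul, ← sub_eq_zero, ← sub_smul,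
      smul_eq_zero, Pi.add_apply, add_sub_add_left_eq_sub] at this
    exact (this.resolve_left (sub_ne_zero.mpr hj)).symm

section Submodules

variable {N : LieSubmodule ℂ (TorusLie n g) J.carrier}

theorem FunStable.mem_iff (hN : J.FunStable N) (m : Fin n → ℤ) (w : U) :
    e (torusExp m ⊗ₜ w) ∈ N ↔ e (torusExp 0 ⊗ₜ w) ∈ N := by
  rw [equiv_torusExp_tmul]
  refine ⟨fun h => ?_, hN _ _⟩
  have := hN (torusExp (-m)) _ h
  rwa [torusExp_neg_smul_smul] at this

/-- The homogeneous components are weight vectors of different weights, so a submodule contains them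
with their sum; stability under functions moves them to exponent `0`. -/
theorem Realizes.comp_mem (h : Realizes J D G e) (h0 : ∀ j w, D j 0 w = lam j • w)
    (hN : J.FunStable N) {t : TorusFun n ⊗[ℂ] U} (ht : e t ∈ N) (m : Fin n → ℤ) :
    e (torusExp 0 ⊗ₜ comp m t) ∈ N := by
  obtain ⟨S, hS⟩ := exists_eq_sum_torusExp_tmul t
  by_cases hm : m ∈ S
  · rw [← FunStable.mem_iff hN m]
    refine mem_of_sum_mem_of_wt (W := N.toSubmodule) (S := S) (χ := fun m => lam + intWt m)
      (x := fun m => e (torusExp m ⊗ₜ comp m t)) (fun j w hw => N.lie_mem hw)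
      (fun m m' hm => intWt_injective (add_left_cancel hm)) (fun k => h.mem_wt h0 k _) ?_ m hm
    rw [← map_sum, ← hS]
    exact ht
  · have : comp m t = 0 := by
      rw [hS, map_sum]
      exact Finset.sum_eq_zero fun k hk => comp_of_ne (ne_of_mem_of_not_mem hk hm) _
    rw [this, TensorProduct.tmul_zero, map_zero]
    exact N.zero_mem

/-- The subspace of `U` that generates a submodule of `F(𝕋ⁿ) ⊗ U`. -/
def down (e : (TorusFun n ⊗[ℂ] U) ≃ₗ[TorusFun n] J.carrier)
    (N : LieSubmodule ℂ (TorusLie n g) J.carrier) : Submodule ℂ U where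
  carrier := {w | e (torusExp 0 ⊗ₜ w) ∈ N}
  add_mem' ha hb := by
    rw [Set.mem_ofPred_eq, TensorProduct.tmul_add, map_add]
    exact N.add_mem ha hb
  zero_mem' := by
    rw [Set.mem_ofPred_eq, TensorProduct.tmul_zero, map_zero]
    exact N.zero_mem
  smul_mem' c w hw := by
    rw [Set.mem_ofPred_eq, TensorProduct.tmul_smul, equiv_smul]
    exact N.smul_mem c hw

theorem mem_down {w : U} : w ∈ down e N ↔ e (torusExp 0 ⊗ₜ w) ∈ N := Iff.rfl

theorem Realizes.vf_mem_down (h : Realizes J D G e) (hN : J.FunStable N) (j : Fin n)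
    (s : Fin n → ℤ) : ∀ w ∈ down e N, D j s w ∈ down e N := by
  intro w hw
  have : ⁅(vf (torusExp s • d j) : TorusLie n g), e (torusExp 0 ⊗ₜ w)⁆ ∈ N :=
    N.lie_mem (mem_down.mp hw)
  rw [h.vf_lie, FunStable.mem_iff hN] at this
  rwa [Pi.zero_apply, Int.cast_zero, zero_smul, zero_add] at this

theorem Realizes.loop_mem_down (h : Realizes J D G e) (hN : J.FunStable N)
    (s : Fin n → ℤ) (x : g) : ∀ w ∈ down e N, G s x w ∈ down e N := by
  intro w hw
  have : ⁅(loop (torusExp s ⊗ₜ x) : TorusLie n g), e (torusExp 0 ⊗ₜ w)⁆ ∈ N :=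
    N.lie_mem (mem_down.mp hw)
  rwa [h.loop_lie, FunStable.mem_iff hN] at this

theorem Realizes.mem_iff_comp_mem (h : Realizes J D G e) (h0 : ∀ j w, D j 0 w = lam j • w)
    (hN : J.FunStable N) (w : J.carrier) : w ∈ N ↔ ∀ m, comp m (e.symm w) ∈ down e N := by
  refine ⟨fun hw m => h.comp_mem h0 hN (by rwa [LinearEquiv.apply_symm_apply]) m, fun hw => ?_⟩
  obtain ⟨S, hS⟩ := exists_eq_sum_torusExp_tmul (e.symm w)
  rw [LinearEquiv.symm_apply_eq, map_sum] at hS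
  rw [hS]
  exact sum_mem fun m _ => (FunStable.mem_iff hN m _).mpr (mem_down.mp (hw m))

/-- The submodule of `F(𝕋ⁿ) ⊗ U` generated by a stable subspace of `U`. -/
def Realizes.up (h : Realizes J D G e) (W : Submodule ℂ U) (hD : ∀ j s, ∀ w ∈ W, D j s w ∈ W)
    (hG : ∀ s x, ∀ w ∈ W, G s x w ∈ W) : LieSubmodule ℂ (TorusLie n g) J.carrier where
  carrier := {w | ∀ m, comp m (e.symm w) ∈ W}
  add_mem' ha hb m := by
    rw [map_add, map_add]
    exact W.add_mem (ha m) (hb m)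
  zero_mem' m := by
    rw [map_zero, map_zero]
    exact W.zero_mem
  smul_mem' c w hw m := by
    rw [equiv_symm_smul, map_smul]
    exact W.smul_mem c (hw m)
  lie_mem := by
    intro y w hw m
    have hc : ∀ (k : Fin n → ℤ), ∀ a ∈ W,
        comp m (e.symm (e (torusExp k ⊗ₜ[ℂ] a))) ∈ W := by
      intro k a ha
      rw [LinearEquiv.symm_apply_apply]
      by_cases hk : k = m
      · rwa [hk, comp_same]
      · rw [comp_of_ne hk]
        exact W.zero_mem
    obtain ⟨S, hS⟩ := exists_eq_sum_torusExp_tmul (e.symm w)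
    rw [LinearEquiv.symm_apply_eq, map_sum] at hS
    change comp m (e.symm ⁅y, w⁆) ∈ W
    have key : ∀ k a, a ∈ W → comp m (e.symm ⁅y, e (torusExp k ⊗ₜ[ℂ] a)⁆) ∈ W := by
      intro k a ha
      induction y using torusLie_induction with
      | hadd x y hx hy =>
        rw [add_lie, map_add, map_add]
        exact W.add_mem hx hy
      | hsmul c x hx =>
        rw [smul_lie, equiv_symm_smul, map_smul]
        exact W.smul_mem c hx
      | hvf j s =>
        rw [h.vf_lie]
        exact hc _ _ (W.add_mem (W.smul_mem _ ha) (hD j s a ha))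
      | hloop s x =>
        rw [h.loop_lie]
        exact hc _ _ (hG s x a ha)
    rw [hS, lie_sum, map_sum, map_sum]
    exact W.sum_mem fun k _ => key k _ (hw k)

variable {W : Submodule ℂ U} {hD : ∀ j s, ∀ w ∈ W, D j s w ∈ W}
  {hG : ∀ s x, ∀ w ∈ W, G s x w ∈ W}

theorem Realizes.mem_up (h : Realizes J D G e) {w : J.carrier} :
    w ∈ h.up W hD hG ↔ ∀ m, comp m (e.symm w) ∈ W := Iff.rfl

theorem Realizes.funStable_up (h : Realizes J D G e) : J.FunStable (h.up W hD hG) := by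
  intro f w hw
  induction f using torusFun_induction with
  | h0 => rw [zero_smul]; exact (h.up W hD hG).zero_mem
  | hadd x y hx hy => rw [add_smul]; exact (h.up W hD hG).add_mem hx hy
  | hexp c s =>
    rw [smul_assoc]
    refine (h.up W hD hG).smul_mem c ?_
    change torusExp s • w ∈ h.up W hD hG
    rw [h.mem_up] at hw ⊢
    intro m
    have := hw (m - s)
    rwa [← comp_torusExp_smul (m - s) s, sub_add_cancel, ← map_smul] at this

theorem Realizes.tmul_mem_up (h : Realizes J D G e) {m : Fin n → ℤ} {w : U} :
    e (torusExp m ⊗ₜ w) ∈ h.up W hD hG ↔ w ∈ W := by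
  rw [h.mem_up, LinearEquiv.symm_apply_apply]
  refine ⟨fun hw => by simpa only [comp_same] using hw m, fun hw k => ?_⟩
  by_cases hk : m = k
  · rwa [hk, comp_same]
  · rw [comp_of_ne hk]
    exact W.zero_mem

end Submodules

end Realized

/-! ### Submodules of `J` and submodules of `U` -/

section Correspondence

variable {n : ℕ} {g : Type u} [LieRing g] [LieAlgebra ℂ g] {J : JMod.{u, v} n g}
  {U : FDMod.{u, v} (PolyLie n g)} {D : Fin n → (Fin n → ℤ) → Module.End ℂ U.carrier}
  {G : (Fin n → ℤ) → g →ₗ[ℂ] Module.End ℂ U.carrier} {lam : Fin n → ℂ}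
  {e : (TorusFun n ⊗[ℂ] U.carrier) ≃ₗ[TorusFun n] J.carrier}

/-- The submodule of `U` that generates a submodule of `F(𝕋ⁿ) ⊗ U`. -/
def downLie (hI : IsJet D G lam (LieModule.toEnd ℂ (PolyLie n g) U.carrier))
    (h : Realizes J D G e) {N : LieSubmodule ℂ (TorusLie n g) J.carrier} (hN : J.FunStable N) :
    LieSubmodule ℂ (PolyLie n g) U.carrier where
  __ := down e N
  lie_mem {y w} hw := hI.stable_of_stable (h.vf_mem_down hN) (h.loop_mem_down hN) y w hw

/-- The submodule of `F(𝕋ⁿ) ⊗ U` generated by a submodule of `U`. -/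
def upLie (hI : IsJet D G lam (LieModule.toEnd ℂ (PolyLie n g) U.carrier))
    (h : Realizes J D G e) (W : LieSubmodule ℂ (PolyLie n g) U.carrier) :
    LieSubmodule ℂ (TorusLie n g) J.carrier :=
  h.up W.toSubmodule (hI.vf_mem fun _ _ hw => W.lie_mem hw) (hI.loop_mem fun _ _ hw => W.lie_mem hw)

variable {hI : IsJet D G lam (LieModule.toEnd ℂ (PolyLie n g) U.carrier)}
  {h : Realizes J D G e} {N N' : LieSubmodule ℂ (TorusLie n g) J.carrier}
  {W W' : LieSubmodule ℂ (PolyLie n g) U.carrier}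

theorem funStable_upLie : J.FunStable (upLie hI h W) := h.funStable_up

theorem tmul_mem_upLie {m : Fin n → ℤ} {w : U.carrier} :
    e (torusExp m ⊗ₜ w) ∈ upLie hI h W ↔ w ∈ W := h.tmul_mem_up

theorem eq_zero_of_tmul_eq_zero {m : Fin n → ℤ} {w : U.carrier} (hw : e (torusExp m ⊗ₜ w) = 0) :
    w = 0 := by
  refine torusExp_tmul_injective m (e.injective ?_)
  dsimp only
  rw [hw, TensorProduct.tmul_zero, map_zero]

theorem mem_iff_downLie (hN : J.FunStable N) (w : J.carrier) :
    w ∈ N ↔ ∀ m, comp m (e.symm w) ∈ downLie hI h hN := h.mem_iff_comp_mem hI.vf_zero hN w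

theorem eq_zero_of_comp {w : J.carrier} (hw : ∀ m, comp m (e.symm w) = 0) : w = 0 :=
  e.symm.injective (comp_ext fun m => by rw [hw, map_zero, map_zero])

theorem eq_bot_of_downLie (hN : J.FunStable N) (h' : downLie hI h hN = ⊥) : N = ⊥ := by
  refine (LieSubmodule.eq_bot_iff _).mpr fun w hw => eq_zero_of_comp (e := e) fun m => ?_
  have := (mem_iff_downLie (hI := hI) (h := h) hN w).mp hw m
  rwa [h', LieSubmodule.mem_bot] at this

theorem eq_top_of_downLie (hN : J.FunStable N) (h' : downLie hI h hN = ⊤) : N = ⊤ := by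
  refine eq_top_iff.mpr fun w _ => (mem_iff_downLie (hI := hI) (h := h) hN w).mpr fun m => ?_
  rw [h']
  exact LieSubmodule.mem_top _

theorem eq_bot_of_upLie (h' : upLie hI h W = ⊥) : W = ⊥ := by
  refine (LieSubmodule.eq_bot_iff _).mpr fun w hw => ?_
  have := (tmul_mem_upLie (hI := hI) (h := h) (m := 0)).mpr hw
  rw [h', LieSubmodule.mem_bot] at this
  exact eq_zero_of_tmul_eq_zero this

theorem eq_top_of_upLie (h' : upLie hI h W = ⊤) : W = ⊤ := by
  refine eq_top_iff.mpr fun w _ => (tmul_mem_upLie (hI := hI) (h := h) (m := 0)).mp ?_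
  rw [h']
  exact LieSubmodule.mem_top _

theorem isCompl_upLie (hW : IsCompl W W') : IsCompl (upLie hI h W) (upLie hI h W') := by
  refine IsCompl.of_eq ((LieSubmodule.eq_bot_iff _).mpr fun w hw => ?_)
    (eq_top_iff.mpr fun w _ => ?_)
  · obtain ⟨h1, h2⟩ := (LieSubmodule.mem_inf _ _ _).mp hw
    refine eq_zero_of_comp (e := e) fun m => ?_
    rw [← LieSubmodule.mem_bot (R := ℂ) (L := PolyLie n g), ← hW.inf_eq_bot,
      LieSubmodule.mem_inf]
    exact ⟨h1 m, h2 m⟩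
  · obtain ⟨S, hS⟩ := exists_eq_sum_torusExp_tmul (e.symm w)
    rw [LinearEquiv.symm_apply_eq, map_sum] at hS
    rw [hS]
    refine sum_mem fun m _ => ?_
    have hm : comp m (e.symm w) ∈ W ⊔ W' := by
      rw [hW.sup_eq_top]
      exact LieSubmodule.mem_top _
    obtain ⟨a, ha, b, hb, hab⟩ := (LieSubmodule.mem_sup _ _ _).mp hm
    rw [← hab, TensorProduct.tmul_add, map_add]
    exact (LieSubmodule.mem_sup _ _ _).mpr
      ⟨_, tmul_mem_upLie.mpr ha, _, tmul_mem_upLie.mpr hb, rfl⟩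

theorem isCompl_downLie (hN : J.FunStable N) (hN' : J.FunStable N') (hc : IsCompl N N') :
    IsCompl (downLie hI h hN) (downLie hI h hN') := by
  refine IsCompl.of_eq ((LieSubmodule.eq_bot_iff _).mpr fun w hw => ?_)
    (eq_top_iff.mpr fun w _ => ?_)
  · obtain ⟨h1, h2⟩ := (LieSubmodule.mem_inf _ _ _).mp hw
    have : e (torusExp 0 ⊗ₜ w) ∈ N ⊓ N' := (LieSubmodule.mem_inf _ _ _).mpr ⟨h1, h2⟩
    rw [hc.inf_eq_bot, LieSubmodule.mem_bot] at this
    exact eq_zero_of_tmul_eq_zero this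
  · have : e (torusExp 0 ⊗ₜ w) ∈ N ⊔ N' := by
      rw [hc.sup_eq_top]
      exact LieSubmodule.mem_top _
    obtain ⟨a, ha, b, hb, hab⟩ := (LieSubmodule.mem_sup _ _ _).mp this
    refine (LieSubmodule.mem_sup _ _ _).mpr ⟨_, (mem_iff_downLie hN a).mp ha 0, _,
      (mem_iff_downLie hN' b).mp hb 0, ?_⟩
    rw [← map_add, ← map_add, hab, LinearEquiv.symm_apply_apply, comp_same]

/-- The passages `downLie` and `upLie` preserve complements, and each detects the zero submodule. -/
theorem Realizes.isIndecomposable_iff (h : Realizes J D G e)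
    (hI : IsJet D G lam (LieModule.toEnd ℂ (PolyLie n g) U.carrier)) :
    J.IsIndecomposable ↔ U.IsIndecomposable := by
  refine and_congr (nontrivial_iff_of_equiv e) ⟨fun hJ W W' hW => ?_, fun hU N N' hN hN' hc => ?_⟩
  · exact (hJ (upLie hI h W) (upLie hI h W') funStable_upLie funStable_upLie
      (isCompl_upLie hW)).imp eq_bot_of_upLie eq_bot_of_upLie
  · exact (hU (downLie hI h hN) (downLie hI h hN') (isCompl_downLie hN hN' hc)).imp
      (eq_bot_of_downLie hN) (eq_bot_of_downLie hN')

theorem FDMod.isIrreducible_iff {L : Type u} [LieRing L] [LieAlgebra ℂ L] {U : FDMod.{u, v} L} :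
    U.IsIrreducible ↔ Nontrivial U.carrier ∧ ∀ W : LieSubmodule ℂ L U.carrier, W = ⊥ ∨ W = ⊤ := by
  refine ⟨fun hU => ?_, fun ⟨_, hU⟩ => LieModule.IsIrreducible.mk fun N hN => (hU N).resolve_left hN⟩
  have : LieModule.IsIrreducible ℂ L U.carrier := hU
  exact ⟨LieModule.nontrivial_of_isIrreducible ℂ L _, eq_bot_or_eq_top⟩

theorem Realizes.isIrreducible_iff (h : Realizes J D G e)
    (hI : IsJet D G lam (LieModule.toEnd ℂ (PolyLie n g) U.carrier)) :
    J.IsIrreducible ↔ U.IsIrreducible := by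
  rw [FDMod.isIrreducible_iff]
  refine and_congr (nontrivial_iff_of_equiv e) ⟨fun hJ W => ?_, fun hU N hN => ?_⟩
  · exact (hJ (upLie hI h W) funStable_upLie).imp eq_bot_of_upLie eq_top_of_upLie
  · exact (hU (downLie hI h hN)).imp (eq_bot_of_downLie hN) (eq_top_of_downLie hN)

end Correspondence

/-! ### The pair `(λ, U)` is determined by `J` -/

section Uniqueness

variable {n : ℕ} {g : Type u} [LieRing g] [LieAlgebra ℂ g] {J : JMod.{u, v} n g}
  {U : Type v} [AddCommGroup U] [Module ℂ U] [FiniteDimensional ℂ U]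
  {D : Fin n → (Fin n → ℤ) → Module.End ℂ U} {G : (Fin n → ℤ) → g →ₗ[ℂ] Module.End ℂ U}
  {lam : Fin n → ℂ} {e : (TorusFun n ⊗[ℂ] U) ≃ₗ[TorusFun n] J.carrier}
  {ρ : PolyLie n g →ₗ⁅ℂ⁆ Module.End ℂ U}
  {U' : Type v} [AddCommGroup U'] [Module ℂ U'] [FiniteDimensional ℂ U']
  {D' : Fin n → (Fin n → ℤ) → Module.End ℂ U'} {G' : (Fin n → ℤ) → g →ₗ[ℂ] Module.End ℂ U'}
  {lam' : Fin n → ℂ} {e' : (TorusFun n ⊗[ℂ] U') ≃ₗ[TorusFun n] J.carrier}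
  {ρ' : PolyLie n g →ₗ⁅ℂ⁆ Module.End ℂ U'}

/-- The spaces `U'` and `U` are identified with the same weight space of `J`, through the exponents
`0` and `k`. The identification intertwines the operators up to scalars, hence the `𝔤⁺`-actions. -/
theorem Realizes.unique (h : Realizes J D G e) (hI : IsJet D G lam ρ) (h' : Realizes J D' G' e')
    (hI' : IsJet D' G' lam' ρ') [Nontrivial U'] :
    ∃ k, lam' = lam + intWt k ∧ ∃ φ : U' ≃ₗ[ℂ] U, ∀ y w, φ (ρ' y w) = ρ y (φ w) := by
  have hmem : ∀ w, e' (torusExp 0 ⊗ₜ w) ∈ wt J lam' := fun w => by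
    have := h'.mem_wt hI'.vf_zero 0 w
    rwa [intWt_zero, add_zero] at this
  obtain ⟨k, hk⟩ : ∃ k, lam' = lam + intWt k := by
    obtain ⟨w, hw⟩ := exists_ne (0 : U')
    refine h.exists_of_mem_wt hI.vf_zero (hmem w) fun h0 => hw ?_
    refine torusExp_tmul_injective (0 : Fin n → ℤ) (e'.injective ?_)
    dsimp only
    rw [h0, TensorProduct.tmul_zero, map_zero]
  have h1 : ∀ w, e (torusExp k ⊗ₜ comp k (e.symm (e' (torusExp 0 ⊗ₜ w)))) =
      e' (torusExp 0 ⊗ₜ w) := fun w => h.eq_of_mem_wt hI.vf_zero (hk ▸ hmem w)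
  have h2 : ∀ w, e' (torusExp 0 ⊗ₜ comp 0 (e'.symm (e (torusExp k ⊗ₜ w)))) =
      e (torusExp k ⊗ₜ w) := fun w => h'.eq_of_mem_wt hI'.vf_zero (by
    rw [intWt_zero, add_zero, hk]
    exact h.mem_wt hI.vf_zero k w)
  let φ : U' ≃ₗ[ℂ] U :=
    { toFun := fun w => comp k (e.symm (e' (torusExp 0 ⊗ₜ w)))
      invFun := fun w => comp 0 (e'.symm (e (torusExp k ⊗ₜ w)))
      map_add' := fun w w' => by rw [TensorProduct.tmul_add, map_add, map_add, map_add]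
      map_smul' := fun c w => by
        rw [TensorProduct.tmul_smul, equiv_smul, equiv_symm_smul, map_smul, RingHom.id_apply]
      left_inv := fun w => by
        beta_reduce
        rw [h1, LinearEquiv.symm_apply_apply, comp_same]
      right_inv := fun w => by
        beta_reduce
        rw [h2, LinearEquiv.symm_apply_apply, comp_same] }
  have hφ : ∀ w, e (torusExp k ⊗ₜ φ w) = e' (torusExp 0 ⊗ₜ w) := h1
  have inj : ∀ (m : Fin n → ℤ), Function.Injective fun w : U => e (torusExp m ⊗ₜ[ℂ] w) := fun m =>
    e.injective.comp (torusExp_tmul_injective m)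
  -- The scalars are `k_j`: along exponent `k` the field `d_j(s)` contributes `k_j` besides `D j s`.
  refine ⟨k, hk, φ, hI'.intertwine hI φ.toLinearMap (intWt k) (fun j s w => inj (k + s) ?_)
    fun s x w => inj (k + s) ?_⟩
  · change e (torusExp (k + s) ⊗ₜ φ _) = e (torusExp (k + s) ⊗ₜ ((k j : ℂ) • φ w + D j s (φ w)))
    rw [← h.vf_lie, hφ, h'.vf_lie, equiv_torusExp_add_tmul, equiv_torusExp_add_tmul, hφ,
      Pi.zero_apply, Int.cast_zero, zero_smul, zero_add]
  · change e (torusExp (k + s) ⊗ₜ φ _) = e (torusExp (k + s) ⊗ₜ G s x (φ w))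
    rw [← h.loop_lie, hφ, h'.loop_lie, equiv_torusExp_add_tmul, equiv_torusExp_add_tmul, hφ]

end Uniqueness

/-! ### Changing the representative of `λ` -/

section Shift

variable {n : ℕ} {g : Type u} [LieRing g] [LieAlgebra ℂ g] {U : Type v} [AddCommGroup U] [Module ℂ U]
  {D : Fin n → (Fin n → ℤ) → Module.End ℂ U} {G : (Fin n → ℤ) → g →ₗ[ℂ] Module.End ℂ U}
  {lam : Fin n → ℂ} {ρ : PolyLie n g →ₗ⁅ℂ⁆ Module.End ℂ U}

theorem IsJet.shift (hI : IsJet D G lam ρ) (k : Fin n → ℤ) :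
    IsJet (fun j s => D j s + (k j : ℂ) • 1) G (lam + intWt k) ρ where
  vf_eq j s := by
    rw [hI.vf_eq, Pi.add_apply, add_smul, add_right_comm]
    rfl
  loop_eq := hI.loop_eq

end Shift

/-! ### Splitting a module by cosets of weights -/

section Decomposition

variable {n : ℕ} {g : Type u} [LieRing g] [LieAlgebra ℂ g] {J : JMod.{u, v} n g}

theorem iSupIndep_wt : iSupIndep (wt J) :=
  (Module.End.independent_iInf_maxGenEigenspace_of_forall_mapsTo (dOp J) fun i j φ =>
    Module.End.mapsTo_maxGenEigenspace_of_comm (commute_dOp j i) φ).mono fun _ =>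
    iInf_mono fun _ => (Module.End.genEigenspace _ _).monotone le_top

/-- The sum of the weight spaces for a set of weights that is stable under `ℤⁿ`. -/
def wtSub {S : Set (Fin n → ℂ)} (hS : ∀ μ ∈ S, ∀ m, μ + intWt m ∈ S) :
    LieSubmodule ℂ (TorusLie n g) J.carrier where
  __ := wtSum J S
  lie_mem := by
    intro y w hw
    have hw' : w ∈ ⨆ t : S, wt J t.1 := hw
    change ⁅y, w⁆ ∈ wtSum J S
    induction hw' using Submodule.iSup_induction' with
    | zero => rw [lie_zero]; exact Submodule.zero_mem _
    | add a b _ _ ha hb =>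
      rw [lie_add]
      exact Submodule.add_mem _ (ha ‹_›) (hb ‹_›)
    | mem t w hw' =>
      induction y using torusLie_induction with
      | hadd x y hx hy => rw [add_lie]; exact Submodule.add_mem _ hx hy
      | hsmul c x hx => rw [smul_lie]; exact Submodule.smul_mem _ c hx
      | hvf j s => exact wt_le_wtSum (hS _ t.2 s) (vf_lie_mem_wt hw' j s)
      | hloop s x => exact wt_le_wtSum (hS _ t.2 s) (loop_lie_mem_wt hw' x s)

theorem funStable_wtSub {S : Set (Fin n → ℂ)} (hS : ∀ μ ∈ S, ∀ m, μ + intWt m ∈ S) :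
    J.FunStable (wtSub hS) := by
  intro f w hw
  have hw' : w ∈ ⨆ t : S, wt J t.1 := hw
  change f • w ∈ wtSum J S
  clear hw
  induction hw' using Submodule.iSup_induction' with
  | zero => rw [smul_zero]; exact Submodule.zero_mem _
  | add a b _ _ ha hb =>
    rw [smul_add]
    exact Submodule.add_mem _ ha hb
  | mem t w hw' =>
    induction f using torusFun_induction with
    | h0 => rw [zero_smul]; exact Submodule.zero_mem _
    | hadd x y hx hy => rw [add_smul]; exact Submodule.add_mem _ hx hy
    | hexp c s =>
      rw [smul_assoc]
      exact Submodule.smul_mem _ c (wt_le_wtSum (hS _ t.2 s) (torusExp_smul_mem_wt hw' s))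

theorem isCompl_wtSub {S : Set (Fin n → ℂ)} (hS : ∀ μ ∈ S, ∀ m, μ + intWt m ∈ S)
    (hS' : ∀ μ ∈ Sᶜ, ∀ m, μ + intWt m ∈ Sᶜ) :
    IsCompl (wtSub (J := J) hS) (wtSub hS') := by
  have h1 : ∀ S, wtSum J S = ⨆ μ ∈ S, wt J μ := fun S => iSup_subtype'' _ _
  refine IsCompl.of_eq ((LieSubmodule.eq_bot_iff _).mpr fun w hw => ?_)
    (eq_top_iff.mpr fun w _ => ?_)
  · obtain ⟨ha, hb⟩ := (LieSubmodule.mem_inf _ _ _).mp hw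
    have ha' : w ∈ wtSum J S := ha
    have hb' : w ∈ wtSum J Sᶜ := hb
    rw [h1] at ha' hb'
    exact Submodule.disjoint_def.mp (iSupIndep_wt.disjoint_biSup_biSup disjoint_compl_right) w ha'
      hb'
  · have : w ∈ wtSum J S ⊔ wtSum J Sᶜ := by
      rw [h1, h1, ← iSup_union, Set.union_compl_self, iSup_univ, iSup_wt]
      exact Submodule.mem_top
    obtain ⟨a, ha, b, hb, hab⟩ := Submodule.mem_sup.mp this
    exact (LieSubmodule.mem_sup _ _ _).mpr ⟨a, ha, b, hb, hab⟩

/-- The weights in the coset of a weight `lam` and the remaining weights span complementary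
submodules. The first is nonzero, so the second vanishes. -/
theorem JMod.IsIndecomposable.exists_isTransversal (hJ : J.IsIndecomposable) :
    ∃ lam, IsTransversal J {lam} := by
  obtain ⟨hnt, hJ⟩ := hJ
  obtain ⟨lam, hlam⟩ : ∃ lam, wt J lam ≠ ⊥ := by
    by_contra! h
    have := iSup_wt (J := J)
    simp only [h, iSup_bot] at this
    exact bot_ne_top this
  let S : Set (Fin n → ℂ) := {μ | ∃ m, μ = lam + intWt m}
  have hS : ∀ μ ∈ S, ∀ m, μ + intWt m ∈ S := by
    rintro _ ⟨m, rfl⟩ m'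
    exact ⟨m + m', by rw [intWt_add, add_assoc]⟩
  have hS' : ∀ μ ∈ Sᶜ, ∀ m, μ + intWt m ∈ Sᶜ := by
    intro μ hμ m h
    refine hμ ?_
    have := hS _ h (-m)
    rwa [intWt_neg, add_neg_cancel_right] at this
  have hlamS : lam ∈ S := ⟨0, by rw [intWt_zero, add_zero]⟩
  refine ⟨lam, ⟨?_, fun μ hμ => ⟨lam, rfl, ?_⟩⟩⟩
  · rintro ⟨t, m⟩ ⟨t', m'⟩ h
    obtain rfl : t = t' := Subsingleton.elim _ _
    exact congrArg _ (intWt_injective (add_left_cancel h))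
  · by_contra hμS
    rcases hJ _ _ (funStable_wtSub hS) (funStable_wtSub hS') (isCompl_wtSub hS hS') with h | h
    · refine hlam (eq_bot_iff.mpr fun w hw => ?_)
      have : w ∈ wtSub (J := J) hS := wt_le_wtSum hlamS hw
      rwa [h] at this
    · refine hμ (eq_bot_iff.mpr fun w hw => ?_)
      have : w ∈ wtSub (J := J) hS' := wt_le_wtSum (T := Sᶜ) hμS hw
      rwa [h] at this

end Decomposition

/-- The module given by a homomorphism to a Lie algebra of endomorphisms. -/
def FDMod.ofHom {L : Type u} [LieRing L] [LieAlgebra ℂ L] {U : Type v} [AddCommGroup U] [Module ℂ U]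
    [FiniteDimensional ℂ U] (ρ : L →ₗ⁅ℂ⁆ Module.End ℂ U) : FDMod.{u, v} L :=
  letI : LieRingModule L U := LieRingModule.compLieHom U ρ
  letI : LieModule ℂ L U := LieModule.compLieHom U ρ
  { carrier := U }

/-! ### The relation between `J` and `(λ, U)` -/

section JetClassification

variable {n : ℕ} {g : Type u} [LieRing g] [LieAlgebra ℂ g]

/-- With a one-point transversal `U` is a single weight space, so the operator at `s = 0` is the
scalar `lam j`. -/
theorem JMod.IsIndecomposable.exists_jetRealizes {J : JMod.{u, v} n g} (hJ : J.IsIndecomposable) :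
    ∃ lam U, JetRealizes J lam U := by
  obtain ⟨lam, hT⟩ := hJ.exists_isTransversal
  have := finiteDimensional_of_equiv hT.equiv
  obtain ⟨N, ρ, -, -, hD, hG⟩ := hT.realizes.jetRel.exists_polyHom
  have hI : IsJet (vfOp J {lam}) (loopOp J {lam}) lam ρ := by
    refine ⟨fun j s => ?_, hG⟩
    rw [hD j s]
    congr 1
    exact LinearMap.ext (vfOp_singleton_zero lam j)
  exact ⟨lam, FDMod.ofHom ρ, (jetRealizes_iff (U := FDMod.ofHom ρ) hI).mpr ⟨_, hT.realizes⟩⟩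

theorem exists_jetRealizes (lam : Fin n → ℂ) (U : FDMod.{u, v} (PolyLie n g)) :
    ∃ J, JetRealizes J lam U := by
  obtain ⟨D, G, hR, hI⟩ := exists_isJet lam (LieModule.toEnd ℂ (PolyLie n g) U.carrier)
  exact ⟨_, (jetRealizes_iff hI).mpr ⟨_, realizes_jetMod hR lam hI.vf_zero⟩⟩

variable {J J' : JMod.{u, v} n g} {lam lam' : Fin n → ℂ} {U U' : FDMod.{u, v} (PolyLie n g)}

theorem JetRealizes.exists_realizes (h : JetRealizes J lam U) : ∃ D G e,
    IsJet D G lam (LieModule.toEnd ℂ (PolyLie n g) U.carrier) ∧ Realizes J D G e := by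
  obtain ⟨D, G, -, hI⟩ := exists_isJet lam (LieModule.toEnd ℂ (PolyLie n g) U.carrier)
  obtain ⟨e, he⟩ := (jetRealizes_iff hI).mp h
  exact ⟨D, G, e, hI, he⟩

theorem JetRealizes.isIndecomposable_iff (h : JetRealizes J lam U) :
    J.IsIndecomposable ↔ U.IsIndecomposable := by
  obtain ⟨D, G, e, hI, he⟩ := h.exists_realizes
  exact he.isIndecomposable_iff hI

theorem JetRealizes.isIrreducible_iff (h : JetRealizes J lam U) :
    J.IsIrreducible ↔ U.IsIrreducible := by
  obtain ⟨D, G, e, hI, he⟩ := h.exists_realizes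
  exact he.isIrreducible_iff hI

theorem JetRealizes.congr_iso (h : JetRealizes J lam U) (hJ : J ≈ J') : JetRealizes J' lam U := by
  obtain ⟨D, G, e, hI, he⟩ := h.exists_realizes
  exact (jetRealizes_iff hI).mpr (he.congr_iso hJ)

theorem JetRealizes.congr_equiv (h : JetRealizes J lam U) (hU : U ≈ U') : JetRealizes J lam U' := by
  obtain ⟨D, G, e, hI, he⟩ := h.exists_realizes
  obtain ⟨D', G', -, hI'⟩ := exists_isJet lam (LieModule.toEnd ℂ (PolyLie n g) U'.carrier)
  obtain ⟨φ⟩ := Setoid.symm hU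
  obtain ⟨hD, hG⟩ := hI'.map_equiv hI φ.toLinearEquiv fun y w => φ.map_lie'
  exact (jetRealizes_iff hI').mpr (he.congr_equiv φ.toLinearEquiv hD hG)

theorem JetRealizes.shift (h : JetRealizes J lam U)
    (hl : (QuotientAddGroup.mk lam : (Fin n → ℂ) ⧸ intLattice n) = QuotientAddGroup.mk lam') :
    JetRealizes J lam' U := by
  obtain ⟨k, hk⟩ := mem_intLattice.mp (QuotientAddGroup.eq.mp hl)
  obtain rfl : lam' = lam + intWt k := by rw [hk, add_neg_cancel_left]
  obtain ⟨D, G, e, hI, he⟩ := h.exists_realizes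
  exact (jetRealizes_iff (hI.shift k)).mpr (he.shift k)

theorem JetRealizes.unique (h : JetRealizes J lam U) (h' : JetRealizes J lam' U')
    (hJ : Nontrivial J.carrier) :
    (QuotientAddGroup.mk lam : (Fin n → ℂ) ⧸ intLattice n) = QuotientAddGroup.mk lam' ∧ U ≈ U' := by
  obtain ⟨D, G, e, hI, he⟩ := h.exists_realizes
  obtain ⟨D', G', e', hI', he'⟩ := h'.exists_realizes
  have := (nontrivial_iff_of_equiv e').mp hJ
  obtain ⟨k, rfl, φ, hφ⟩ := he.unique hI he' hI'
  refine ⟨QuotientAddGroup.eq.mpr (mem_intLattice.mpr ⟨k, by rw [neg_add_cancel_left]⟩),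
    Setoid.symm ⟨{ φ with map_lie' := fun {y w} => hφ y w }⟩⟩

theorem JetRealizes.iso (h : JetRealizes J lam U) (h' : JetRealizes J' lam U) : J ≈ J' := by
  obtain ⟨D, G, e, hI, he⟩ := h.exists_realizes
  obtain ⟨e', he'⟩ := (jetRealizes_iff hI).mp h'
  exact he.iso he'

end JetClassification

/-! ### Irreducible modules -/

section Pullback

variable {L L' : Type u} [LieRing L] [LieAlgebra ℂ L] [LieRing L'] [LieAlgebra ℂ L']

/-- The restriction of a module along a homomorphism. -/
def FDMod.pull (f : L →ₗ⁅ℂ⁆ L') (V : FDMod.{u, v} L') : FDMod.{u, v} L :=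
  letI : LieRingModule L V.carrier := LieRingModule.compLieHom V.carrier f
  letI : LieModule ℂ L V.carrier := LieModule.compLieHom V.carrier f
  { carrier := V.carrier }

variable {f : L →ₗ⁅ℂ⁆ L'} {V V' : FDMod.{u, v} L'}

/-- Under a surjection the two algebras have the same stable subspaces. -/
theorem FDMod.isIrreducible_pull_iff (hf : Function.Surjective f) :
    (V.pull f).IsIrreducible ↔ V.IsIrreducible := by
  rw [FDMod.isIrreducible_iff, FDMod.isIrreducible_iff]
  refine and_congr Iff.rfl ⟨fun h W => ?_, fun h W => ?_⟩
  · have hW : ∀ (x : L) (w : V.carrier), w ∈ W → ⁅f x, w⁆ ∈ W := fun _ _ hw => W.lie_mem hw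
    let W' : LieSubmodule ℂ L (V.pull f).carrier :=
      { carrier := (W : Set V.carrier)
        add_mem' := fun ha hb => W.add_mem ha hb
        zero_mem' := W.zero_mem
        smul_mem' := fun c _ hw => W.smul_mem c hw
        lie_mem := fun {x w} hw => hW x w hw }
    refine (h W').imp (fun h' => ?_) fun h' => ?_
    · refine (LieSubmodule.eq_bot_iff _).mpr fun w hw => ?_
      exact (LieSubmodule.eq_bot_iff _).mp h' w hw
    · have hw : ∀ w : (V.pull f).carrier, w ∈ W' := fun w => by
        rw [h']
        exact LieSubmodule.mem_top w
      exact eq_top_iff.mpr fun w _ => hw w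
  · have hW : ∀ (x : L) (w : (V.pull f).carrier), w ∈ W → ⁅x, w⁆ ∈ W := fun _ _ hw => W.lie_mem hw
    let W' : LieSubmodule ℂ L' V.carrier :=
      { carrier := (W : Set (V.pull f).carrier)
        add_mem' := fun ha hb => W.add_mem ha hb
        zero_mem' := W.zero_mem
        smul_mem' := fun c _ hw => W.smul_mem c hw
        lie_mem := fun {x w} hw => by
          obtain ⟨y, rfl⟩ := hf x
          exact hW y w hw }
    refine (h W').imp (fun h' => ?_) fun h' => ?_
    · refine (LieSubmodule.eq_bot_iff _).mpr fun w hw => ?_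
      exact (LieSubmodule.eq_bot_iff _).mp h' w hw
    · have hw : ∀ w : V.carrier, w ∈ W' := fun w => by
        rw [h']
        exact LieSubmodule.mem_top w
      exact eq_top_iff.mpr fun w _ => hw w

theorem FDMod.pull_equiv_iff (hf : Function.Surjective f) : V.pull f ≈ V'.pull f ↔ V ≈ V' := by
  refine ⟨fun ⟨φ⟩ => ⟨{ φ.toLinearEquiv with map_lie' := ?_ }⟩,
    fun ⟨φ⟩ => ⟨{ φ.toLinearEquiv with map_lie' := ?_ }⟩⟩
  · intro x w
    obtain ⟨y, rfl⟩ := hf x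
    exact φ.map_lie y w
  · intro x w
    exact φ.map_lie (f x) w

end Pullback

/-! ### Linear parts: the quotient `gl_n ⊕ g` of `𝔤⁺` -/

section LinearPart

variable {n : ℕ} {g : Type u} [LieRing g] [LieAlgebra ℂ g]

open MvPolynomial

theorem coeff_single_mul {q : MvPolynomial (Fin n) ℂ} (hq : constantCoeff q = 0) (p : Fin n)
    (r : MvPolynomial (Fin n) ℂ) : coeff (Finsupp.single p 1) (q * r) =
      coeff (Finsupp.single p 1) q * constantCoeff r := by
  classical
  have h0 : coeff 0 q = 0 := hq
  rw [coeff_mul, Finsupp.antidiagonal_single, Finset.sum_map]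
  simp [Finset.Nat.antidiagonal_succ, h0, constantCoeff_eq]

theorem constantCoeff_pderiv (i : Fin n) (q : MvPolynomial (Fin n) ℂ) :
    constantCoeff (pderiv i q) = coeff (Finsupp.single i 1) q := by
  classical
  induction q using MvPolynomial.induction_on' with
  | add p q hp hq => rw [map_add, map_add, coeff_add, hp, hq]
  | monomial β c =>
    rw [pderiv_monomial, constantCoeff_monomial, coeff_monomial]
    by_cases h : β = Finsupp.single i 1
    · subst h
      simp
    · rw [if_neg h]
      split_ifs with h'
      · by_cases hi : β i = 0
        · rw [hi, Nat.cast_zero, mul_zero]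
        · exact absurd (le_antisymm (tsub_eq_zero_iff_le.mp h')
            (Finsupp.single_le_iff.mpr (Nat.one_le_iff_ne_zero.mpr hi))) h
      · rfl

/-- The matrix of the linear part of a vector field. -/
def linPart : WPlus n →ₗ[ℂ] Matrix (Fin n) (Fin n) ℂ where
  toFun X := Matrix.of fun p j => coeff (Finsupp.single p 1) (X.1 (MvPolynomial.X j))
  map_add' X Y := by
    ext p j
    exact coeff_add _ (X.1 (MvPolynomial.X j)) (Y.1 (MvPolynomial.X j))
  map_smul' c X := by
    ext p j
    exact coeff_smul _ c (X.1 (MvPolynomial.X j))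

theorem linPart_apply (X : WPlus n) (p j : Fin n) :
    linPart X p j = coeff (Finsupp.single p 1) (X.1 (MvPolynomial.X j)) := rfl

/-- A field vanishing at the origin acts on linear parts through its own linear part. -/
theorem coeff_single_derivation (X : WPlus n) (p : Fin n) (q : MvPolynomial (Fin n) ℂ) :
    coeff (Finsupp.single p 1) (X.1 q) =
      ∑ i, linPart X p i * coeff (Finsupp.single i 1) q := by
  rw [derivation_apply_eq_sum, coeff_sum]
  refine Finset.sum_congr rfl fun i _ => ?_
  rw [coeff_single_mul (WPlus.constantCoeff_apply_X X i), constantCoeff_pderiv, linPart_apply]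

/-- By `coeff_single_derivation`, the linear part of `X (Y z_j)` is the `j`-th column of the product
of the matrices. -/
theorem linPart_lie (X Y : WPlus n) : linPart ⁅X, Y⁆ = ⁅linPart X, linPart Y⁆ := by
  ext p j
  rw [LieRing.of_associative_ring_bracket, Matrix.sub_apply, Matrix.mul_apply, Matrix.mul_apply]
  simp only [linPart_apply Y _ j, linPart_apply X _ j]
  rw [← coeff_single_derivation, ← coeff_single_derivation, ← coeff_sub, linPart_apply]
  rfl

theorem linPart_zdW (β : {β : Fin n →₀ ℕ // β ≠ 0}) (p j k : Fin n) :
    linPart (zdW β j) p k = if β.1 = Finsupp.single p 1 ∧ j = k then 1 else 0 := by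
  classical
  rw [linPart_apply]
  change coeff (Finsupp.single p 1)
    (monomial β.1 (1 : ℂ) • pderiv j (MvPolynomial.X k : MvPolynomial (Fin n) ℂ)) = _
  rw [smul_eq_mul]
  rw [pderiv_X]
  by_cases hk : j = k
  · subst hk
    rw [Pi.single_eq_same, mul_one, coeff_monomial]
    simp
  · rw [Pi.single_eq_of_ne (Ne.symm hk), mul_zero, coeff_zero, if_neg fun h => hk h.2]

/-- The value at the origin of a polynomial map to `g`. -/
def evalZero : MvPolynomial (Fin n) ℂ ⊗[ℂ] g →ₗ[ℂ] g :=
  TensorProduct.lift (LinearMap.lsmul ℂ g ∘ₗ (aeval (0 : Fin n → ℂ)).toLinearMap)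

theorem evalZero_tmul (q : MvPolynomial (Fin n) ℂ) (x : g) :
    evalZero (q ⊗ₜ x) = constantCoeff q • x := by
  change aeval (0 : Fin n → ℂ) q • x = _
  rw [aeval_zero]
  rfl

/-- The linear part of an element of `𝔤⁺`. -/
def linHom (n : ℕ) (g : Type u) [LieRing g] [LieAlgebra ℂ g] :
    PolyLie n g →ₗ⁅ℂ⁆ Matrix (Fin n) (Fin n) ℂ × g :=
  semiDirectLift _
    { LinearMap.inr ℂ (Matrix (Fin n) (Fin n) ℂ) g ∘ₗ evalZero with
      map_lie' := by
        intro a b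
        refine Prod.ext ?_ ?_
        · change (0 : Matrix (Fin n) (Fin n) ℂ) = ⁅(0 : Matrix (Fin n) (Fin n) ℂ), 0⁆
          rw [lie_zero]
        · change evalZero ⁅a, b⁆ = ⁅evalZero a, evalZero b⁆
          induction a using TensorProduct.induction_on with
          | zero => simp
          | add a₁ a₂ h₁ h₂ => simp only [add_lie, map_add, h₁, h₂]
          | tmul p x =>
            induction b using TensorProduct.induction_on with
            | zero => simp
            | add a₁ a₂ h₁ h₂ => simp only [lie_add, map_add, h₁, h₂]
            | tmul q y =>
              rw [LieAlgebra.ExtendScalars.bracket_tmul, evalZero_tmul, evalZero_tmul,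
                evalZero_tmul, smul_lie, lie_smul, smul_smul, map_mul] }
    { LinearMap.inl ℂ (Matrix (Fin n) (Fin n) ℂ) g ∘ₗ linPart with
      map_lie' := by
        intro X Y
        refine Prod.ext (linPart_lie X Y) ?_
        change (0 : g) = ⁅(0 : g), 0⁆
        rw [lie_zero] }
    (by
      intro X b
      refine Prod.ext ?_ ?_
      · change ⁅linPart X, (0 : Matrix (Fin n) (Fin n) ℂ)⁆ = 0
        rw [lie_zero]
      · change ⁅(0 : g), evalZero b⁆ = evalZero (derAct _ g X.1 b)
        rw [zero_lie]
        induction b using TensorProduct.induction_on with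
        | zero => simp
        | add a₁ a₂ h₁ h₂ => rw [map_add, map_add, ← h₁, ← h₂, add_zero]
        | tmul q y =>
          rw [derAct_tmul, evalZero_tmul, derivation_apply_eq_sum, map_sum,
            Finset.sum_eq_zero, zero_smul]
          intro i _
          rw [map_mul, WPlus.constantCoeff_apply_X, zero_mul])

theorem linHom_zdPlus (β : {β : Fin n →₀ ℕ // β ≠ 0}) (j : Fin n) :
    linHom n g (zdPlus β j) = (linPart (zdW β j), 0) := by
  refine (semiDirectLift_inr _ _ _ _ _).trans ?_
  rfl

theorem linHom_zPlus (β : Fin n →₀ ℕ) (x : g) :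
    linHom n g (zPlus β x) = (0, if β = 0 then x else 0) := by
  refine (semiDirectLift_inl _ _ _ _ _).trans ?_
  change ((0 : Matrix (Fin n) (Fin n) ℂ), evalZero (monomial β (1 : ℂ) ⊗ₜ[ℂ] x)) = _
  rw [evalZero_tmul, constantCoeff_monomial, ite_smul, one_smul, zero_smul]

/-- The element `e_p` of `ℕⁿ`. -/
def unitVec (p : Fin n) : {β : Fin n →₀ ℕ // β ≠ 0} := ⟨Finsupp.single p 1, by simp⟩

theorem linHom_unitVec (p j : Fin n) :
    linHom n g (zdPlus (unitVec p) j) = (Matrix.single p j 1, 0) := by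
  rw [linHom_zdPlus]
  congr 1
  ext q k
  rw [linPart_zdW, Matrix.single_apply]
  congr 1
  rw [unitVec, Finsupp.single_left_inj one_ne_zero]

theorem linHom_zdPlus_eq_zero {β : {β : Fin n →₀ ℕ // β ≠ 0}} (hβ : ∀ p, β ≠ unitVec p)
    (j : Fin n) : linHom n g (zdPlus β j) = 0 := by
  rw [linHom_zdPlus]
  refine Prod.ext ?_ rfl
  ext p k
  change linPart (zdW β j) p k = 0
  rw [linPart_zdW, if_neg fun h => hβ p (Subtype.ext h.1)]

/-- A linear right inverse of `linHom`. -/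
def linSection (n : ℕ) (g : Type u) [LieRing g] [LieAlgebra ℂ g] :
    Matrix (Fin n) (Fin n) ℂ × g →ₗ[ℂ] PolyLie n g where
  toFun a := ∑ p, ∑ j, a.1 p j • zdPlus (unitVec p) j + zPlus 0 a.2
  map_add' a b := by
    have : (zPlus 0 (a.2 + b.2) : PolyLie n g) = zPlus 0 a.2 + zPlus 0 b.2 := by
      rw [zPlus, TensorProduct.tmul_add, map_add]; rfl
    simp only [Prod.fst_add, Prod.snd_add, Matrix.add_apply, add_smul, Finset.sum_add_distrib, this]
    abel
  map_smul' c a := by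
    have : (zPlus 0 (c • a.2) : PolyLie n g) = c • zPlus 0 a.2 := by
      rw [zPlus, TensorProduct.tmul_smul, map_smul]; rfl
    simp only [Prod.smul_fst, Prod.smul_snd, Matrix.smul_apply, smul_assoc, ← Finset.smul_sum, this,
      ← smul_add, RingHom.id_apply]

theorem linSection_apply (a : Matrix (Fin n) (Fin n) ℂ × g) :
    linSection n g a = ∑ p, ∑ j, a.1 p j • zdPlus (unitVec p) j + zPlus 0 a.2 := rfl

theorem zPlus_zero (β : Fin n →₀ ℕ) : (zPlus β (0 : g) : PolyLie n g) = 0 := by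
  rw [zPlus, TensorProduct.tmul_zero, map_zero]

theorem linSection_single (p j : Fin n) :
    linSection n g (Matrix.single p j 1, 0) = zdPlus (unitVec p) j := by
  have h : ∀ q k, ((Matrix.single p j 1, 0) : Matrix (Fin n) (Fin n) ℂ × g).1 q k =
      if p = q ∧ j = k then 1 else 0 := fun q k => Matrix.single_apply _ _ _ _ _
  rw [linSection_apply, zPlus_zero, add_zero, Finset.sum_eq_single p, Finset.sum_eq_single j]
  · rw [h, if_pos ⟨rfl, rfl⟩, one_smul]
  · intro k _ hk
    rw [h, if_neg fun h => hk h.2.symm, zero_smul]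
  · simp
  · intro q _ hq
    refine Finset.sum_eq_zero fun k _ => ?_
    rw [h, if_neg fun h => hq h.1.symm, zero_smul]
  · simp

theorem linSection_zero_left (x : g) : linSection n g (0, x) = zPlus 0 x := by
  rw [linSection_apply, Finset.sum_eq_zero, zero_add]
  exact fun p _ => Finset.sum_eq_zero fun j _ => zero_smul ℂ _

theorem linHom_linSection (a : Matrix (Fin n) (Fin n) ℂ × g) :
    linHom n g (linSection n g a) = a := by
  rw [linSection_apply, map_add, map_sum, linHom_zPlus, if_pos rfl]
  have : ∀ p, linHom n g (∑ j, a.1 p j • zdPlus (unitVec p) j) =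
      (∑ j, Matrix.single p j (a.1 p j), 0) := by
    intro p
    rw [map_sum]
    simp only [map_smul, linHom_unitVec]
    rw [Prod.ext_iff, Prod.fst_sum, Prod.snd_sum]
    simp [Matrix.smul_single]
  simp only [this]
  refine Prod.ext ?_ ?_
  · rw [Prod.fst_add, Prod.fst_sum, add_zero]
    exact (Matrix.matrix_eq_sum_single a.1).symm
  · rw [Prod.snd_add, Prod.snd_sum, Finset.sum_const_zero, zero_add]

theorem linHom_surjective : Function.Surjective (linHom n g) := fun a => ⟨_, linHom_linSection a⟩

variable {U : Type v} [AddCommGroup U] [Module ℂ U] (ρ : PolyLie n g →ₗ⁅ℂ⁆ Module.End ℂ U)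

/-- The section keeps the generators of Euler degree `0` and drops the others, which kill `w` by
assumption. -/
theorem apply_linSection_linHom {w : U} (hW : ∀ β j, (∀ p, β ≠ unitVec p) → ρ (zdPlus β j) w = 0)
    (hL : ∀ β x, β ≠ 0 → ρ (zPlus β x) w = 0) (y : PolyLie n g) :
    ρ (linSection n g (linHom n g y)) w = ρ y w := by
  induction y using polyLie_induction with
  | hadd x y hx hy => simp only [map_add, LinearMap.add_apply, hx, hy]
  | hsmul c x hx => simp only [map_smul, LinearMap.smul_apply, hx]
  | hzd β j =>
    by_cases hβ : ∀ p, β ≠ unitVec p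
    · rw [linHom_zdPlus_eq_zero hβ, map_zero, map_zero, hW β j hβ]
      rfl
    · push Not at hβ
      obtain ⟨p, rfl⟩ := hβ
      rw [linHom_unitVec, linSection_single]
  | hz β x =>
    by_cases hβ : β = 0
    · subst hβ
      rw [linHom_zPlus, if_pos rfl, linSection_zero_left]
    · rw [linHom_zPlus, if_neg hβ, ← Prod.zero_eq_mk, map_zero, map_zero, hL β x hβ]
      rfl

/-- An element of positive Euler degree `k` sends an eigenvector for `α` to one for `α + k`. If `α`
has maximal real part, the image is zero. -/
theorem exists_ne_zero_of_kernel [FiniteDimensional ℂ U] [Nontrivial U] :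
    ∃ w : U, w ≠ 0 ∧ ∀ y, linHom n g y = 0 → ρ y w = 0 := by
  let T : Module.End ℂ U := ρ (euler n g)
  have hfin : {μ : ℂ | T.HasEigenvalue μ}.Finite := Module.End.finite_hasEigenvalue T
  obtain ⟨α, hα, hmax⟩ := hfin.exists_maximalFor Complex.re _ (Module.End.exists_eigenvalue T)
  obtain ⟨w, hw, hw0⟩ := Module.End.HasEigenvalue.exists_hasEigenvector hα
  rw [Module.End.mem_eigenspace_iff] at hw
  have key : ∀ (y : PolyLie n g) (k : ℕ), 0 < k → ⁅euler n g, y⁆ = (k : ℂ) • y → ρ y w = 0 := by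
    intro y k hk hy
    by_contra hne
    have h1 : T (ρ y w) = (α + k) • ρ y w := by
      have := LinearMap.congr_fun (ρ.map_lie (euler n g) y) w
      rw [hy, map_smul, LieRing.of_associative_ring_bracket, LinearMap.sub_apply,
        Module.End.mul_apply, Module.End.mul_apply, LinearMap.smul_apply] at this
      change (k : ℂ) • ρ y w = T (ρ y w) - ρ y (T w) at this
      rw [hw, map_smul] at this
      rw [add_smul, this, add_sub_cancel]
    have h2 : T.HasEigenvalue (α + k) := Module.End.hasEigenvalue_of_hasEigenvector
      ⟨Module.End.mem_eigenspace_iff.mpr h1, hne⟩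
    have h3 := hmax h2 (by simp)
    simp at h3
    omega
  -- By the section formula it suffices that the generators of positive degree kill `w`: `|β| ≥ 2`
  -- for vector fields and `|β| ≥ 1` for loops.
  refine ⟨w, hw0, fun y hy => ?_⟩
  rw [← apply_linSection_linHom ρ (w := w) (fun β j hβ => ?_) (fun β x hβ => ?_) y, hy, map_zero,
    map_zero]
  · rfl
  · have h1 : β.1.degree ≠ 0 := fun h => β.2 (Finsupp.degree_eq_zero_iff _ |>.mp h)
    have h2 : β.1.degree ≠ 1 := fun h => by
      obtain ⟨p, hp⟩ : β.1 ∈ Set.range fun p : Fin n => Finsupp.single p 1 := by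
        rw [Finsupp.range_single_one]
        exact h
      exact hβ p (Subtype.ext hp.symm)
    refine key _ (β.1.degree - 1) (by omega) ?_
    rw [lie_euler_zdPlus, Nat.cast_sub (by omega), Nat.cast_one]
  · exact key _ β.degree (Nat.pos_of_ne_zero fun h => hβ (Finsupp.degree_eq_zero_iff _ |>.mp h))
      (lie_euler_zPlus β x)

/-- An irreducible `𝔤⁺`-module is the restriction of a module over `gl_n ⊕ g`. -/
theorem FDMod.IsIrreducible.exists_pull {U : FDMod.{u, v} (PolyLie n g)} (hU : U.IsIrreducible) :
    ∃ V : FDMod.{u, v} (Matrix (Fin n) (Fin n) ℂ × g), U ≈ V.pull (linHom n g) := by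
  obtain ⟨hnt, hU⟩ := FDMod.isIrreducible_iff.mp hU
  let ρ := LieModule.toEnd ℂ (PolyLie n g) U.carrier
  -- The vectors killed by the kernel of `linHom`; they form a submodule because the kernel is an
  -- ideal.
  let W : LieSubmodule ℂ (PolyLie n g) U.carrier :=
    { carrier := {w | ∀ y, linHom n g y = 0 → ρ y w = 0}
      add_mem' := fun ha hb y hy => by rw [map_add, ha y hy, hb y hy, add_zero]
      zero_mem' := fun y _ => map_zero _
      smul_mem' := fun c w hw y hy => by rw [map_smul, hw y hy, smul_zero]
      lie_mem := by
        intro z w hw y hy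
        change ⁅y, ⁅z, w⁆⁆ = 0
        have h1 : ⁅⁅y, z⁆, w⁆ = 0 := hw _ (by rw [LieHom.map_lie, hy, zero_lie])
        have h2 : ⁅y, w⁆ = 0 := hw y hy
        rw [leibniz_lie, h1, h2, lie_zero, add_zero] }
  have hW : W = ⊤ := by
    refine (hU W).resolve_left fun h => ?_
    obtain ⟨w, hw0, hw⟩ := exists_ne_zero_of_kernel ρ
    exact hw0 ((LieSubmodule.eq_bot_iff _).mp h w hw)
  have hker : ∀ y, linHom n g y = 0 → ρ y = 0 := fun y hy => LinearMap.ext fun w =>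
    (hW ▸ LieSubmodule.mem_top w : w ∈ W) y hy
  have hρ : ∀ y z, linHom n g y = linHom n g z → ρ y = ρ z := fun y z h => by
    rw [← sub_eq_zero, ← map_sub]
    exact hker _ (by rw [map_sub, h, sub_self])
  -- The section is only linear, but its failure to respect brackets lies in the kernel of `linHom`,
  -- on which `ρ` vanishes.
  let τ : Matrix (Fin n) (Fin n) ℂ × g →ₗ⁅ℂ⁆ Module.End ℂ U.carrier :=
    { ρ.toLinearMap ∘ₗ linSection n g with
      map_lie' := by
        intro a b
        change ρ (linSection n g ⁅a, b⁆) = ⁅ρ (linSection n g a), ρ (linSection n g b)⁆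
        rw [← LieHom.map_lie]
        refine hρ _ _ ?_
        rw [LieHom.map_lie, linHom_linSection, linHom_linSection, linHom_linSection] }
  refine ⟨FDMod.ofHom τ, ⟨{ LinearEquiv.refl ℂ U.carrier with map_lie' := ?_ }⟩⟩
  intro y w
  change ρ y w = ρ (linSection n g (linHom n g y)) w
  rw [hρ _ y (linHom_linSection _)]

end LinearPart

/-! ### Modules pulled back from `gl_n ⊕ g` -/

section Tensor

variable {n : ℕ} {g : Type u} [LieRing g] [LieAlgebra ℂ g]

theorem coef_unitVec (s : Fin n → ℤ) (p : Fin n) : coef s (unitVec p).1 = s p := by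
  rw [coef, Finset.prod_eq_single p, Finset.prod_eq_one]
  · simp [unitVec]
  · intro i _
    by_cases h : i = p
    · subst h; simp [unitVec]
    · simp [unitVec, Finsupp.single_eq_of_ne h]
  · intro i _ h
    simp [unitVec, Finsupp.single_eq_of_ne h]
  · simp

theorem unitVec_injective : Function.Injective (unitVec (n := n)) := fun _ _ h =>
  Finsupp.single_left_injective one_ne_zero (congrArg Subtype.val h)

theorem coef_zero_right (s : Fin n → ℤ) : coef s 0 = 1 := by simp [coef]

/-- Only `β = e_p` has a nonzero linear part, and there `s^β / β!` is `s_p`. -/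
theorem finsum_vf_eq {M V : Type*} [AddCommGroup M] [Module ℂ M] [AddCommGroup V] [Module ℂ V]
    (ρ : Matrix (Fin n) (Fin n) ℂ × g →ₗ[ℂ] V) (φ : V →ₗ[ℂ] M) (s : Fin n → ℤ) (j : Fin n) :
    ∑ᶠ β : {β : Fin n →₀ ℕ // β ≠ 0}, coef s β.1 • φ (ρ (linHom n g (zdPlus β j))) =
      ∑ p, (s p : ℂ) • φ (ρ (Matrix.single p j 1, 0)) := by
  rw [finsum_eq_sum_of_support_subset (s := Finset.univ.map ⟨unitVec, unitVec_injective⟩),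
    Finset.sum_map]
  · refine Finset.sum_congr rfl fun p _ => ?_
    rw [Function.Embedding.coeFn_mk, coef_unitVec, linHom_unitVec]
  · intro β hβ
    by_contra h
    refine hβ ?_
    beta_reduce
    rw [linHom_zdPlus_eq_zero, map_zero, map_zero, smul_zero]
    rintro p rfl
    exact h (by simp)

theorem finsum_loop_eq {M V : Type*} [AddCommGroup M] [Module ℂ M] [AddCommGroup V] [Module ℂ V]
    (ρ : Matrix (Fin n) (Fin n) ℂ × g →ₗ[ℂ] V) (φ : V →ₗ[ℂ] M) (s : Fin n → ℤ) (x : g) :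
    ∑ᶠ β : Fin n →₀ ℕ, coef s β • φ (ρ (linHom n g (zPlus β x))) = φ (ρ (0, x)) := by
  rw [finsum_eq_single _ 0, coef_zero_right, one_smul, linHom_zPlus, if_pos rfl]
  intro β hβ
  rw [linHom_zPlus, if_neg hβ, ← Prod.zero_eq_mk, map_zero, map_zero, smul_zero]

/-- On a pulled back module the two jet sums collapse to their terms with `|β| = 1` and `β = 0`, and
the finiteness clauses are automatic. -/
theorem tensorRealizes_iff {J : JMod.{u, v} n g} {lam : Fin n → ℂ}
    {V : FDMod.{u, v} (Matrix (Fin n) (Fin n) ℂ × g)} :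
    TensorRealizes J lam V ↔ JetRealizes J lam (V.pull (linHom n g)) := by
  let ρ : V.carrier → Matrix (Fin n) (Fin n) ℂ × g →ₗ[ℂ] V.carrier := fun w =>
    (LieModule.toEnd ℂ (Matrix (Fin n) (Fin n) ℂ × g) V.carrier).toLinearMap.flip w
  let φ : (Fin n → ℤ) → V.carrier →ₗ[ℂ] TorusFun n ⊗[ℂ] V.carrier := fun m =>
    TensorProduct.mk ℂ (TorusFun n) V.carrier (torusExp m)
  constructor
  · rintro ⟨e, h1, h2⟩
    refine ⟨finite_setOf_zdPlus_ne_zero _, finite_setOf_zPlus_ne_zero _, e, fun j s m w => ?_,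
      fun x s m w => ?_⟩
    · exact (h1 j s m w).trans (congrArg (fun t => e (_ + t))
        (finsum_vf_eq (ρ w) (φ (m + s)) s j).symm)
    · exact (h2 x s m w).trans (congrArg e (finsum_loop_eq (ρ w) (φ (m + s)) s x).symm)
  · rintro ⟨-, -, e, h1, h2⟩
    refine ⟨e, fun j s m w => ?_, fun x s m w => ?_⟩
    · exact (h1 j s m w).trans (congrArg (fun t => e (_ + t))
        (finsum_vf_eq (ρ w) (φ (m + s)) s j))
    · exact (h2 x s m w).trans (congrArg e (finsum_loop_eq (ρ w) (φ (m + s)) s x))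

end Tensor

/-! ### Bijections between isomorphism classes -/

section Classes

variable {X : Type*} [Setoid X] {p : X → Prop}

theorem cls_eq_cls {x x' : {x // p x}} : cls x = cls x' ↔ x.1 ≈ x'.1 := Quotient.eq

theorem exists_cls_eq (c : Classes p) : ∃ x, cls x = c := Quotient.exists_rep c

variable {Y A : Type*} [Setoid Y] {q : Y → Prop} [AddCommGroup A] {H : AddSubgroup A}
  {R : X → A → Y → Prop}

/-- A relation that relates isomorphism classes bijectively is given by a bijection. -/
theorem exists_classes_equiv
    (exists_right : ∀ x, p x → ∃ a y, q y ∧ R x a y)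
    (exists_left : ∀ a y, q y → ∃ x, p x ∧ R x a y)
    (unique_right : ∀ {x a y a' y'}, p x → R x a y → R x a' y' →
      (QuotientAddGroup.mk a : A ⧸ H) = QuotientAddGroup.mk a' ∧ y ≈ y')
    (unique_left : ∀ {x x' a y}, R x a y → R x' a y → x ≈ x')
    (congr_left : ∀ {x x' a y}, R x a y → x ≈ x' → R x' a y)
    (congr_right : ∀ {x a y y'}, R x a y → y ≈ y' → R x a y')
    (congr_mk : ∀ {x a a' y}, R x a y →
      (QuotientAddGroup.mk a : A ⧸ H) = QuotientAddGroup.mk a' → R x a' y) :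
    ∃ Φ : Classes p ≃ (A ⧸ H) × Classes q, ∀ (x : {x // p x}) (a : A) (y : {y // q y}),
      Φ (cls x) = (QuotientAddGroup.mk a, cls y) ↔ R x.1 a y.1 := by
  choose a y hq hR using exists_right
  let f₀ : {x // p x} → (A ⧸ H) × Classes q := fun x =>
    (QuotientAddGroup.mk (a x.1 x.2), cls ⟨y x.1 x.2, hq x.1 x.2⟩)
  -- The chosen pair depends on the representative, but `unique_right` and `congr_left` make its
  -- class independent of it.
  let f : Classes p → (A ⧸ H) × Classes q := Quotient.lift f₀ fun x x' hx => by
    obtain ⟨h1, h2⟩ := unique_right x'.2 (congr_left (hR x.1 x.2) hx) (hR x'.1 x'.2)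
    exact Prod.ext h1 (cls_eq_cls.mpr h2)
  have hf : ∀ (x : {x // p x}) (b : A) (z : {y // q y}),
      f (cls x) = (QuotientAddGroup.mk b, cls z) ↔ R x.1 b z.1 := by
    intro x b z
    constructor
    · intro h
      obtain ⟨h1, h2⟩ := Prod.ext_iff.mp h
      exact congr_right (congr_mk (hR x.1 x.2) h1) (cls_eq_cls.mp h2)
    · intro h
      obtain ⟨h1, h2⟩ := unique_right x.2 (hR x.1 x.2) h
      exact Prod.ext h1 (cls_eq_cls.mpr h2)
  refine ⟨Equiv.ofBijective f ⟨fun c c' h => ?_, fun ⟨b, d⟩ => ?_⟩, hf⟩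
  · obtain ⟨x, rfl⟩ := exists_cls_eq c
    obtain ⟨x', rfl⟩ := exists_cls_eq c'
    exact cls_eq_cls.mpr (unique_left (hR x.1 x.2)
      ((hf x' (a x.1 x.2) ⟨y x.1 x.2, hq x.1 x.2⟩).mp h.symm))
  · obtain ⟨b, rfl⟩ := QuotientAddGroup.mk_surjective b
    obtain ⟨z, rfl⟩ := exists_cls_eq d
    obtain ⟨x, hx, hxz⟩ := exists_left b z.1 z.2
    exact ⟨cls ⟨x, hx⟩, (hf _ _ _).mpr hxz⟩

end Classes

/-! ### The two classifications -/

section Main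

variable {n : ℕ} {g : Type u} [LieRing g] [LieAlgebra ℂ g]

theorem JMod.IsIrreducible.isIndecomposable {J : JMod.{u, v} n g} (hJ : J.IsIrreducible) :
    J.IsIndecomposable := by
  refine ⟨hJ.1, fun N N' hN _ hc => (hJ.2 N hN).imp_right fun h => ?_⟩
  subst h
  exact eq_bot_of_top_isCompl hc

theorem exists_indecomposable_equiv (n : ℕ) (g : Type u) [LieRing g] [LieAlgebra ℂ g] :
    ∃ Φ : Classes (JMod.IsIndecomposable.{u, v} (n := n) (g := g)) ≃
        ((Fin n → ℂ) ⧸ intLattice n) ×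
          Classes (FDMod.IsIndecomposable.{u, v} (L := PolyLie n g)),
      ∀ (J : {J : JMod.{u, v} n g // J.IsIndecomposable}) (lam : Fin n → ℂ)
        (U : {U : FDMod.{u, v} (PolyLie n g) // U.IsIndecomposable}),
        Φ (cls J) = (QuotientAddGroup.mk lam, cls U) ↔ JetRealizes J.1 lam U.1 := by
  refine exists_classes_equiv (R := JetRealizes) (fun J hJ => ?_) (fun lam U hU => ?_)
    (fun hJ h h' => h.unique h' hJ.1) (fun h h' => h.iso h') (fun h hJ => h.congr_iso hJ)
    (fun h hU => h.congr_equiv hU) (fun h hl => h.shift hl)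
  · obtain ⟨lam, U, h⟩ := hJ.exists_jetRealizes
    exact ⟨lam, U, h.isIndecomposable_iff.mp hJ, h⟩
  · obtain ⟨J, h⟩ := exists_jetRealizes lam U
    exact ⟨J, h.isIndecomposable_iff.mpr hU, h⟩

/-- An irreducible module is indecomposable, so it comes from some `U`; this `U` is irreducible and
hence pulled back along `linHom`. Surjectivity of `linHom` transfers irreducibility and isomorphism
in both directions. -/
theorem exists_irreducible_equiv (n : ℕ) (g : Type u) [LieRing g] [LieAlgebra ℂ g] :
    ∃ Ψ : Classes (JMod.IsIrreducible.{u, v} (n := n) (g := g)) ≃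
        ((Fin n → ℂ) ⧸ intLattice n) ×
          Classes (FDMod.IsIrreducible.{u, v} (L := Matrix (Fin n) (Fin n) ℂ × g)),
      ∀ (J : {J : JMod.{u, v} n g // J.IsIrreducible}) (lam : Fin n → ℂ)
        (V : {V : FDMod.{u, v} (Matrix (Fin n) (Fin n) ℂ × g) // V.IsIrreducible}),
        Ψ (cls J) = (QuotientAddGroup.mk lam, cls V) ↔ TensorRealizes J.1 lam V.1 := by
  simp only [tensorRealizes_iff]
  refine exists_classes_equiv (R := fun J lam V => JetRealizes J lam (FDMod.pull (linHom n g) V))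
    (fun J hJ => ?_) (fun lam V hV => ?_) (fun hJ h h' => ?_) (fun h h' => h.iso h')
    (fun h hJ => h.congr_iso hJ)
    (fun h hV => h.congr_equiv ((FDMod.pull_equiv_iff linHom_surjective).mpr hV))
    (fun h hl => h.shift hl)
  · obtain ⟨lam, U, h⟩ := hJ.isIndecomposable.exists_jetRealizes
    obtain ⟨V, hV⟩ := (h.isIrreducible_iff.mp hJ).exists_pull
    have h' := h.congr_equiv hV
    exact ⟨lam, V, (FDMod.isIrreducible_pull_iff linHom_surjective).mp
      (h'.isIrreducible_iff.mp hJ), h'⟩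
  · obtain ⟨J, h⟩ := exists_jetRealizes lam (V.pull (linHom n g))
    exact ⟨J, h.isIrreducible_iff.mpr
      ((FDMod.isIrreducible_pull_iff linHom_surjective).mpr hV), h⟩
  · obtain ⟨h1, h2⟩ := h.unique h' hJ.1
    exact ⟨h1, (FDMod.pull_equiv_iff linHom_surjective).mp h2⟩

end Main

end

end JetModules

theorem theorem4 (n : ℕ) (g : Type u) [LieRing g] [LieAlgebra ℂ g] [FiniteDimensional ℂ g] :
    -- (a)
    (∀ J : JetModules.JMod.{u, v} n g, J.IsPolynomial) ∧
    -- (b)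
    (∃ Φ : JetModules.Classes (JetModules.JMod.IsIndecomposable.{u, v} (n := n) (g := g)) ≃
        ((Fin n → ℂ) ⧸ JetModules.intLattice n) ×
          JetModules.Classes
            (JetModules.FDMod.IsIndecomposable.{u, v} (L := JetModules.PolyLie n g)),
      ∀ (J : {J : JetModules.JMod.{u, v} n g // J.IsIndecomposable}) (lam : Fin n → ℂ)
        (U : {U : JetModules.FDMod.{u, v} (JetModules.PolyLie n g) // U.IsIndecomposable}),
        Φ (JetModules.cls J) = (QuotientAddGroup.mk lam, JetModules.cls U) ↔
          JetModules.JetRealizes J.1 lam U.1) ∧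
    -- (c)
    (∃ Ψ : JetModules.Classes (JetModules.JMod.IsIrreducible.{u, v} (n := n) (g := g)) ≃
        ((Fin n → ℂ) ⧸ JetModules.intLattice n) ×
          JetModules.Classes
            (JetModules.FDMod.IsIrreducible.{u, v} (L := Matrix (Fin n) (Fin n) ℂ × g)),
      ∀ (J : {J : JetModules.JMod.{u, v} n g // J.IsIrreducible}) (lam : Fin n → ℂ)
        (V : {V : JetModules.FDMod.{u, v} (Matrix (Fin n) (Fin n) ℂ × g) // V.IsIrreducible}),
        Ψ (JetModules.cls J) = (QuotientAddGroup.mk lam, JetModules.cls V) ↔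
          JetModules.TensorRealizes J.1 lam V.1) :=
  ⟨JetModules.isPolynomial, JetModules.exists_indecomposable_equiv n g,
    JetModules.exists_irreducible_equiv n g⟩
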